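/- Theorem. Let $(M,g)$ be a smooth Lorentzian manifold of dimension $n>3$, with signature $(-,+,\dots,+)$, Levi-Civita connection $\nabla$, Ricci tensor $R_{kl}$, scalar curvature $R$ and Weyl tensor $C_{jklm}$. Let $u$ be a smooth vector field on $M$ with $u_ju^j=-1$, and suppose that $M$ is a perfect-fluid space-time with velocity $u$: there are scalar fields $A,B$ with $R_{kl}=A\,g_{kl}+B\,u_ku_l$. Let $\xi$ be the corresponding eigenvalue of the Ricci tensor, $R_{kl}u^l=\xi u_k$. Suppose that $$u^j\nabla^mC_{jklm}=0\qquad\text{and}\qquad u^k\nabla_ku_j=0 .$$ Let $U=\{p\in M: R(p)\neq n\,\xi(p)\}$. Then: (1) on $U$ the field $u$ is torse-forming: there is a smooth scalar field $\varphi$ on $U$ with $\nabla_ju_k=\varphi\,(g_{jk}+u_ju_k)$ on $U$; (2) $(M,g)$ is a generalized Robertson-Walker (GRW) space-time near every point of $U$: each $p\in U$ has a coordinate neighbourhood with coordinates $(t,y)$ ranging over a product $I\times V$ of an open interval $I$ and an open set $V\subseteq\mathbb R^{n-1}$, in which $$ds^2=-dt^2+a(t)^2\,g^*_{\mu\nu}(y)\,dy^\mu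 dy^\nu$$ with a smooth function $a>0$ on $I$ and a smooth Riemannian metric $g^*$ on $V$; (3) at every point where $R=n\xi$ the Ricci tensor is Einstein, $R_{kl}=\tfrac{R}{n}\,g_{kl}$. In particular, if $R\neq n\xi$ everywhere, then $u$ is torse-forming on $M$ and $M$ is (locally) a GRW space-time. -/

import Mathlib

open scoped Manifold ContDiff Bundle

noncomputable section

/-! Tensor calculus in one coordinate system on an open part of `ℝⁿ`. A metric is given by the
matrix `G x` of its components `g_ij(x)`. All index sums are written out. -/
namespace Coord

variable {n : ℕ}

/-- The partial derivative `∂_k f` at `x`. -/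
def pd (k : Fin n) (f : EuclideanSpace ℝ (Fin n) → ℝ) (x : EuclideanSpace ℝ (Fin n)) : ℝ :=
  fderiv ℝ f x (EuclideanSpace.single k 1)

/-- The Christoffel symbol `Γ^i_{jk} = ½ g^{il} (∂_j g_{lk} + ∂_k g_{lj} - ∂_l g_{jk})`. -/
def christoffel (G : EuclideanSpace ℝ (Fin n) → Matrix (Fin n) (Fin n) ℝ) (i j k : Fin n)
    (x : EuclideanSpace ℝ (Fin n)) : ℝ :=
  (1 / 2 : ℝ) * ∑ l, (G x)⁻¹ i l *
    (pd j (fun y => G y l k) x + pd k (fun y => G y l j) x - pd l (fun y => G y j k) x)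

/-- The curvature
`R^i_{jkl} = ∂_k Γ^i_{lj} - ∂_l Γ^i_{kj} + Γ^i_{kp} Γ^p_{lj} - Γ^i_{lp} Γ^p_{kj}`. -/
def riemannUp (G : EuclideanSpace ℝ (Fin n) → Matrix (Fin n) (Fin n) ℝ) (i j k l : Fin n)
    (x : EuclideanSpace ℝ (Fin n)) : ℝ :=
  pd k (christoffel G i l j) x - pd l (christoffel G i k j) x
    + ∑ p, (christoffel G i k p x * christoffel G p l j x
          - christoffel G i l p x * christoffel G p k j x)

/-- The curvature tensor `R_{ijkl} = g_{ip} R^p_{jkl}`. -/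
def riemann (G : EuclideanSpace ℝ (Fin n) → Matrix (Fin n) (Fin n) ℝ) (i j k l : Fin n)
    (x : EuclideanSpace ℝ (Fin n)) : ℝ :=
  ∑ p, G x i p * riemannUp G p j k l x

/-- The Ricci tensor `R_{jl} = R^i_{jil}` (positive on round spheres). -/
def ricci (G : EuclideanSpace ℝ (Fin n) → Matrix (Fin n) (Fin n) ℝ) (j l : Fin n)
    (x : EuclideanSpace ℝ (Fin n)) : ℝ :=
  ∑ i, riemannUp G i j i l x

/-- The scalar curvature `R = g^{jl} R_{jl}`. -/
def scalar (G : EuclideanSpace ℝ (Fin n) → Matrix (Fin n) (Fin n) ℝ)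
    (x : EuclideanSpace ℝ (Fin n)) : ℝ :=
  ∑ j, ∑ l, (G x)⁻¹ j l * ricci G j l x

/-- The Weyl tensor `C_{ijkl}` (for `n ≥ 3`). -/
def weyl (G : EuclideanSpace ℝ (Fin n) → Matrix (Fin n) (Fin n) ℝ) (i j k l : Fin n)
    (x : EuclideanSpace ℝ (Fin n)) : ℝ :=
  riemann G i j k l x
    - 1 / ((n : ℝ) - 2) *
      (ricci G i k x * G x j l - ricci G i l x * G x j k
        + ricci G j l x * G x i k - ricci G j k x * G x i l)
    + scalar G x / (((n : ℝ) - 1) * ((n : ℝ) - 2)) *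
      (G x i k * G x j l - G x i l * G x j k)

/-- The covariant derivative `∇_p C_{jklm}` of the Weyl tensor. -/
def covWeyl (G : EuclideanSpace ℝ (Fin n) → Matrix (Fin n) (Fin n) ℝ) (p j k l m : Fin n)
    (x : EuclideanSpace ℝ (Fin n)) : ℝ :=
  pd p (weyl G j k l m) x
    - ∑ q, (christoffel G q p j x * weyl G q k l m x
          + christoffel G q p k x * weyl G j q l m x
          + christoffel G q p l x * weyl G j k q m x
          + christoffel G q p m x * weyl G j k l q x)

/-- The divergence `∇^m C_{jklm} = g^{pm} ∇_p C_{jklm}` of the Weyl tensor. -/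
def divWeyl (G : EuclideanSpace ℝ (Fin n) → Matrix (Fin n) (Fin n) ℝ) (j k l : Fin n)
    (x : EuclideanSpace ℝ (Fin n)) : ℝ :=
  ∑ p, ∑ m, (G x)⁻¹ p m * covWeyl G p j k l m x

/-- The covector `v_j = g_{jk} v^k`. -/
def lower (G : EuclideanSpace ℝ (Fin n) → Matrix (Fin n) (Fin n) ℝ)
    (v : EuclideanSpace ℝ (Fin n) → Fin n → ℝ) (j : Fin n)
    (x : EuclideanSpace ℝ (Fin n)) : ℝ :=
  ∑ k, G x j k * v x k

/-- The covariant derivative `∇_k v_l = ∂_k v_l - Γ^m_{kl} v_m`. -/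
def covLower (G : EuclideanSpace ℝ (Fin n) → Matrix (Fin n) (Fin n) ℝ)
    (v : EuclideanSpace ℝ (Fin n) → Fin n → ℝ) (k l : Fin n)
    (x : EuclideanSpace ℝ (Fin n)) : ℝ :=
  pd k (lower G v l) x - ∑ m, christoffel G m k l x * lower G v m x

end Coord

/-- A smooth Lorentzian metric on a smooth `n`-manifold, with signature `(-, +, …, +)`: at each
point some vector is time-like and the metric is positive definite on its orthogonal complement. -/
structure LorentzianMetric (n : ℕ) (M : Type*) [TopologicalSpace M]
    [ChartedSpace (EuclideanSpace ℝ (Fin n)) M] [IsManifold (𝓡 n) ∞ M] where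
  inner (p : M) : TangentSpace (𝓡 n) p →L[ℝ] TangentSpace (𝓡 n) p →L[ℝ] ℝ
  symm (p : M) (v w : TangentSpace (𝓡 n) p) : inner p v w = inner p w v
  lorentzian (p : M) : ∃ v : TangentSpace (𝓡 n) p, inner p v v < 0 ∧
    ∀ w : TangentSpace (𝓡 n) p, inner p v w = 0 → w ≠ 0 → 0 < inner p w w
  contMDiff : ContMDiff (𝓡 n)
    ((𝓡 n).prod 𝓘(ℝ, EuclideanSpace ℝ (Fin n) →L[ℝ] EuclideanSpace ℝ (Fin n) →L[ℝ] ℝ)) ∞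
    (fun p : M => Bundle.TotalSpace.mk'
      (EuclideanSpace ℝ (Fin n) →L[ℝ] EuclideanSpace ℝ (Fin n) →L[ℝ] ℝ)
      (E := fun p : M => TangentSpace (𝓡 n) p →L[ℝ] TangentSpace (𝓡 n) p →L[ℝ] ℝ) p (inner p))

namespace LorentzianMetric

variable {n : ℕ} {M : Type*} [TopologicalSpace M] [ChartedSpace (EuclideanSpace ℝ (Fin n)) M]
  [IsManifold (𝓡 n) ∞ M]

/-- The coordinate vector `∂_i` of the chart `e` at the point with coordinates `x`. -/
def coordVector (e : OpenPartialHomeomorph M (EuclideanSpace ℝ (Fin n)))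
    (x : EuclideanSpace ℝ (Fin n)) (i : Fin n) : TangentSpace (𝓡 n) (e.symm x) :=
  mfderiv (𝓡 n) (𝓡 n) e.symm x
    (show TangentSpace (𝓡 n) x from EuclideanSpace.single i (1 : ℝ))

/-- The matrix of components `g_ij = g(∂_i, ∂_j)` in the chart `e`. -/
def comp (g : LorentzianMetric n M) (e : OpenPartialHomeomorph M (EuclideanSpace ℝ (Fin n)))
    (x : EuclideanSpace ℝ (Fin n)) : Matrix (Fin n) (Fin n) ℝ :=
  Matrix.of fun i j => g.inner (e.symm x) (coordVector e x i) (coordVector e x j)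

/-- The components `u^i` of a vector field in the chart `e`. -/
def vecComp (u : ∀ p : M, TangentSpace (𝓡 n) p)
    (e : OpenPartialHomeomorph M (EuclideanSpace ℝ (Fin n)))
    (x : EuclideanSpace ℝ (Fin n)) (i : Fin n) : ℝ :=
  (show EuclideanSpace ℝ (Fin n) from
    mfderiv (𝓡 n) (𝓡 n) e (e.symm x) (u (e.symm x))) i

/-- The covariant components `u_i = g_{ij} u^j` in the chart `e`. -/
def lowComp (g : LorentzianMetric n M) (u : ∀ p : M, TangentSpace (𝓡 n) p)
    (e : OpenPartialHomeomorph M (EuclideanSpace ℝ (Fin n))) (i : Fin n)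
    (x : EuclideanSpace ℝ (Fin n)) : ℝ :=
  Coord.lower (g.comp e) (vecComp u e) i x

/-- The scalar curvature at a point, computed in the preferred chart there (the value does not
depend on the chart). -/
def scalarCurvature (g : LorentzianMetric n M) (p : M) : ℝ :=
  Coord.scalar (g.comp (chartAt (EuclideanSpace ℝ (Fin n)) p))
    (chartAt (EuclideanSpace ℝ (Fin n)) p p)

/-! Tensor equations are required in every chart of the maximal smooth atlas. -/

/-- The Ricci tensor has the form `R_{kl} = A g_{kl} + B u_k u_l` with scalar fields `A`, `B`. -/
def IsPerfectFluid (g : LorentzianMetric n M) (u : ∀ p : M, TangentSpace (𝓡 n) p) : Prop :=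
  ∃ A B : M → ℝ, ∀ e ∈ IsManifold.maximalAtlas (𝓡 n) ∞ M, ∀ x ∈ e.target, ∀ k l,
    Coord.ricci (g.comp e) k l x =
      A (e.symm x) * g.comp e x k l + B (e.symm x) * (g.lowComp u e k x * g.lowComp u e l x)

/-- `R_{kl} u^l = ξ u_k`. -/
def IsRicciEigenvector (g : LorentzianMetric n M) (u : ∀ p : M, TangentSpace (𝓡 n) p)
    (ξ : M → ℝ) : Prop :=
  ∀ e ∈ IsManifold.maximalAtlas (𝓡 n) ∞ M, ∀ x ∈ e.target, ∀ k,
    ∑ l, Coord.ricci (g.comp e) k l x * vecComp u e x l = ξ (e.symm x) * g.lowComp u e k x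

/-- `u^j ∇^m C_{jklm} = 0`. -/
def ContractedDivWeylVanishes (g : LorentzianMetric n M)
    (u : ∀ p : M, TangentSpace (𝓡 n) p) : Prop :=
  ∀ e ∈ IsManifold.maximalAtlas (𝓡 n) ∞ M, ∀ x ∈ e.target, ∀ k l,
    ∑ j, vecComp u e x j * Coord.divWeyl (g.comp e) j k l x = 0

/-- `u^k ∇_k u_j = 0`. -/
def IsGeodesicField (g : LorentzianMetric n M) (u : ∀ p : M, TangentSpace (𝓡 n) p) : Prop :=
  ∀ e ∈ IsManifold.maximalAtlas (𝓡 n) ∞ M, ∀ x ∈ e.target, ∀ j,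
    ∑ k, vecComp u e x k * Coord.covLower (g.comp e) (vecComp u e) k j x = 0

/-- On `U`, `∇_j u_k = φ (g_{jk} + u_j u_k)` for a smooth scalar field `φ`. -/
def IsTorseFormingOn (g : LorentzianMetric n M) (u : ∀ p : M, TangentSpace (𝓡 n) p)
    (U : Set M) : Prop :=
  ∃ φ : M → ℝ, ContMDiffOn (𝓡 n) 𝓘(ℝ, ℝ) ∞ φ U ∧
    ∀ e ∈ IsManifold.maximalAtlas (𝓡 n) ∞ M, ∀ x ∈ e.target, e.symm x ∈ U → ∀ j k,
      Coord.covLower (g.comp e) (vecComp u e) j k x =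
        φ (e.symm x) * (g.comp e x j k + g.lowComp u e j x * g.lowComp u e k x)

/-- At `p`, `R_{kl} = (R / n) g_{kl}`. -/
def IsEinsteinAt (g : LorentzianMetric n M) (p : M) : Prop :=
  ∀ e ∈ IsManifold.maximalAtlas (𝓡 n) ∞ M, p ∈ e.source → ∀ k l,
    Coord.ricci (g.comp e) k l (e p) = g.scalarCurvature p / n * g.comp e (e p) k l

/-- Near `p` the manifold is a generalized Robertson-Walker space-time: some smooth chart around
`p` maps onto a product `I × V` of an open interval and an open set `V ⊆ ℝᵐ`, and in it
`ds² = -dt² + a(t)² g*_{μν}(y) dy^μ dy^ν` with a smooth positive scale function `a` on `I` and a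
smooth Riemannian metric `g*` on `V`. The coordinate `0` is `t`, the others are `y`. -/
def IsGRWNear {m : ℕ} {M : Type*} [TopologicalSpace M]
    [ChartedSpace (EuclideanSpace ℝ (Fin (m + 1))) M] [IsManifold (𝓡 (m + 1)) ∞ M]
    (g : LorentzianMetric (m + 1) M) (p : M) : Prop :=
  ∃ e ∈ IsManifold.maximalAtlas (𝓡 (m + 1)) ∞ M, p ∈ e.source ∧
  ∃ (I : Set ℝ) (V : Set (EuclideanSpace ℝ (Fin m))) (a : ℝ → ℝ)
    (gs : EuclideanSpace ℝ (Fin m) → Matrix (Fin m) (Fin m) ℝ),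
    IsOpen I ∧ I.OrdConnected ∧ IsOpen V ∧
    e.target = {x | x 0 ∈ I ∧ WithLp.toLp 2 (fun μ : Fin m => x μ.succ) ∈ V} ∧
    ContDiffOn ℝ ∞ a I ∧ (∀ t ∈ I, 0 < a t) ∧
    (∀ μ ν, ContDiffOn ℝ ∞ (fun y => gs y μ ν) V) ∧ (∀ y ∈ V, (gs y).PosDef) ∧
    ∀ x ∈ e.target,
      g.comp e x 0 0 = -1 ∧
      (∀ μ : Fin m, g.comp e x 0 μ.succ = 0 ∧ g.comp e x μ.succ 0 = 0) ∧
      ∀ μ ν : Fin m, g.comp e x μ.succ ν.succ =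
        a (x 0) ^ 2 * gs (WithLp.toLp 2 (fun κ : Fin m => x κ.succ)) μ ν

end LorentzianMetric

end

/-! Write the Ricci tensor as `A g + B u⊗u`. Tracing and applying it to `u` give `R = nA - B` and `ξ
= A - B`, so `R - nξ = (n - 1) B`. The set `U` is therefore the set where `B ≠ 0`, and where `B = 0`
the Ricci tensor is `A g`, which is claim (3).

The second Bianchi identity expresses the divergence of the Weyl tensor through `∇Ric` and `∇R`,
with the factor `(n - 3)/(n - 2)`, which is nonzero for `n > 3` (`divWeyl_eq`). Contracting with
`u^j` and using that `u` is unit and geodesic gives a formula for `B ∇_k u_l` in terms of `g`, `u`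
and the gradients of `A` and `B` (`weyl_equation`). A further contraction with `u^l`, together with
the contracted Bianchi identity projected orthogonally to `u`, gives two linear equations for the
spatial gradients of `A` and `B`. The system is nonsingular because its determinant is proportional
to `(n - 2)^2`, so both gradients vanish (`pd_coeff`). What remains is `-B ∇_k u_l = (A' -
R'/(2(n-1))) (g_{kl} + u_k u_l)` (`neg_mul_covLower`), with `'` the derivative along `u`; dividing
by `B` on `U` gives claim (1).

For claim (2), `∇u` is symmetric on `U`, so the one-form `-u♭` is closed and locally equals `dT`,
with `T` growing at unit rate along `u`. Flowing along `u` and using `T` as time gives coordinates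
with `u = ∂_t`, `g_00 = -1`, `g_0μ = 0` (`exists_flowBox`, `exists_comoving_chart`). There `∇_μ u_ν
= ½ ∂_t g_μν`, hence `∂_t g_μν = 2φ g_μν`. Since `A` and `B` depend on `t` only, so does `φ`, and
this linear equation integrates to `g_μν(t,y) = a(t)² g_μν(0,y)` (`exists_scale`).

The smooth flow is obtained by applying the inverse function theorem to the integral equation in a
space of continuous curves. -/

noncomputable section

namespace Coord

open Matrix

variable {n : ℕ} {O : Set (EuclideanSpace ℝ (Fin n))} {x : EuclideanSpace ℝ (Fin n)}
  {f h : EuclideanSpace ℝ (Fin n) → ℝ}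
  {A B : EuclideanSpace ℝ (Fin n) → Matrix (Fin n) (Fin n) ℝ}
  {G : EuclideanSpace ℝ (Fin n) → Matrix (Fin n) (Fin n) ℝ}

/-! ### Partial derivatives -/

theorem pd_congr (hO : IsOpen O) (hx : x ∈ O) (hfh : ∀ y ∈ O, f y = h y) (k : Fin n) :
    pd k f x = pd k h x := by
  have : f =ᶠ[nhds x] h := Filter.eventually_of_mem (hO.mem_nhds hx) hfh
  rw [pd, pd, this.fderiv_eq]

theorem pd_const (c : ℝ) (k : Fin n) : pd k (fun _ => c) x = 0 := by simp [pd]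

theorem pd_add (hf : DifferentiableAt ℝ f x) (hh : DifferentiableAt ℝ h x) (k : Fin n) :
    pd k (fun y => f y + h y) x = pd k f x + pd k h x := by
  simp [pd, fderiv_fun_add hf hh]

theorem pd_sub (hf : DifferentiableAt ℝ f x) (hh : DifferentiableAt ℝ h x) (k : Fin n) :
    pd k (fun y => f y - h y) x = pd k f x - pd k h x := by
  simp [pd, fderiv_fun_sub hf hh]

theorem pd_mul (hf : DifferentiableAt ℝ f x) (hh : DifferentiableAt ℝ h x) (k : Fin n) :
    pd k (fun y => f y * h y) x = pd k f x * h x + f x * pd k h x := by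
  simp [pd, fderiv_fun_mul hf hh]; ring

theorem pd_const_mul (hf : DifferentiableAt ℝ f x) (c : ℝ) (k : Fin n) :
    pd k (fun y => c * f y) x = c * pd k f x := by
  simp [pd, fderiv_const_mul hf]

theorem pd_sum {ι : Type*} {s : Finset ι} {F : ι → EuclideanSpace ℝ (Fin n) → ℝ}
    (hF : ∀ i ∈ s, DifferentiableAt ℝ (F i) x) (k : Fin n) :
    pd k (fun y => ∑ i ∈ s, F i y) x = ∑ i ∈ s, pd k (F i) x := by
  simp [pd, fderiv_fun_sum hF]

theorem contDiffOn_pd (hO : IsOpen O) (hf : ContDiffOn ℝ ∞ f O) (k : Fin n) :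
    ContDiffOn ℝ ∞ (pd k f) O :=
  (hf.fderiv_of_isOpen hO (by simp)).clm_apply contDiffOn_const

theorem differentiableAt_of_contDiffOn {F : Type*} [NormedAddCommGroup F] [NormedSpace ℝ F]
    {f : EuclideanSpace ℝ (Fin n) → F} (hO : IsOpen O) (hf : ContDiffOn ℝ ∞ f O)
    (hx : x ∈ O) : DifferentiableAt ℝ f x :=
  (hf.differentiableOn (by simp)).differentiableAt (hO.mem_nhds hx)

theorem pd_pd_comm (hO : IsOpen O) (hf : ContDiffOn ℝ ∞ f O) (hx : x ∈ O) (k l : Fin n) :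
    pd k (pd l f) x = pd l (pd k f) x := by
  have hd : DifferentiableAt ℝ (fderiv ℝ f) x :=
    differentiableAt_of_contDiffOn hO (hf.fderiv_of_isOpen hO (by simp)) hx
  have hs : IsSymmSndFDerivAt ℝ f x :=
    (hf.contDiffAt (hO.mem_nhds hx)).isSymmSndFDerivAt (by simpa using ENat.LEInfty.out)
  have key : ∀ i j : Fin n, pd i (pd j f) x =
      fderiv ℝ (fderiv ℝ f) x (EuclideanSpace.single i 1) (EuclideanSpace.single j 1) := by
    intro i j
    change fderiv ℝ (fun y => fderiv ℝ f y (EuclideanSpace.single j 1)) x _ = _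
    rw [fderiv_clm_apply hd (by fun_prop)]
    simp
  rw [key, key]
  exact hs _ _

/-- The entrywise partial derivative of a matrix-valued function. -/
def pdM (k : Fin n) (A : EuclideanSpace ℝ (Fin n) → Matrix (Fin n) (Fin n) ℝ)
    (x : EuclideanSpace ℝ (Fin n)) : Matrix (Fin n) (Fin n) ℝ :=
  Matrix.of fun i j => pd k (fun y => A y i j) x

/-- A matrix-valued function with smooth entries on `O`. -/
def SmoothM (O : Set (EuclideanSpace ℝ (Fin n)))
    (A : EuclideanSpace ℝ (Fin n) → Matrix (Fin n) (Fin n) ℝ) : Prop :=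
  ∀ i j, ContDiffOn ℝ ∞ (fun y => A y i j) O

theorem SmoothM.differentiableAt (hA : SmoothM O A) (hO : IsOpen O) (hx : x ∈ O) (i j : Fin n) :
    DifferentiableAt ℝ (fun y => A y i j) x :=
  differentiableAt_of_contDiffOn hO (hA i j) hx

theorem SmoothM.mul (hA : SmoothM O A) (hB : SmoothM O B) : SmoothM O (fun y => A y * B y) := by
  intro i j
  simp only [Matrix.mul_apply]
  exact ContDiffOn.sum fun l _ => (hA i l).mul (hB l j)

theorem SmoothM.add (hA : SmoothM O A) (hB : SmoothM O B) : SmoothM O (fun y => A y + B y) :=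
  fun i j => (hA i j).add (hB i j)

theorem SmoothM.sub (hA : SmoothM O A) (hB : SmoothM O B) : SmoothM O (fun y => A y - B y) :=
  fun i j => (hA i j).sub (hB i j)

theorem SmoothM.transpose (hA : SmoothM O A) : SmoothM O (fun y => (A y)ᵀ) :=
  fun i j => hA j i

theorem SmoothM.pdM (hA : SmoothM O A) (hO : IsOpen O) (k : Fin n) : SmoothM O (pdM k A) :=
  fun i j => contDiffOn_pd hO (hA i j) k

theorem pdM_congr (hO : IsOpen O) (hx : x ∈ O) (hAB : ∀ y ∈ O, A y = B y) (k : Fin n) :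
    pdM k A x = pdM k B x := by
  ext i j
  exact pd_congr hO hx (fun y hy => by rw [hAB y hy]) k

theorem pdM_mul (hO : IsOpen O) (hA : SmoothM O A) (hB : SmoothM O B) (hx : x ∈ O) (k : Fin n) :
    pdM k (fun y => A y * B y) x = pdM k A x * B x + A x * pdM k B x := by
  ext i j
  simp only [pdM, Matrix.mul_apply, Matrix.add_apply, Matrix.of_apply]
  rw [pd_sum (F := fun l y => A y i l * B y l j)
    fun l _ => (hA.differentiableAt hO hx i l).mul (hB.differentiableAt hO hx l j),
    ← Finset.sum_add_distrib]
  exact Finset.sum_congr rfl fun l _ =>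
    pd_mul (hA.differentiableAt hO hx i l) (hB.differentiableAt hO hx l j) k

theorem pdM_add (hO : IsOpen O) (hA : SmoothM O A) (hB : SmoothM O B) (hx : x ∈ O) (k : Fin n) :
    pdM k (fun y => A y + B y) x = pdM k A x + pdM k B x := by
  ext i j
  exact pd_add (hA.differentiableAt hO hx i j) (hB.differentiableAt hO hx i j) k

theorem pdM_sub (hO : IsOpen O) (hA : SmoothM O A) (hB : SmoothM O B) (hx : x ∈ O) (k : Fin n) :
    pdM k (fun y => A y - B y) x = pdM k A x - pdM k B x := by
  ext i j
  exact pd_sub (hA.differentiableAt hO hx i j) (hB.differentiableAt hO hx i j) k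

theorem pdM_transpose (k : Fin n) : pdM k (fun y => (A y)ᵀ) x = (pdM k A x)ᵀ := rfl

theorem pdM_const (M : Matrix (Fin n) (Fin n) ℝ) (k : Fin n) : pdM k (fun _ => M) x = 0 := by
  ext i j
  exact pd_const _ k

theorem pdM_pdM_comm (hO : IsOpen O) (hA : SmoothM O A) (hx : x ∈ O) (k l : Fin n) :
    pdM k (pdM l A) x = pdM l (pdM k A) x := by
  ext i j
  exact pd_pd_comm hO (hA i j) hx k l

/-! ### The Levi-Civita connection -/

/-- `G` is a smooth pseudo-Riemannian metric on the open set `O`. -/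
structure IsMetricOn (G : EuclideanSpace ℝ (Fin n) → Matrix (Fin n) (Fin n) ℝ)
    (O : Set (EuclideanSpace ℝ (Fin n))) : Prop where
  isOpen : IsOpen O
  smooth : SmoothM O G
  symm : ∀ y ∈ O, (G y)ᵀ = G y
  isUnit_det : ∀ y ∈ O, IsUnit (G y).det

/-- The matrix `(Γ_k)^i_j = Γ^i_{kj}`. -/
def connection (G : EuclideanSpace ℝ (Fin n) → Matrix (Fin n) (Fin n) ℝ) (k : Fin n)
    (x : EuclideanSpace ℝ (Fin n)) : Matrix (Fin n) (Fin n) ℝ :=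
  Matrix.of fun i j => christoffel G i k j x

/-- The matrix `(K_{kl})^i_j = R^i_{jkl}`. -/
def curvature (G : EuclideanSpace ℝ (Fin n) → Matrix (Fin n) (Fin n) ℝ) (k l : Fin n)
    (x : EuclideanSpace ℝ (Fin n)) : Matrix (Fin n) (Fin n) ℝ :=
  pdM k (connection G l) x - pdM l (connection G k) x
    + (connection G k x * connection G l x - connection G l x * connection G k x)

/-- The matrix form hides two of the indices in matrix products, so that the curvature identities
become computations in a noncommutative ring. -/
theorem riemannUp_eq (i j k l : Fin n) : riemannUp G i j k l x = curvature G k l x i j := by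
  simp [riemannUp, curvature, connection, pdM, Matrix.mul_apply]

theorem riemann_eq (i j k l : Fin n) : riemann G i j k l x = (G x * curvature G k l x) i j := by
  simp [riemann, riemannUp_eq, Matrix.mul_apply]

theorem ricci_eq (j l : Fin n) : ricci G j l x = ∑ i, curvature G i l x i j := by
  simp [ricci, riemannUp_eq]

namespace IsMetricOn

variable (hG : IsMetricOn G O)
include hG

theorem apply_comm (hx : x ∈ O) (i j : Fin n) : G x i j = G x j i :=
  congrFun (congrFun (hG.symm x hx) j) i

theorem inv_apply_comm (hx : x ∈ O) (i j : Fin n) : (G x)⁻¹ i j = (G x)⁻¹ j i := by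
  have : ((G x)⁻¹)ᵀ = (G x)⁻¹ := by rw [Matrix.transpose_nonsing_inv, hG.symm x hx]
  exact congrFun (congrFun this j) i

theorem mul_inv (hx : x ∈ O) : G x * (G x)⁻¹ = 1 :=
  Matrix.mul_nonsing_inv _ (hG.isUnit_det x hx)

theorem inv_mul (hx : x ∈ O) : (G x)⁻¹ * G x = 1 :=
  Matrix.nonsing_inv_mul _ (hG.isUnit_det x hx)

/-- Cramer's rule: determinants are polynomials in the entries, and each adjugate entry is again the
determinant of a matrix with smooth entries. -/
theorem smooth_inv : SmoothM O (fun y => (G y)⁻¹) := by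
  have hdet : ∀ {A : EuclideanSpace ℝ (Fin n) → Matrix (Fin n) (Fin n) ℝ}, SmoothM O A →
      ContDiffOn ℝ ∞ (fun y => (A y).det) O := by
    intro A hA
    simp only [Matrix.det_apply]
    exact ContDiffOn.sum fun σ _ => (contDiffOn_prod fun i _ => hA (σ i) i).const_smul _
  intro i j
  simp only [Matrix.inv_def, Ring.inverse_eq_inv', Matrix.smul_apply, smul_eq_mul,
    Matrix.adjugate_apply]
  refine ((hdet hG.smooth).inv fun y hy => (hG.isUnit_det y hy).ne_zero).mul (hdet ?_)
  intro a b
  by_cases hab : a = j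
  · subst hab; simpa using contDiffOn_const
  · simpa [Matrix.updateRow_ne hab] using hG.smooth a b

theorem contDiffOn_christoffel (i j k : Fin n) : ContDiffOn ℝ ∞ (christoffel G i j k) O := by
  refine contDiffOn_const.mul (ContDiffOn.sum fun l _ => (hG.smooth_inv i l).mul ?_)
  exact ((contDiffOn_pd hG.isOpen (hG.smooth l k) j).add
    (contDiffOn_pd hG.isOpen (hG.smooth l j) k)).sub (contDiffOn_pd hG.isOpen (hG.smooth j k) l)

theorem smooth_connection (k : Fin n) : SmoothM O (connection G k) :=
  fun i j => hG.contDiffOn_christoffel i k j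

theorem smooth_curvature (k l : Fin n) : SmoothM O (curvature G k l) :=
  (((hG.smooth_connection l).pdM hG.isOpen k).sub ((hG.smooth_connection k).pdM hG.isOpen l)).add
    (((hG.smooth_connection k).mul (hG.smooth_connection l)).sub
      ((hG.smooth_connection l).mul (hG.smooth_connection k)))

theorem contDiffOn_riemann (i j k l : Fin n) : ContDiffOn ℝ ∞ (riemann G i j k l) O := by
  have : riemann G i j k l = fun y => (G y * curvature G k l y) i j := funext fun y => riemann_eq ..
  rw [this]
  exact (hG.smooth.mul (hG.smooth_curvature k l)) i j

theorem contDiffOn_ricci (j l : Fin n) : ContDiffOn ℝ ∞ (ricci G j l) O := by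
  have : ricci G j l = fun y => ∑ i, curvature G i l y i j := funext fun y => ricci_eq ..
  rw [this]
  exact ContDiffOn.sum fun i _ => hG.smooth_curvature i l i j

theorem contDiffOn_scalar : ContDiffOn ℝ ∞ (scalar G) O :=
  ContDiffOn.sum fun j _ => ContDiffOn.sum fun l _ =>
    (hG.smooth_inv j l).mul (hG.contDiffOn_ricci j l)

theorem pd_comm (hx : x ∈ O) (i j k : Fin n) :
    pd k (fun y => G y i j) x = pd k (fun y => G y j i) x :=
  pd_congr hG.isOpen hx (fun _ hy => hG.apply_comm hy i j) k

theorem christoffel_comm (hx : x ∈ O) (i j k : Fin n) :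
    christoffel G i j k x = christoffel G i k j x := by
  simp only [christoffel]
  congr 1
  refine Finset.sum_congr rfl fun l _ => ?_
  rw [hG.pd_comm hx j k l]
  ring

theorem sum_mul_christoffel (hx : x ∈ O) (i j k : Fin n) :
    ∑ p, G x i p * christoffel G p j k x = (1 / 2 : ℝ) *
      (pd j (fun y => G y i k) x + pd k (fun y => G y i j) x - pd i (fun y => G y j k) x) := by
  have key := congrFun (congrArg (fun M => M *ᵥ (fun l => (1 / 2 : ℝ) *
      (pd j (fun y => G y l k) x + pd k (fun y => G y l j) x - pd l (fun y => G y j k) x)))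
      (hG.mul_inv hx)) i
  simp only [← Matrix.mulVec_mulVec, Matrix.one_mulVec] at key
  rw [← key]
  simp only [Matrix.mulVec, dotProduct, christoffel, Finset.mul_sum]
  refine Finset.sum_congr rfl fun p _ => Finset.sum_congr rfl fun l _ => ?_
  ring

/-- Metric compatibility `∇g = 0`. Lowering the index of the Christoffel symbols cancels the inverse
metric, and two of the resulting first-kind symbols add up to a single derivative of `g`. -/
theorem pdM_metric (hx : x ∈ O) (k : Fin n) :
    pdM k G x = (connection G k x)ᵀ * G x + G x * connection G k x := by
  ext i j
  simp only [pdM, connection, Matrix.add_apply, Matrix.mul_apply, Matrix.transpose_apply,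
    Matrix.of_apply]
  have h1 : ∑ p, christoffel G p k i x * G x p j = ∑ p, G x j p * christoffel G p k i x :=
    Finset.sum_congr rfl fun p _ => by rw [hG.apply_comm hx p j, mul_comm]
  rw [h1, hG.sum_mul_christoffel hx, hG.sum_mul_christoffel hx, hG.pd_comm hx j i k,
    hG.pd_comm hx j k i, hG.pd_comm hx i k j]
  ring

theorem pdM_inv (hx : x ∈ O) (k : Fin n) :
    pdM k (fun y => (G y)⁻¹) x =
      -(connection G k x * (G x)⁻¹ + (G x)⁻¹ * (connection G k x)ᵀ) := by
  have h0 : pdM k (fun y => (G y)⁻¹ * G y) x = 0 := by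
    rw [pdM_congr hG.isOpen hx (fun y hy => hG.inv_mul hy), pdM_const]
  rw [pdM_mul hG.isOpen hG.smooth_inv hG.smooth hx, hG.pdM_metric hx] at h0
  have h1 := congrArg (fun M => M * (G x)⁻¹) h0
  simp only [add_mul, mul_add, Matrix.mul_assoc, hG.mul_inv hx, zero_mul, mul_one] at h1
  rw [← Matrix.mul_assoc, hG.inv_mul hx, one_mul] at h1
  rw [eq_neg_iff_add_eq_zero, ← h1]
  abel

/-! ### Symmetries of the curvature -/

omit hG in
theorem curvature_swap (k l : Fin n) : curvature G l k x = -curvature G k l x := by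
  simp only [curvature]; abel

/-- Antisymmetry in the first pair of indices: differentiating `∇g = 0` once more and using that
second partial derivatives of `g` commute leaves exactly the curvature acting on `g`. -/
theorem metric_mul_curvature (hx : x ∈ O) (k l : Fin n) :
    G x * curvature G k l x + (G x * curvature G k l x)ᵀ = 0 := by
  have hs := pdM_pdM_comm hG.isOpen hG.smooth hx k l
  have hc : ∀ a b, pdM a (pdM b G) x =
      (pdM a (connection G b) x)ᵀ * G x + (connection G b x)ᵀ * pdM a G x +
      (pdM a G x * connection G b x + G x * pdM a (connection G b) x) := by
    intro a b
    have hC := hG.smooth_connection b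
    rw [pdM_congr hG.isOpen hx (fun y hy => hG.pdM_metric hy b),
      pdM_add hG.isOpen (hC.transpose.mul hG.smooth) (hG.smooth.mul hC) hx,
      pdM_mul hG.isOpen hC.transpose hG.smooth hx, pdM_mul hG.isOpen hG.smooth hC hx,
      pdM_transpose]
  rw [hc, hc, hG.pdM_metric hx, hG.pdM_metric hx, ← sub_eq_zero] at hs
  rw [← hs]
  simp only [curvature, Matrix.transpose_mul, hG.symm x hx, Matrix.transpose_add,
    Matrix.transpose_sub]
  noncomm_ring

theorem riemann_swap_left (hx : x ∈ O) (i j k l : Fin n) :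
    riemann G i j k l x = -riemann G j i k l x := by
  have := congrFun (congrFun (hG.metric_mul_curvature hx k l) i) j
  rw [riemann_eq, riemann_eq, eq_neg_iff_add_eq_zero]
  exact this

omit hG in
theorem riemann_swap_right (i j k l : Fin n) :
    riemann G i j k l x = -riemann G i j l k x := by
  rw [riemann_eq, riemann_eq, curvature_swap l k]
  simp

/-- The first Bianchi identity; it uses only that the connection is torsion-free, `Γ^i_{jk} =
Γ^i_{kj}`. -/
theorem curvature_cyclic (hx : x ∈ O) (i j k l : Fin n) :
    curvature G k l x i j + curvature G l j x i k + curvature G j k x i l = 0 := by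
  have h1 : ∀ a b c, pd a (fun y => connection G b y i c) x
      = pd a (fun y => connection G c y i b) x := fun a b c =>
    pd_congr hG.isOpen hx (fun y hy => hG.christoffel_comm hy i b c) a
  have h2 : ∀ a b c, ∑ p, connection G a x i p * connection G b x p c =
      ∑ p, connection G a x i p * connection G c x p b := fun a b c =>
    Finset.sum_congr rfl fun p _ => by
      rw [show connection G b x p c = connection G c x p b from hG.christoffel_comm hx p b c]
  simp only [curvature, pdM, Matrix.add_apply, Matrix.sub_apply, Matrix.of_apply, Matrix.mul_apply]
  rw [h1 k l j, h1 l k j, h1 j k l, h2 k l j, h2 l k j, h2 j k l]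
  ring

theorem riemann_cyclic (hx : x ∈ O) (i j k l : Fin n) :
    riemann G i j k l x + riemann G i k l j x + riemann G i l j k x = 0 := by
  simp only [riemann, riemannUp_eq, ← Finset.sum_add_distrib, ← mul_add,
    hG.curvature_cyclic hx, mul_zero, Finset.sum_const_zero]

/-- A formal consequence of the two antisymmetries and four instances of the first Bianchi identity,
one for each index in first place. -/
theorem riemann_pair (hx : x ∈ O) (i j k l : Fin n) :
    riemann G i j k l x = riemann G k l i j x := by
  have c1 := hG.riemann_cyclic hx i j k l
  have c2 := hG.riemann_cyclic hx j k l i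
  have c3 := hG.riemann_cyclic hx k l i j
  have c4 := hG.riemann_cyclic hx l i j k
  have a := hG.riemann_swap_left hx
  have b := fun i j k l => riemann_swap_right (G := G) (x := x) i j k l
  linarith [a i j k l, a i k l j, a i l j k, a j k l i, a j l i k, a j i k l, a k l i j, a k i j l,
    a k j l i, a l i j k, a l j k i, a l k i j, b i j k l, b i k l j, b i l j k, b j k l i,
    b j l i k, b j i k l, b k l i j, b k i j l, b k j l i, b l i j k, b l j k i, b l k i j]

end IsMetricOn
end Coord
end

noncomputable section

namespace Coord

open Matrix

variable {n : ℕ} {O : Set (EuclideanSpace ℝ (Fin n))} {x : EuclideanSpace ℝ (Fin n)}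
  {G : EuclideanSpace ℝ (Fin n) → Matrix (Fin n) (Fin n) ℝ}

/-! ### Covariant derivatives -/

/-- The covariant derivative `∇_p S_{jk}`. -/
def cov2 (G : EuclideanSpace ℝ (Fin n) → Matrix (Fin n) (Fin n) ℝ)
    (S : Fin n → Fin n → EuclideanSpace ℝ (Fin n) → ℝ) (p j k : Fin n)
    (x : EuclideanSpace ℝ (Fin n)) : ℝ :=
  pd p (S j k) x - ∑ q, (christoffel G q p j x * S q k x + christoffel G q p k x * S j q x)

/-- The covariant derivative `∇_p T_{jklm}`. -/
def cov4 (G : EuclideanSpace ℝ (Fin n) → Matrix (Fin n) (Fin n) ℝ)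
    (T : Fin n → Fin n → Fin n → Fin n → EuclideanSpace ℝ (Fin n) → ℝ) (p j k l m : Fin n)
    (x : EuclideanSpace ℝ (Fin n)) : ℝ :=
  pd p (T j k l m) x
    - ∑ q, (christoffel G q p j x * T q k l m x + christoffel G q p k x * T j q l m x
          + christoffel G q p l x * T j k q m x + christoffel G q p m x * T j k l q x)

theorem covWeyl_eq (p j k l m : Fin n) : covWeyl G p j k l m x = cov4 G (weyl G) p j k l m x := rfl

/-- The matrix `(∇_p K_{lm})^i_j = ∇_p R^i_{jlm}`. -/
def covCurvature (G : EuclideanSpace ℝ (Fin n) → Matrix (Fin n) (Fin n) ℝ) (p l m : Fin n)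
    (x : EuclideanSpace ℝ (Fin n)) : Matrix (Fin n) (Fin n) ℝ :=
  pdM p (curvature G l m) x
    + (connection G p x * curvature G l m x - curvature G l m x * connection G p x)
    - (∑ q, connection G p x q l • curvature G q m x + ∑ q, connection G p x q m • curvature G l q x)

variable {S S' : Fin n → Fin n → EuclideanSpace ℝ (Fin n) → ℝ}
  {T T' : Fin n → Fin n → Fin n → Fin n → EuclideanSpace ℝ (Fin n) → ℝ}

theorem cov4_add (hT : ∀ i j k l, DifferentiableAt ℝ (T i j k l) x)
    (hT' : ∀ i j k l, DifferentiableAt ℝ (T' i j k l) x) (p j k l m : Fin n) :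
    cov4 G (fun i j k l y => T i j k l y + T' i j k l y) p j k l m x =
      cov4 G T p j k l m x + cov4 G T' p j k l m x := by
  simp only [cov4, pd_add (hT _ _ _ _) (hT' _ _ _ _)]
  have : ∀ a b c d : ℝ, a + b - (c + d) = a - c + (b - d) := fun _ _ _ _ => by ring
  rw [← this, ← Finset.sum_add_distrib]
  congr 1
  exact Finset.sum_congr rfl fun q _ => by ring

theorem cov4_const_mul (hT : ∀ i j k l, DifferentiableAt ℝ (T i j k l) x) (c : ℝ)
    (p j k l m : Fin n) :
    cov4 G (fun i j k l y => c * T i j k l y) p j k l m x = c * cov4 G T p j k l m x := by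
  simp only [cov4, pd_const_mul (hT _ _ _ _), mul_sub, Finset.mul_sum]
  congr 1
  exact Finset.sum_congr rfl fun q _ => by ring

/-- The Leibniz rule for `S_{ik} S'_{jl}`. -/
theorem cov4_mul (hS : ∀ i j, DifferentiableAt ℝ (S i j) x)
    (hS' : ∀ i j, DifferentiableAt ℝ (S' i j) x) (p i j k l : Fin n) :
    cov4 G (fun i j k l y => S i k y * S' j l y) p i j k l x =
      cov2 G S p i k x * S' j l x + S i k x * cov2 G S' p j l x := by
  simp only [cov4, cov2, pd_mul (hS _ _) (hS' _ _), mul_sub, sub_mul, Finset.mul_sum,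
    Finset.sum_mul]
  have : ∀ a b c d : ℝ, a + b - (c + d) = a - c + (b - d) := fun _ _ _ _ => by ring
  rw [← this, ← Finset.sum_add_distrib]
  congr 1
  exact Finset.sum_congr rfl fun q _ => by ring

/-- This lemma and the next two say that `∇` commutes with permuting slots. They carry the
symmetries of the Riemann tensor over to `∇Riem` and reduce the four terms of a product with `g` to
one Leibniz rule. -/
theorem cov4_swap_right (p i j k l : Fin n) :
    cov4 G (fun i j k l y => T i j l k y) p i j k l x = cov4 G T p i j l k x := by
  simp only [cov4]
  congr 1
  exact Finset.sum_congr rfl fun q _ => by ring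

theorem cov4_swap_left (p i j k l : Fin n) :
    cov4 G (fun i j k l y => T j i k l y) p i j k l x = cov4 G T p j i k l x := by
  simp only [cov4]
  congr 1
  exact Finset.sum_congr rfl fun q _ => by ring

theorem cov4_swap_pair (p i j k l : Fin n) :
    cov4 G (fun i j k l y => T k l i j y) p i j k l x = cov4 G T p k l i j x := by
  simp only [cov4]
  congr 1
  exact Finset.sum_congr rfl fun q _ => by ring

theorem cov4_congr (hO : IsOpen O) (hx : x ∈ O)
    (h : ∀ y ∈ O, ∀ i j k l, T i j k l y = T' i j k l y) (p i j k l : Fin n) :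
    cov4 G T p i j k l x = cov4 G T' p i j k l x := by
  simp only [cov4, h x hx, pd_congr hO hx fun y hy => h y hy i j k l]

theorem cov2_congr (hO : IsOpen O) (hx : x ∈ O) (h : ∀ y ∈ O, ∀ i j, S i j y = S' i j y)
    (p i j : Fin n) : cov2 G S p i j x = cov2 G S' p i j x := by
  simp only [cov2, h x hx, pd_congr hO hx fun y hy => h y hy i j]

theorem covCurvature_cyclic_aux {R : Type*} [AddCommGroup R] {a b c d e f : R}
    (h : a + c + e = b + d + f) : (a - b) + (c - d) + (e - f) = 0 := by
  rw [← sub_eq_zero] at h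
  rw [← h]; abel

namespace IsMetricOn

variable (hG : IsMetricOn G O)
include hG

theorem cov2_metric (hx : x ∈ O) (p j k : Fin n) : cov2 G (fun i j y => G y i j) p j k x = 0 := by
  have h := congrFun (congrFun (hG.pdM_metric hx p) j) k
  simp only [pdM, connection, Matrix.add_apply, Matrix.mul_apply, Matrix.transpose_apply,
    Matrix.of_apply] at h
  simp only [cov2, h, Finset.sum_add_distrib]
  rw [sub_eq_zero]
  congr 1
  exact Finset.sum_congr rfl fun q _ => mul_comm _ _

theorem connection_comm (hx : x ∈ O) (i j k : Fin n) :
    connection G k x i j = connection G j x i k := hG.christoffel_comm hx i k j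

/-- The second Bianchi identity. -/
theorem covCurvature_cyclic (hx : x ∈ O) (p l m : Fin n) :
    covCurvature G p l m x + covCurvature G l m p x + covCurvature G m p l x = 0 := by
  have hC := hG.smooth_connection
  have hD : ∀ a b c, pdM a (curvature G b c) x =
      pdM a (pdM b (connection G c)) x - pdM a (pdM c (connection G b)) x
      + (pdM a (connection G b) x * connection G c x + connection G b x * pdM a (connection G c) x
        - (pdM a (connection G c) x * connection G b x
          + connection G c x * pdM a (connection G b) x)) := by
    intro a b c
    have h1 := (hC c).pdM hG.isOpen b
    have h2 := (hC b).pdM hG.isOpen c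
    unfold curvature
    rw [pdM_add hG.isOpen (h1.sub h2) (((hC b).mul (hC c)).sub ((hC c).mul (hC b))) hx,
      pdM_sub hG.isOpen h1 h2 hx,
      pdM_sub hG.isOpen ((hC b).mul (hC c)) ((hC c).mul (hC b)) hx,
      pdM_mul hG.isOpen (hC b) (hC c) hx, pdM_mul hG.isOpen (hC c) (hC b) hx]
  -- The Christoffel terms acting on the two form indices cancel in pairs over the cyclic sum, as
  -- `Γ` is symmetric and `K` antisymmetric in those indices. What is left is the Jacobi identity
  -- and the commutation of partial derivatives.
  have hs : ∀ a b c, ∑ q, connection G a x q b • curvature G c q x =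
      -∑ q, connection G b x q a • curvature G q c x := by
    intro a b c
    rw [← Finset.sum_neg_distrib]
    refine Finset.sum_congr rfl fun q _ => ?_
    rw [curvature_swap q c, hG.connection_comm hx, smul_neg]
  unfold covCurvature
  rw [covCurvature_cyclic_aux]
  · rw [hs p m l, hs l p m, hs m l p, hD, hD, hD,
      pdM_pdM_comm hG.isOpen (hC m) hx p l, pdM_pdM_comm hG.isOpen (hC l) hx p m,
      pdM_pdM_comm hG.isOpen (hC p) hx l m]
    simp only [curvature]
    noncomm_ring

/-- Lowering the first index commutes with `∇` because `∇g = 0`. -/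
theorem cov4_riemann (hx : x ∈ O) (p j k l m : Fin n) :
    cov4 G (riemann G) p j k l m x = (G x * covCurvature G p l m x) j k := by
  have h1 : pd p (riemann G j k l m) x = (pdM p (fun y => G y * curvature G l m y) x) j k :=
    pd_congr hG.isOpen hx (fun y _ => riemann_eq ..) p
  have e1 : ∑ q, christoffel G q p j x * (G x * curvature G l m x) q k
      = ((connection G p x)ᵀ * (G x * curvature G l m x)) j k := rfl
  have e2 : ∑ q, christoffel G q p k x * (G x * curvature G l m x) j q
      = ((G x * curvature G l m x) * connection G p x) j k :=
    Finset.sum_congr rfl fun q _ => mul_comm _ _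
  have e3 : ∑ q, christoffel G q p l x * (G x * curvature G q m x) j k
      = (G x * ∑ q, connection G p x q l • curvature G q m x) j k := by
    rw [Finset.mul_sum, Matrix.sum_apply]
    exact Finset.sum_congr rfl fun q _ => by simp [connection]
  have e4 : ∑ q, christoffel G q p m x * (G x * curvature G l q x) j k
      = (G x * ∑ q, connection G p x q m • curvature G l q x) j k := by
    rw [Finset.mul_sum, Matrix.sum_apply]
    exact Finset.sum_congr rfl fun q _ => by simp [connection]
  simp only [cov4, h1, riemann_eq, Finset.sum_add_distrib, e1, e2, e3, e4]
  rw [pdM_mul hG.isOpen hG.smooth (hG.smooth_curvature l m) hx, hG.pdM_metric hx, covCurvature]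
  simp only [← Matrix.add_apply, ← Matrix.sub_apply]
  refine congrFun (congrFun ?_ j) k
  noncomm_ring

/-- Contraction commutes with `∇`: the Christoffel terms of the contracted upper and lower indices
cancel (`e1`). -/
theorem sum_covCurvature (hx : x ∈ O) (k l j : Fin n) :
    ∑ p, covCurvature G k p j x p l = cov2 G (ricci G) k l j x := by
  have h1 : pd k (ricci G l j) x = ∑ i, pdM k (curvature G i j) x i l := by
    rw [pd_congr hG.isOpen hx (h := fun y => ∑ i, curvature G i j y i l) (fun y _ => ricci_eq ..) k]
    exact pd_sum (fun i _ => (hG.smooth_curvature i j).differentiableAt hG.isOpen hx i l) k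
  have e1 : ∑ p, (connection G k x * curvature G p j x) p l =
      ∑ p, ∑ q, connection G k x q p * curvature G q j x p l := by
    simp only [Matrix.mul_apply]
    exact Finset.sum_comm
  have e2 : ∑ p, (curvature G p j x * connection G k x) p l =
      ∑ q, christoffel G q k l x * ∑ p, curvature G p j x p q := by
    simp only [Matrix.mul_apply, Finset.mul_sum]
    rw [Finset.sum_comm]
    exact Finset.sum_congr rfl fun q _ => Finset.sum_congr rfl fun p _ => mul_comm _ _
  have e3 : ∑ p, ∑ q, connection G k x q j * curvature G p q x p l =
      ∑ q, christoffel G q k j x * ∑ p, curvature G p q x p l := by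
    simp only [Finset.mul_sum]
    exact Finset.sum_comm
  simp only [covCurvature, cov2, h1, ricci_eq, Matrix.add_apply, Matrix.sub_apply,
    Matrix.sum_apply, Matrix.smul_apply, smul_eq_mul, Finset.sum_add_distrib,
    Finset.sum_sub_distrib, e1, e2, e3]
  ring

/-! ### Contractions -/

theorem sum_inv_mul (hx : x ∈ O) (a b : Fin n) : ∑ q, (G x)⁻¹ a q * G x q b = if a = b then 1 else 0 := by
  rw [← Matrix.mul_apply, hG.inv_mul hx, Matrix.one_apply]

theorem sum_inv_mul_metric_mul (hx : x ∈ O) (M : Fin n → Matrix (Fin n) (Fin n) ℝ) (j : Fin n) :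
    ∑ p, ∑ m, (G x)⁻¹ p m * (G x * M p) m j = ∑ p, M p p j := by
  refine Finset.sum_congr rfl fun p _ => ?_
  rw [← Matrix.mul_apply, ← Matrix.mul_assoc, hG.inv_mul hx, one_mul]

theorem sum_inv_mul_left (hx : x ∈ O) (X : Fin n → ℝ) (k : Fin n) :
    ∑ p, ∑ m, (G x)⁻¹ p m * (X p * G x k m) = X k := by
  have : ∀ p m, (G x)⁻¹ p m * (X p * G x k m) = X p * ((G x)⁻¹ p m * G x m k) := fun p m => by
    rw [hG.apply_comm hx k m]; ring
  simp only [this, ← Finset.mul_sum, hG.sum_inv_mul hx]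
  simp

theorem ricci_eq_sum (hx : x ∈ O) (j l : Fin n) :
    ricci G j l x = ∑ p, ∑ m, (G x)⁻¹ p m * riemann G m j p l x := by
  simp only [riemann_eq, ricci_eq]
  exact (hG.sum_inv_mul_metric_mul hx (fun p => curvature G p l x) j).symm

theorem ricci_comm (hx : x ∈ O) (j l : Fin n) : ricci G j l x = ricci G l j x := by
  rw [hG.ricci_eq_sum hx, hG.ricci_eq_sum hx, Finset.sum_comm]
  refine Finset.sum_congr rfl fun p _ => Finset.sum_congr rfl fun m _ => ?_
  rw [hG.riemann_pair hx, hG.inv_apply_comm hx]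

theorem cov2_ricci_comm (hx : x ∈ O) (p j k : Fin n) :
    cov2 G (ricci G) p j k x = cov2 G (ricci G) p k j x := by
  simp only [cov2, pd_congr hG.isOpen hx (fun y hy => hG.ricci_comm hy j k) p]
  congr 1
  refine Finset.sum_congr rfl fun q _ => ?_
  rw [hG.ricci_comm hx q k, hG.ricci_comm hx j q]
  ring

theorem differentiableAt_riemann (hx : x ∈ O) (i j k l : Fin n) :
    DifferentiableAt ℝ (riemann G i j k l) x :=
  differentiableAt_of_contDiffOn hG.isOpen (hG.contDiffOn_riemann i j k l) hx

theorem differentiableAt_ricci (hx : x ∈ O) (j l : Fin n) : DifferentiableAt ℝ (ricci G j l) x :=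
  differentiableAt_of_contDiffOn hG.isOpen (hG.contDiffOn_ricci j l) hx

theorem cov4_riemann_swap_left (hx : x ∈ O) (p i j k l : Fin n) :
    cov4 G (riemann G) p i j k l x = -cov4 G (riemann G) p j i k l x := by
  rw [cov4_congr (T' := fun i j k l y => -1 * riemann G j i k l y) hG.isOpen hx
    (fun y hy i j k l => by rw [hG.riemann_swap_left hy]; ring),
    cov4_const_mul (T := fun i j k l y => riemann G j i k l y)
      (fun i j k l => hG.differentiableAt_riemann hx j i k l), cov4_swap_left]
  ring

theorem cov4_riemann_swap_right (hx : x ∈ O) (p i j k l : Fin n) :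
    cov4 G (riemann G) p i j k l x = -cov4 G (riemann G) p i j l k x := by
  rw [cov4_congr (T' := fun i j k l y => -1 * riemann G i j l k y) hG.isOpen hx
    (fun y hy i j k l => by rw [riemann_swap_right]; ring),
    cov4_const_mul (T := fun i j k l y => riemann G i j l k y)
      (fun i j k l => hG.differentiableAt_riemann hx i j l k), cov4_swap_right]
  ring

theorem cov4_riemann_pair (hx : x ∈ O) (p i j k l : Fin n) :
    cov4 G (riemann G) p i j k l x = cov4 G (riemann G) p k l i j x := by
  rw [cov4_congr (T' := fun i j k l y => riemann G k l i j y) hG.isOpen hx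
    (fun y hy i j k l => hG.riemann_pair hy i j k l), cov4_swap_pair]

omit hG in
theorem covCurvature_swap (p l m : Fin n) : covCurvature G p m l x = -covCurvature G p l m x := by
  have h : pdM p (curvature G m l) x = -pdM p (curvature G l m) x := by
    ext i j
    have : (fun y => curvature G m l y i j) = fun y => -curvature G l m y i j := by
      funext y; rw [curvature_swap l m]; rfl
    simp [pdM, this, pd, fderiv_fun_neg]
  simp only [covCurvature, h, curvature_swap l m, curvature_swap _ m, curvature_swap l, smul_neg,
    Finset.sum_neg_distrib]
  noncomm_ring

/-- `∇^m R_{jklm} = ∇_k R_{lj} - ∇_j R_{lk}`. -/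
theorem div_riemann (hx : x ∈ O) (j k l : Fin n) :
    ∑ p, ∑ m, (G x)⁻¹ p m * cov4 G (riemann G) p j k l m x =
      cov2 G (ricci G) k l j x - cov2 G (ricci G) j l k x := by
  -- The pair symmetry moves the contracted index `m` into the first slot, where raising it turns
  -- the divergence into a trace of `covCurvature`; the second Bianchi identity then applies to that
  -- trace.
  have h1 : ∀ p m, cov4 G (riemann G) p j k l m x = (G x * covCurvature G p k j x) m l := by
    intro p m
    rw [hG.cov4_riemann_pair hx, hG.cov4_riemann_swap_left hx, hG.cov4_riemann_swap_right hx,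
      neg_neg, hG.cov4_riemann hx]
  simp only [h1]
  rw [hG.sum_inv_mul_metric_mul hx (fun p => covCurvature G p k j x), ← hG.sum_covCurvature hx,
    ← hG.sum_covCurvature hx, ← Finset.sum_sub_distrib]
  refine Finset.sum_congr rfl fun p _ => ?_
  have h2 := congrFun (congrFun (hG.covCurvature_cyclic hx p k j) p) l
  rw [covCurvature_swap k p j] at h2
  simp only [Matrix.add_apply, Matrix.neg_apply, Matrix.zero_apply] at h2
  linarith

theorem sum_inv_cov4_riemann (hx : x ∈ O) (p j m : Fin n) :
    ∑ k, ∑ l, (G x)⁻¹ k l * cov4 G (riemann G) p j k l m x = -cov2 G (ricci G) p j m x := by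
  have h1 : ∀ k l, (G x)⁻¹ k l * cov4 G (riemann G) p j k l m x =
      -((G x)⁻¹ l k * (G x * covCurvature G p l m x) k j) := by
    intro k l
    rw [hG.cov4_riemann_swap_left hx, hG.cov4_riemann hx, hG.inv_apply_comm hx]
    ring
  simp only [h1, Finset.sum_neg_distrib]
  rw [Finset.sum_comm, hG.sum_inv_mul_metric_mul hx (fun l => covCurvature G p l m x),
    hG.sum_covCurvature hx]

/-- The trace commutes with `∇`, since the inverse metric is also parallel (`pdM_inv`). -/
theorem pd_scalar (hx : x ∈ O) (j : Fin n) :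
    pd j (scalar G) x = ∑ a, ∑ b, (G x)⁻¹ a b * cov2 G (ricci G) j a b x := by
  have hI := fun a b => hG.smooth_inv.differentiableAt hG.isOpen hx a b
  have hR := hG.differentiableAt_ricci hx
  have h1 : pd j (scalar G) x = ∑ a, ∑ b, (pdM j (fun y => (G y)⁻¹) x a b * ricci G a b x +
      (G x)⁻¹ a b * pd j (ricci G a b) x) := by
    refine (pd_sum (F := fun a y => ∑ b, (G y)⁻¹ a b * ricci G a b y)
      (fun a _ => DifferentiableAt.fun_sum fun b _ => (hI a b).mul (hR a b)) j).trans
      (Finset.sum_congr rfl fun a _ => ?_)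
    refine (pd_sum (F := fun b y => (G y)⁻¹ a b * ricci G a b y)
      (fun b _ => (hI a b).mul (hR a b)) j).trans (Finset.sum_congr rfl fun b _ => ?_)
    exact pd_mul (hI a b) (hR a b) j
  rw [h1, hG.pdM_inv hx]
  have e1 : ∑ a, ∑ b, (connection G j x * (G x)⁻¹) a b * ricci G a b x =
      ∑ a, ∑ b, (G x)⁻¹ a b * ∑ q, christoffel G q j a x * ricci G q b x := by
    simp only [Matrix.mul_apply, Finset.sum_mul, Finset.mul_sum]
    conv_lhs => enter [2, a]; rw [Finset.sum_comm]
    rw [Finset.sum_comm]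
    refine Finset.sum_congr rfl fun a _ => ?_
    rw [Finset.sum_comm]
    refine Finset.sum_congr rfl fun b _ => Finset.sum_congr rfl fun q _ => ?_
    simp only [connection, Matrix.of_apply]
    ring
  have e2 : ∑ a, ∑ b, ((G x)⁻¹ * (connection G j x)ᵀ) a b * ricci G a b x =
      ∑ a, ∑ b, (G x)⁻¹ a b * ∑ q, christoffel G q j b x * ricci G a q x := by
    simp only [Matrix.mul_apply, Finset.sum_mul, Finset.mul_sum]
    refine Finset.sum_congr rfl fun a _ => ?_
    rw [Finset.sum_comm]
    refine Finset.sum_congr rfl fun b _ => Finset.sum_congr rfl fun q _ => ?_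
    simp only [connection, Matrix.of_apply, Matrix.transpose_apply]
    ring
  simp only [cov2, mul_sub, Finset.sum_add_distrib, Finset.sum_sub_distrib, mul_add,
    Matrix.neg_apply, Matrix.add_apply, neg_mul, add_mul, Finset.sum_neg_distrib, e1, e2]
  ring

/-- The contracted Bianchi identity `2 ∇^m R_{jm} = ∇_j R`. -/
theorem two_mul_div_ricci (hx : x ∈ O) (j : Fin n) :
    2 * ∑ p, ∑ m, (G x)⁻¹ p m * cov2 G (ricci G) p j m x = pd j (scalar G) x := by
  -- The double trace of `∇_p R_{jklm}` is computed in both orders: one contracts `div_riemann`, the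
  -- other takes the divergence of Ricci.
  have h : ∑ k, ∑ l, (G x)⁻¹ k l * ∑ p, ∑ m, (G x)⁻¹ p m * cov4 G (riemann G) p j k l m x =
      ∑ p, ∑ m, (G x)⁻¹ p m * ∑ k, ∑ l, (G x)⁻¹ k l * cov4 G (riemann G) p j k l m x := by
    simp only [Finset.mul_sum]
    conv_lhs => enter [2, k]; rw [Finset.sum_comm]
    rw [Finset.sum_comm]
    refine Finset.sum_congr rfl fun p _ => ?_
    conv_lhs => enter [2, k]; rw [Finset.sum_comm]
    rw [Finset.sum_comm]
    refine Finset.sum_congr rfl fun m _ => Finset.sum_congr rfl fun k _ =>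
      Finset.sum_congr rfl fun l _ => ?_
    ring
  simp only [hG.div_riemann hx, hG.sum_inv_cov4_riemann hx, mul_sub, mul_neg,
    Finset.sum_sub_distrib, Finset.sum_neg_distrib] at h
  have e1 : ∑ k, ∑ l, (G x)⁻¹ k l * cov2 G (ricci G) j l k x = pd j (scalar G) x := by
    rw [hG.pd_scalar hx]
    simp only [hG.cov2_ricci_comm hx j]
  have e2 : ∑ k, ∑ l, (G x)⁻¹ k l * cov2 G (ricci G) k l j x =
      ∑ k, ∑ l, (G x)⁻¹ k l * cov2 G (ricci G) k j l x := by
    simp only [hG.cov2_ricci_comm hx _ j]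
  rw [e1, e2] at h
  linarith

/-- `∇_p (r g_{ij}) = ∂_p r g_{ij}`. -/
theorem cov2_mul_metric (hx : x ∈ O) {r : EuclideanSpace ℝ (Fin n) → ℝ}
    (hr : DifferentiableAt ℝ r x) (p i j : Fin n) :
    cov2 G (fun i j y => r y * G y i j) p i j x = pd p r x * G x i j := by
  have h := hG.cov2_metric hx p i j
  simp only [cov2] at h ⊢
  rw [pd_mul hr (hG.smooth.differentiableAt hG.isOpen hx i j), sub_eq_zero.1 h,
    add_sub_assoc, Finset.mul_sum, ← Finset.sum_sub_distrib]
  simp only [add_eq_left]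
  exact Finset.sum_eq_zero fun q _ => by ring

/-- The covariant derivative of `S_{ik} g_{jl} - S_{il} g_{jk} + S_{jl} g_{ik} - S_{jk} g_{il}`. -/
theorem cov4_mul_metric (hx : x ∈ O) (hS : ∀ i j, DifferentiableAt ℝ (S i j) x)
    (p i j k l : Fin n) :
    cov4 G (fun i j k l y => S i k y * G y j l - S i l y * G y j k + S j l y * G y i k
      - S j k y * G y i l) p i j k l x =
    cov2 G S p i k x * G x j l - cov2 G S p i l x * G x j k + cov2 G S p j l x * G x i k
      - cov2 G S p j k x * G x i l := by
  have hg := hG.smooth.differentiableAt hG.isOpen hx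
  have e1 : ∀ p i j k l, cov4 G (fun i j k l y => S i k y * G y j l) p i j k l x =
      cov2 G S p i k x * G x j l := fun p i j k l => by
    rw [cov4_mul (S' := fun i j y => G y i j) hS hg, hG.cov2_metric hx, mul_zero, add_zero]
  have e2 := cov4_swap_right (G := G) (x := x) (T := fun i j k l y => S i k y * G y j l) p
  have e3 := cov4_swap_left (G := G) (x := x) (T := fun i j k l y => S i k y * G y j l) p
  have e4 := cov4_swap_left (G := G) (x := x) (T := fun i j k l y => S i l y * G y j k) p
  rw [show (fun (i j k l : Fin n) (y : EuclideanSpace ℝ (Fin n)) => S i k y * G y j l -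
      S i l y * G y j k + S j l y * G y i k - S j k y * G y i l) = fun i j k l y =>
      ((S i k y * G y j l + S j l y * G y i k) + (-1) * (S i l y * G y j k + S j k y * G y i l))
      from by funext i j k l y; ring]
  rw [cov4_add (T := fun i j k l y => S i k y * G y j l + S j l y * G y i k)
      (T' := fun i j k l y => (-1) * (S i l y * G y j k + S j k y * G y i l)),
    cov4_const_mul (T := fun i j k l y => S i l y * G y j k + S j k y * G y i l),
    cov4_add (T := fun i j k l y => S i k y * G y j l) (T' := fun i j k l y => S j l y * G y i k),
    cov4_add (T := fun i j k l y => S i l y * G y j k) (T' := fun i j k l y => S j k y * G y i l),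
    e1, e2, e1, e3, e1, e4, e2, e1]
  · ring
  all_goals
    intro i j k l
    have h1 := hS i k; have h2 := hS i l; have h3 := hS j k; have h4 := hS j l
    have g1 := hg i k; have g2 := hg i l; have g3 := hg j k; have g4 := hg j l
    fun_prop

/-- The divergence of the Weyl tensor in terms of the Ricci tensor. -/
theorem divWeyl_eq (hn : 3 ≤ n) (hx : x ∈ O) (j k l : Fin n) :
    divWeyl G j k l x = ((n : ℝ) - 3) / (n - 2) *
      (cov2 G (ricci G) k j l x - cov2 G (ricci G) j k l x
        - 1 / (2 * ((n : ℝ) - 1)) * (pd k (scalar G) x * G x j l - pd j (scalar G) x * G x k l)) := by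
  have hr : DifferentiableAt ℝ (scalar G) x :=
    differentiableAt_of_contDiffOn hG.isOpen hG.contDiffOn_scalar hx
  have hg := hG.smooth.differentiableAt hG.isOpen hx
  have hn' : (3 : ℝ) ≤ n := by exact_mod_cast hn
  have h1 : (n : ℝ) - 1 ≠ 0 := by linarith
  have h2 : (n : ℝ) - 2 ≠ 0 := by linarith
  have hW : ∀ p j k l m, covWeyl G p j k l m x = cov4 G (riemann G) p j k l m x
      + (-(1 / ((n : ℝ) - 2)) * (cov2 G (ricci G) p j l x * G x k m
          - cov2 G (ricci G) p j m x * G x k l + cov2 G (ricci G) p k m x * G x j l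
          - cov2 G (ricci G) p k l x * G x j m)
        + 1 / (2 * ((n : ℝ) - 1) * (n - 2)) * (pd p (scalar G) x * G x j l * G x k m
          - pd p (scalar G) x * G x j m * G x k l + pd p (scalar G) x * G x k m * G x j l
          - pd p (scalar G) x * G x k l * G x j m)) := by
    intro p j k l m
    -- The scalar part is written as the same four-term product with `g` as the Ricci part, now with
    -- `S = R g`. Each of its two terms then occurs twice, whence the extra factor 2 in the
    -- denominator.
    rw [covWeyl_eq, show weyl G = fun i j k l y => riemann G i j k l y
      + (-(1 / ((n : ℝ) - 2)) * (ricci G i k y * G y j l - ricci G i l y * G y j k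
          + ricci G j l y * G y i k - ricci G j k y * G y i l)
        + 1 / (2 * ((n : ℝ) - 1) * (n - 2)) * (scalar G y * G y i k * G y j l
          - scalar G y * G y i l * G y j k + scalar G y * G y j l * G y i k
          - scalar G y * G y j k * G y i l)) from by
        funext i j k l y; simp only [weyl]; field_simp; ring]
    rw [cov4_add, cov4_add, cov4_const_mul, cov4_const_mul,
      hG.cov4_mul_metric hx (S := ricci G) (hG.differentiableAt_ricci hx),
      hG.cov4_mul_metric hx (S := fun i j y => scalar G y * G y i j) (fun i j => hr.mul (hg i j))]
    · simp only [hG.cov2_mul_metric hx hr]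
    all_goals
      intro i j k l
      have r1 := hG.differentiableAt_riemann hx i j k l
      have h1 := hG.differentiableAt_ricci hx i k
      have h2 := hG.differentiableAt_ricci hx i l
      have h3 := hG.differentiableAt_ricci hx j k
      have h4 := hG.differentiableAt_ricci hx j l
      have g1 := hg i k; have g2 := hg i l; have g3 := hg j k; have g4 := hg j l
      fun_prop
  have s0 := hG.div_riemann hx j k l
  have s1 := hG.two_mul_div_ricci hx
  have hL := hG.sum_inv_mul_left hx
  have t : ∀ (c : ℝ) (X : Fin n → Fin n → ℝ), ∑ p, ∑ m, (G x)⁻¹ p m * (c * X p m) =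
      c * ∑ p, ∑ m, (G x)⁻¹ p m * X p m := fun c X => by
    simp only [Finset.mul_sum]
    exact Finset.sum_congr rfl fun p _ => Finset.sum_congr rfl fun m _ => by ring
  have hWs : ∀ p m, covWeyl G p j k l m x = cov4 G (riemann G) p j k l m x
      + (-(1 / ((n : ℝ) - 2))) * (cov2 G (ricci G) p j l x * G x k m)
      + (1 / ((n : ℝ) - 2) * G x k l) * cov2 G (ricci G) p j m x
      + (-(1 / ((n : ℝ) - 2)) * G x j l) * cov2 G (ricci G) p k m x
      + (1 / ((n : ℝ) - 2)) * (cov2 G (ricci G) p k l x * G x j m)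
      + (1 / (((n : ℝ) - 1) * (n - 2)) * G x j l) * (pd p (scalar G) x * G x k m)
      + (-(1 / (((n : ℝ) - 1) * (n - 2))) * G x k l) * (pd p (scalar G) x * G x j m) := by
    intro p m
    rw [hW]
    field_simp
    ring
  simp only [divWeyl, hWs, mul_add, Finset.sum_add_distrib, t, s0,
    hL (fun p => cov2 G (ricci G) p j l x), hL (fun p => cov2 G (ricci G) p k l x),
    hL (fun p => pd p (scalar G) x)]
  have d1 : ∑ p, ∑ m, (G x)⁻¹ p m * cov2 G (ricci G) p j m x = pd j (scalar G) x / 2 := by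
    linarith [s1 j]
  have d2 : ∑ p, ∑ m, (G x)⁻¹ p m * cov2 G (ricci G) p k m x = pd k (scalar G) x / 2 := by
    linarith [s1 k]
  rw [d1, d2, hG.cov2_ricci_comm hx k l j, hG.cov2_ricci_comm hx j l k]
  field_simp
  ring

end IsMetricOn
end Coord
end

/-! ### The perfect-fluid equations in one coordinate system. -/

noncomputable section

namespace Coord

open Matrix

variable {n : ℕ} {O : Set (EuclideanSpace ℝ (Fin n))} {x : EuclideanSpace ℝ (Fin n)}
  {G : EuclideanSpace ℝ (Fin n) → Matrix (Fin n) (Fin n) ℝ}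
  {v : EuclideanSpace ℝ (Fin n) → Fin n → ℝ} {A B : EuclideanSpace ℝ (Fin n) → ℝ}

/-- The derivative `v^k ∂_k f` along `v`. -/
def dirDeriv (v : EuclideanSpace ℝ (Fin n) → Fin n → ℝ) (f : EuclideanSpace ℝ (Fin n) → ℝ)
    (x : EuclideanSpace ℝ (Fin n)) : ℝ :=
  ∑ k, v x k * pd k f x

/-- A smooth unit time-like field `v` for the metric `G` on `O` whose Ricci tensor is
`A g_{kl} + B v_k v_l`. -/
structure IsFluidOn (G : EuclideanSpace ℝ (Fin n) → Matrix (Fin n) (Fin n) ℝ)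
    (v : EuclideanSpace ℝ (Fin n) → Fin n → ℝ) (A B : EuclideanSpace ℝ (Fin n) → ℝ)
    (O : Set (EuclideanSpace ℝ (Fin n))) : Prop extends IsMetricOn G O where
  smooth_vec : ∀ i, ContDiffOn ℝ ∞ (fun y => v y i) O
  unit : ∀ y ∈ O, ∑ k, v y k * lower G v k y = -1
  ricci_eq : ∀ y ∈ O, ∀ k l, ricci G k l y = A y * G y k l + B y * (lower G v k y * lower G v l y)

namespace IsFluidOn

variable (h : IsFluidOn G v A B O)
include h

theorem contDiffOn_lower (j : Fin n) : ContDiffOn ℝ ∞ (lower G v j) O :=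
  ContDiffOn.sum fun k _ => (h.smooth j k).mul (h.smooth_vec k)

theorem differentiableAt_lower (hx : x ∈ O) (j : Fin n) : DifferentiableAt ℝ (lower G v j) x :=
  differentiableAt_of_contDiffOn h.isOpen (h.contDiffOn_lower j) hx

theorem sum_inv_mul_lower (hx : x ∈ O) (p : Fin n) :
    ∑ m, (G x)⁻¹ p m * lower G v m x = v x p := by
  have := congrFun (congrArg (fun M => M *ᵥ v x) (h.inv_mul hx)) p
  rw [← Matrix.mulVec_mulVec, Matrix.one_mulVec] at this
  exact this

theorem sum_mul_metric (hx : x ∈ O) (l : Fin n) : ∑ j, v x j * G x j l = lower G v l x :=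
  Finset.sum_congr rfl fun j _ => by rw [h.apply_comm hx, mul_comm]

theorem scalar_eq (hx : x ∈ O) : scalar G x = n * A x - B x := by
  have h1 : ∀ j, ∑ l, (G x)⁻¹ j l * ricci G j l x = A x + B x * (v x j * lower G v j x) := by
    intro j
    have : ∀ l, (G x)⁻¹ j l * ricci G j l x = A x * ((G x)⁻¹ j l * G x l j) +
        B x * lower G v j x * ((G x)⁻¹ j l * lower G v l x) := fun l => by
      rw [h.ricci_eq x hx, h.apply_comm hx]; ring
    simp only [this, Finset.sum_add_distrib, ← Finset.mul_sum, h.sum_inv_mul hx,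
      h.sum_inv_mul_lower hx]
    simp; ring
  simp only [scalar, h1, Finset.sum_add_distrib, ← Finset.mul_sum, h.unit x hx]
  simp
  ring

theorem sum_ricci_mul (hx : x ∈ O) (k : Fin n) :
    ∑ l, ricci G k l x * v x l = (A x - B x) * lower G v k x := by
  have : ∀ l, ricci G k l x * v x l = A x * (G x k l * v x l) +
      B x * lower G v k x * (v x l * lower G v l x) := fun l => by
    rw [h.ricci_eq x hx]; ring
  simp only [this, Finset.sum_add_distrib, ← Finset.mul_sum, h.unit x hx]
  rw [← lower]
  ring

/-- `A` and `B` are not assumed smooth. Solving for them in terms of `R` and `Ric(v, v)` yields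
their smoothness. -/
theorem coeff_eq (hn : 1 < n) (hx : x ∈ O) :
    A x = (scalar G x + ∑ k, v x k * ∑ l, ricci G k l x * v x l) / (n - 1) ∧
    B x = (scalar G x + n * ∑ k, v x k * ∑ l, ricci G k l x * v x l) / (n - 1) := by
  have h1 : ∑ k, v x k * ∑ l, ricci G k l x * v x l = -(A x - B x) := by
    simp only [h.sum_ricci_mul hx]
    have : ∀ k, v x k * ((A x - B x) * lower G v k x) = (A x - B x) * (v x k * lower G v k x) :=
      fun k => by ring
    simp only [this, ← Finset.mul_sum, h.unit x hx]
    ring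
  have hn' : (n : ℝ) - 1 ≠ 0 := by
    have : (1 : ℝ) < n := by exact_mod_cast hn
    linarith
  rw [h1, h.scalar_eq hx]
  constructor <;> field_simp <;> ring

theorem contDiffOn_coeff (hn : 1 < n) : ContDiffOn ℝ ∞ A O ∧ ContDiffOn ℝ ∞ B O := by
  have h1 : ContDiffOn ℝ ∞ (fun x => ∑ k, v x k * ∑ l, ricci G k l x * v x l) O :=
    ContDiffOn.sum fun k _ => (h.smooth_vec k).mul
      (ContDiffOn.sum fun l _ => (h.contDiffOn_ricci k l).mul (h.smooth_vec l))
  constructor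
  · exact ((h.contDiffOn_scalar.add h1).div_const _).congr fun y hy => (h.coeff_eq hn hy).1
  · exact ((h.contDiffOn_scalar.add (contDiffOn_const.mul h1)).div_const _).congr
      fun y hy => (h.coeff_eq hn hy).2

theorem pd_lower (hx : x ∈ O) (k j : Fin n) :
    pd k (lower G v j) x = ∑ i, pd k (fun y => G y j i) x * v x i +
      ∑ i, G x j i * pd k (fun y => v y i) x := by
  have hv := fun i => differentiableAt_of_contDiffOn h.isOpen (h.smooth_vec i) hx
  have hg := h.smooth.differentiableAt h.isOpen hx
  rw [← Finset.sum_add_distrib]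
  exact (pd_sum (F := fun i y => G y j i * v y i) (fun i _ => (hg j i).mul (hv i)) k).trans
    (Finset.sum_congr rfl fun i _ => pd_mul (hg j i) (hv i) k)

/-- `u^j ∇_k u_j = 0` for a unit field. -/
theorem sum_mul_covLower (hx : x ∈ O) (k : Fin n) : ∑ j, v x j * covLower G v k j x = 0 := by
  have hv := fun i => differentiableAt_of_contDiffOn h.isOpen (h.smooth_vec i) hx
  have hu := h.differentiableAt_lower hx
  have h0 : ∑ j, (pd k (fun y => v y j) x * lower G v j x + v x j * pd k (lower G v j) x) = 0 := by
    have e : pd k (fun y => ∑ j, v y j * lower G v j y) x = 0 := by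
      rw [pd_congr h.isOpen hx h.unit, pd_const]
    rw [pd_sum (F := fun j y => v y j * lower G v j y) (fun j _ => (hv j).mul (hu j))] at e
    rw [← e]
    exact Finset.sum_congr rfl fun j _ => (pd_mul (hv j) (hu j) k).symm
  -- With `Q = v^i v^j ∂_k g_ij` and `P = v_j ∂_k v^j`, differentiating `v^j v_j = -1` gives `Q + 2P
  -- = 0`, while `v^j ∇_k v_j = (Q + P) - Q/2`.
  set Q := ∑ j, ∑ i, v x j * (pd k (fun y => G y j i) x * v x i) with hQ
  set P := ∑ j, pd k (fun y => v y j) x * lower G v j x with hP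
  have e1 : ∑ j, v x j * pd k (lower G v j) x = Q + P := by
    simp only [h.pd_lower hx, mul_add, Finset.sum_add_distrib, Finset.mul_sum, hQ, hP]
    congr 1
    rw [Finset.sum_comm]
    refine Finset.sum_congr rfl fun i _ => ?_
    rw [lower, Finset.mul_sum]
    exact Finset.sum_congr rfl fun j _ => by rw [h.apply_comm hx]; ring
  have e2 : ∑ j, v x j * ∑ m, christoffel G m k j x * lower G v m x = Q / 2 := by
    set D := ∑ i, ∑ j, ∑ m, v x i * v x j * (connection G k x m j * G x m i) with hD
    have hD1 : ∑ j, v x j * ∑ m, christoffel G m k j x * lower G v m x = D := by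
      simp only [lower, Finset.mul_sum, hD]
      conv_rhs => rw [Finset.sum_comm]
      refine Finset.sum_congr rfl fun j _ => ?_
      conv_rhs => rw [Finset.sum_comm]
      refine Finset.sum_congr rfl fun m _ => Finset.sum_congr rfl fun i _ => ?_
      simp only [connection, Matrix.of_apply]; ring
    have hD2 : Q = D + D := by
      conv_rhs => enter [1]; rw [hD, Finset.sum_comm]
      rw [hD, hQ, ← Finset.sum_add_distrib]
      refine Finset.sum_congr rfl fun j _ => ?_
      rw [← Finset.sum_add_distrib]
      refine Finset.sum_congr rfl fun i _ => ?_
      have := congrFun (congrFun (h.pdM_metric hx k) j) i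
      simp only [pdM, Matrix.add_apply, Matrix.mul_apply, Matrix.transpose_apply,
        Matrix.of_apply] at this
      rw [this, ← Finset.sum_add_distrib, ← Finset.sum_add_distrib, Finset.sum_mul,
        Finset.mul_sum]
      refine Finset.sum_congr rfl fun m _ => ?_
      rw [h.apply_comm hx j m]; ring
    rw [hD1, hD2]; ring
  rw [Finset.sum_add_distrib, e1, ← hP] at h0
  simp only [covLower, mul_sub, Finset.sum_sub_distrib, e1, e2]
  linarith

theorem cov2_ricci (hn : 1 < n) (hx : x ∈ O) (k j l : Fin n) :
    cov2 G (ricci G) k j l x = pd k A x * G x j l + pd k B x * (lower G v j x * lower G v l x)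
      + B x * (covLower G v k j x * lower G v l x + lower G v j x * covLower G v k l x) := by
  have hA := differentiableAt_of_contDiffOn h.isOpen (h.contDiffOn_coeff hn).1 hx
  have hB := differentiableAt_of_contDiffOn h.isOpen (h.contDiffOn_coeff hn).2 hx
  have hu := h.differentiableAt_lower hx
  have hg := h.smooth.differentiableAt h.isOpen hx
  rw [cov2_congr h.isOpen hx (S' := fun j l y => A y * G y j l + B y * (lower G v j y * lower G v l y))
    h.ricci_eq, ← h.cov2_mul_metric hx hA]
  simp only [cov2, covLower]
  rw [pd_add (f := fun y => A y * G y j l) (h := fun y => B y * (lower G v j y * lower G v l y))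
      (hA.mul (hg j l)) (hB.mul ((hu j).mul (hu l))),
    pd_mul (h := fun y => lower G v j y * lower G v l y) hB ((hu j).mul (hu l)),
    pd_mul (hu j) (hu l)]
  have e : ∀ q, christoffel G q k j x * (A x * G x q l + B x * (lower G v q x * lower G v l x)) +
      christoffel G q k l x * (A x * G x j q + B x * (lower G v j x * lower G v q x)) =
      (christoffel G q k j x * (A x * G x q l) + christoffel G q k l x * (A x * G x j q)) +
      B x * lower G v l x * (christoffel G q k j x * lower G v q x) +
      B x * lower G v j x * (christoffel G q k l x * lower G v q x) := fun q => by ring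
  simp only [e, Finset.sum_add_distrib, ← Finset.mul_sum]
  ring

variable (hn : 3 < n)
  (hW : ∀ y ∈ O, ∀ k l, ∑ j, v y j * divWeyl G j k l y = 0)
  (hgeo : ∀ y ∈ O, ∀ j, ∑ k, v y k * covLower G v k j y = 0)

theorem pd_scalar_eq (hn : 1 < n) (hx : x ∈ O) (k : Fin n) :
    pd k (scalar G) x = n * pd k A x - pd k B x := by
  have hA := differentiableAt_of_contDiffOn h.isOpen (h.contDiffOn_coeff hn).1 hx
  have hB := differentiableAt_of_contDiffOn h.isOpen (h.contDiffOn_coeff hn).2 hx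
  rw [pd_congr h.isOpen hx fun y hy => h.scalar_eq hy, pd_sub (hA.const_mul _) hB, pd_const_mul hA]

include hn hW hgeo in
-- The contraction with `v^j` removes every derivative of `v` except `B ∇_k v_l`: the others contain
-- `v^j ∇_k v_j` or `v^j ∇_j v`. The common factor `(n - 3)/(n - 2)` is cancelled, which needs `n >
-- 3`.
theorem weyl_equation (hx : x ∈ O) (k l : Fin n) :
    lower G v l x * pd k A x - lower G v l x * pd k B x - B x * covLower G v k l x
      - G x k l * dirDeriv v A x - lower G v k x * lower G v l x * dirDeriv v B x
    = 1 / (2 * ((n : ℝ) - 1)) * (lower G v l x * (n * pd k A x - pd k B x)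
      - G x k l * (n * dirDeriv v A x - dirDeriv v B x)) := by
  have hn1 : 1 < n := by omega
  have hn' : (3 : ℝ) < n := by exact_mod_cast hn
  have hne : ((n : ℝ) - 3) / (n - 2) ≠ 0 := div_ne_zero (by linarith) (by linarith)
  have h0 := hW x hx k l
  simp only [h.divWeyl_eq hn.le hx] at h0
  have t : ∀ j, v x j * (((n : ℝ) - 3) / (n - 2) * (cov2 G (ricci G) k j l x
      - cov2 G (ricci G) j k l x - 1 / (2 * ((n : ℝ) - 1)) *
        (pd k (scalar G) x * G x j l - pd j (scalar G) x * G x k l))) =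
      ((n : ℝ) - 3) / (n - 2) * ((pd k A x - 1 / (2 * ((n : ℝ) - 1)) * (n * pd k A x - pd k B x))
        * (v x j * G x j l) + (pd k B x * lower G v l x + B x * covLower G v k l x)
          * (v x j * lower G v j x)
      + B x * lower G v l x * (v x j * covLower G v k j x)
      + (-G x k l + 1 / (2 * ((n : ℝ) - 1)) * n * G x k l) * (v x j * pd j A x)
      + (-(lower G v k x * lower G v l x) - 1 / (2 * ((n : ℝ) - 1)) * G x k l) * (v x j * pd j B x)
      + (-B x * lower G v l x) * (v x j * covLower G v j k x)
      + (-B x * lower G v k x) * (v x j * covLower G v j l x)) := by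
    intro j
    rw [h.cov2_ricci hn1 hx, h.cov2_ricci hn1 hx, h.pd_scalar_eq hn1 hx, h.pd_scalar_eq hn1 hx]
    ring
  simp only [t, ← Finset.mul_sum, Finset.sum_add_distrib, h.sum_mul_metric hx, h.unit x hx,
    h.sum_mul_covLower hx, hgeo x hx] at h0
  have h1 := (mul_eq_zero.1 h0).resolve_left hne
  simp only [← dirDeriv.eq_1] at h1
  linear_combination h1

include hgeo in
-- Here `θ` is the divergence of `v`. Its value is irrelevant: it multiplies `v_j` and disappears in
-- the projection orthogonal to `v`.
theorem bianchi_equation (hn : 1 < n) (hx : x ∈ O) :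
    ∃ θ : ℝ, ∀ j, 2 * (pd j A x + dirDeriv v B x * lower G v j x + B x * θ * lower G v j x) =
      n * pd j A x - pd j B x := by
  refine ⟨∑ p, ∑ m, (G x)⁻¹ p m * covLower G v p m x, fun j => ?_⟩
  have h0 := h.two_mul_div_ricci hx j
  rw [h.pd_scalar_eq hn hx] at h0
  rw [← h0]
  congr 1
  have t : ∀ p m, (G x)⁻¹ p m * cov2 G (ricci G) p j m x =
      (G x)⁻¹ p m * (pd p A x * G x j m) + pd p B x * lower G v j x * ((G x)⁻¹ p m * lower G v m x)
      + B x * covLower G v p j x * ((G x)⁻¹ p m * lower G v m x)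
      + B x * lower G v j x * ((G x)⁻¹ p m * covLower G v p m x) := fun p m => by
    rw [h.cov2_ricci hn hx]; ring
  have e1 : ∑ p, pd p B x * lower G v j x * v x p = dirDeriv v B x * lower G v j x := by
    rw [dirDeriv, Finset.sum_mul]
    exact Finset.sum_congr rfl fun p _ => by ring
  have e2 : ∑ p, B x * covLower G v p j x * v x p = 0 := by
    rw [← mul_zero (B x), ← hgeo x hx j, Finset.mul_sum]
    exact Finset.sum_congr rfl fun p _ => by ring
  simp only [t, Finset.sum_add_distrib, ← Finset.mul_sum, h.sum_inv_mul_lower hx,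
    h.sum_inv_mul_left hx, e1, e2]
  ring

include hn hW hgeo in
/-- The coefficients `A` and `B` are constant on the orthogonal complement of `v`. -/
theorem pd_coeff (hx : x ∈ O) (k : Fin n) :
    pd k A x = -(lower G v k x * dirDeriv v A x) ∧
    pd k B x = -(lower G v k x * dirDeriv v B x) := by
  have hn1 : 1 < n := by omega
  have hn' : (3 : ℝ) < n := by exact_mod_cast hn
  -- Contraction of `weyl_equation` with `v^l`. The combinations `∂_k f + v_k v(f)` are the parts of
  -- the gradients orthogonal to `v`.
  have h1 : -(pd k A x + lower G v k x * dirDeriv v A x)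
        + (pd k B x + lower G v k x * dirDeriv v B x) = -(1 / (2 * ((n : ℝ) - 1)) *
      (n * (pd k A x + lower G v k x * dirDeriv v A x)
        - (pd k B x + lower G v k x * dirDeriv v B x))) := by
    have e := Finset.sum_congr rfl fun l (_ : l ∈ Finset.univ) =>
      congrArg (fun r => v x l * r) (h.weyl_equation hn hW hgeo hx k l)
    have t1 : ∀ l, v x l * (lower G v l x * pd k A x - lower G v l x * pd k B x
          - B x * covLower G v k l x - G x k l * dirDeriv v A x
          - lower G v k x * lower G v l x * dirDeriv v B x) =
        (pd k A x - pd k B x - lower G v k x * dirDeriv v B x) * (v x l * lower G v l x)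
        + -B x * (v x l * covLower G v k l x) + -dirDeriv v A x * (v x l * G x l k) := fun l => by
      rw [h.apply_comm hx l k]; ring
    have t2 : ∀ l, v x l * (1 / (2 * ((n : ℝ) - 1)) * (lower G v l x * (n * pd k A x - pd k B x)
          - G x k l * (n * dirDeriv v A x - dirDeriv v B x))) =
        1 / (2 * ((n : ℝ) - 1)) * (n * pd k A x - pd k B x) * (v x l * lower G v l x)
        + -(1 / (2 * ((n : ℝ) - 1)) * (n * dirDeriv v A x - dirDeriv v B x)) * (v x l * G x l k) :=
      fun l => by rw [h.apply_comm hx l k]; ring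
    simp only [t1, t2, Finset.sum_add_distrib, ← Finset.mul_sum, h.unit x hx,
      h.sum_mul_covLower hx, h.sum_mul_metric hx] at e
    linear_combination e
  -- Orthogonal projection of the contracted Bianchi identity; `θ` drops out.
  have h2 : 2 * (pd k A x + lower G v k x * dirDeriv v A x) =
      n * (pd k A x + lower G v k x * dirDeriv v A x)
        - (pd k B x + lower G v k x * dirDeriv v B x) := by
    obtain ⟨θ, hθ⟩ := h.bianchi_equation hgeo hn1 hx
    have e := Finset.sum_congr rfl fun j (_ : j ∈ Finset.univ) =>
      congrArg (fun r => v x j * r) (hθ j)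
    have t1 : ∀ j, v x j * (2 * (pd j A x + dirDeriv v B x * lower G v j x
          + B x * θ * lower G v j x)) = 2 * (v x j * pd j A x)
        + 2 * (dirDeriv v B x + B x * θ) * (v x j * lower G v j x) := fun j => by ring
    have t2 : ∀ j, v x j * (n * pd j A x - pd j B x) =
        n * (v x j * pd j A x) + -1 * (v x j * pd j B x) := fun j => by ring
    simp only [t1, t2, Finset.sum_add_distrib, ← Finset.mul_sum, h.unit x hx] at e
    simp only [← dirDeriv.eq_1] at e
    linear_combination hθ k + lower G v k x * e
  set a := pd k A x + lower G v k x * dirDeriv v A x with ha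
  set b := pd k B x + lower G v k x * dirDeriv v B x with hb
  have hb' : b = (n - 2) * a := by linear_combination h2
  have hn2 : (n : ℝ) - 1 ≠ 0 := by linarith
  -- Substituting `b = (n - 2) a` into `h1` gives `((n - 3)(n - 1) + 1) a = 0`, and the coefficient
  -- is `(n - 2)^2`.
  have ha0 : a = 0 := by
    rw [hb'] at h1
    field_simp at h1
    have h3 : ((n : ℝ) - 2) ^ 2 * a = 0 := by linear_combination h1 / 2
    exact (mul_eq_zero.1 h3).resolve_left (pow_ne_zero 2 (by linarith))
  rw [ha0, mul_zero] at hb'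
  constructor <;> linarith

include hn hW hgeo in
/-- `-B ∇_k u_l = (A' - R' / (2 (n - 1))) (g_{kl} + u_k u_l)`, where `'` is the derivative
along `v`. -/
theorem neg_mul_covLower (hx : x ∈ O) (k l : Fin n) :
    -(B x * covLower G v k l x) = (dirDeriv v A x - 1 / (2 * ((n : ℝ) - 1)) *
      (n * dirDeriv v A x - dirDeriv v B x)) * (G x k l + lower G v k x * lower G v l x) := by
  have h1 := h.weyl_equation hn hW hgeo hx k l
  obtain ⟨hA, hB⟩ := h.pd_coeff hn hW hgeo hx k
  rw [hA, hB] at h1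
  linear_combination h1

end IsFluidOn
end Coord
end

noncomputable section

/-! ### Local diffeomorphisms -/

/-- The inverse function theorem for maps that are smooth on an open set: the local inverse is
smooth on its whole domain. -/
theorem exists_openPartialHomeomorph_of_contDiffOn {E F : Type*} [NormedAddCommGroup E]
    [NormedSpace ℝ E] [CompleteSpace E] [NormedAddCommGroup F] [NormedSpace ℝ F] {f : E → F}
    {O : Set E} (hO : IsOpen O) (hf : ContDiffOn ℝ ∞ f O) {a : E} (ha : a ∈ O) {f' : E ≃L[ℝ] F}
    (hf' : HasFDerivAt f (f' : E →L[ℝ] F) a) :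
    ∃ φ : OpenPartialHomeomorph E F, a ∈ φ.source ∧ φ.source ⊆ O ∧ (∀ x, φ x = f x) ∧
      ContDiffOn ℝ ∞ φ.symm φ.target := by
  have hfa : ContDiffAt ℝ ∞ f a := hf.contDiffAt (hO.mem_nhds ha)
  have hcont : ContinuousOn (fderiv ℝ f) O := (hf.fderiv_of_isOpen (m := ∞) hO (by simp)).continuousOn
  -- Restricting the local inverse to the open set where the derivative is invertible makes it
  -- smooth at every point of its domain, not only at the image of `a`.
  have hO' : IsOpen (O ∩ fderiv ℝ f ⁻¹' (Set.range ContinuousLinearEquiv.toContinuousLinearMap)) :=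
    hcont.isOpen_inter_preimage hO ContinuousLinearEquiv.isOpen
  set ψ := hfa.toOpenPartialHomeomorph f hf' (by simp) with hψ
  have hcoe : ∀ x, ψ x = f x := fun x => rfl
  refine ⟨ψ.restrOpen _ hO', ?_, fun x hx => hx.2.1, hcoe, ?_⟩
  · exact ⟨hfa.mem_toOpenPartialHomeomorph_source hf' (by simp), ha, f', hf'.fderiv.symm⟩
  · intro y hy
    have hx := (ψ.restrOpen _ hO').map_target hy
    obtain ⟨L, hL⟩ := hx.2.2
    have hd : HasFDerivAt f (L : E →L[ℝ] F) ((ψ.restrOpen _ hO').symm y) := by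
      rw [hL]
      exact ((hf.differentiableOn (by simp)).differentiableAt (hO.mem_nhds hx.2.1)).hasFDerivAt
    exact ((ψ.restrOpen _ hO').contDiffAt_symm hy hd
      (hf.contDiffAt (hO.mem_nhds hx.2.1))).contDiffWithinAt

/-! ### Smooth dependence of solutions of ordinary differential equations -/

section Nemytskii

universe u

variable {X : Type*} [TopologicalSpace X] [CompactSpace X] {E F : Type u} [NormedAddCommGroup E]
  [NormedSpace ℝ E] [NormedAddCommGroup F] [NormedSpace ℝ F]

/-- Pointwise application of a continuous bilinear map to two continuous maps. -/
def pointwiseBilin (X : Type*) [TopologicalSpace X] [CompactSpace X] {V E F : Type*}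
    [NormedAddCommGroup V] [NormedSpace ℝ V] [NormedAddCommGroup E] [NormedSpace ℝ E]
    [NormedAddCommGroup F] [NormedSpace ℝ F] (b : V →L[ℝ] E →L[ℝ] F) :
    C(X, V) →L[ℝ] C(X, E) →L[ℝ] C(X, F) :=
  LinearMap.mkContinuous₂
    (LinearMap.mk₂ ℝ (fun (T : C(X, V)) (h : C(X, E)) =>
        (⟨fun t => b (T t) (h t), (b.continuous.comp T.continuous).clm_apply h.continuous⟩ : C(X, F)))
      (fun _ _ _ => by ext; simp) (fun _ _ _ => by ext; simp) (fun _ _ _ => by ext; simp)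
      (fun _ _ _ => by ext; simp)) ‖b‖
    (fun T h => by
      rw [ContinuousMap.norm_le _ (by positivity)]
      intro t
      refine (b.le_opNorm₂ (T t) (h t)).trans ?_
      gcongr
      · exact T.norm_coe_le_norm t
      · exact h.norm_coe_le_norm t)

@[simp] theorem pointwiseBilin_apply {V : Type*} [NormedAddCommGroup V] [NormedSpace ℝ V]
    (b : V →L[ℝ] E →L[ℝ] F) (T : C(X, V)) (h : C(X, E)) (t : X) :
    pointwiseBilin X b T h t = b (T t) (h t) := rfl

/-- The mean value inequality on the segment from `γ t` to `γ t + h t` bounds the remainder. The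
bound is uniform in `t` because `γ ↦ f' ∘ γ` is continuous for the sup norm. -/
theorem hasFDerivAt_continuousMap_comp {V : Type*} [NormedAddCommGroup V] [NormedSpace ℝ V]
    (b : V →L[ℝ] E →L[ℝ] F) (f : C(E, F)) (f' : C(E, V))
    (hf : ∀ x, HasFDerivAt f (b (f' x)) x) (γ : C(X, E)) :
    HasFDerivAt (fun γ : C(X, E) => f.comp γ) (pointwiseBilin X b (f'.comp γ)) γ := by
  rw [hasFDerivAt_iff_isLittleO_nhds_zero, Asymptotics.isLittleO_iff]
  intro ε hε
  have hc : Continuous fun γ : C(X, E) => f'.comp γ := ContinuousMap.continuous_postcomp f'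
  obtain ⟨δ, hδ, hball⟩ := Metric.continuousAt_iff.1 (hc.continuousAt (x := γ)) (ε / (‖b‖ + 1))
    (by positivity)
  filter_upwards [Metric.ball_mem_nhds 0 hδ] with h hh
  rw [mem_ball_zero_iff] at hh
  rw [ContinuousMap.norm_le _ (by positivity)]
  intro t
  have key := (convex_segment (𝕜 := ℝ) (γ t) (γ t + h t)).norm_image_sub_le_of_norm_hasFDerivWithin_le'
    (f := f) (f' := fun x => b (f' x)) (φ := b (f' (γ t))) (C := ε)
    (fun z _ => (hf z).hasFDerivWithinAt) ?_ (left_mem_segment ..) (right_mem_segment ..)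
  · simp only [add_sub_cancel_left] at key
    exact key.trans (mul_le_mul_of_nonneg_left (h.norm_coe_le_norm t) hε.le)
  · intro z hz
    rw [segment_eq_image'] at hz
    obtain ⟨s, hs, rfl⟩ := hz
    have h1 : dist (γ + s • h) γ < δ := by
      rw [dist_eq_norm, add_sub_cancel_left, norm_smul, Real.norm_of_nonneg hs.1]
      exact (mul_le_of_le_one_left (norm_nonneg _) hs.2).trans_lt hh
    have h2 := (ContinuousMap.dist_apply_le_dist t).trans (hball h1).le
    rw [dist_eq_norm] at h2
    have h3 : ‖f' (γ t + s • h t) - f' (γ t)‖ ≤ ε / (‖b‖ + 1) := h2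
    simp only [add_sub_cancel_left, ← map_sub]
    calc ‖b (f' (γ t + s • h t) - f' (γ t))‖ ≤ ‖b‖ * (ε / (‖b‖ + 1)) :=
          (b.le_opNorm _).trans (mul_le_mul_of_nonneg_left h3 (norm_nonneg _))
      _ ≤ (‖b‖ + 1) * (ε / (‖b‖ + 1)) := by gcongr; linarith
      _ = ε := mul_div_cancel₀ _ (by positivity)

set_option synthInstance.maxHeartbeats 400000 in
-- The derivative is pointwise application of `f' ∘ γ`, itself a composition operator of one order
-- less. The induction replaces `F` by `E →L[ℝ] F`, which is why `E` and `F` share a universe.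
theorem contDiff_continuousMap_comp_nat (n : ℕ) (f : C(E, F)) (hf : ContDiff ℝ n f) :
    ContDiff ℝ n fun γ : C(X, E) => f.comp γ := by
  induction n generalizing F with
  | zero => exact contDiff_zero.2 (ContinuousMap.continuous_postcomp f)
  | succ n ih =>
    obtain ⟨f', hf', hd⟩ := contDiff_succ_iff_hasFDerivAt.1 (by exact_mod_cast hf)
    refine mod_cast contDiff_succ_iff_hasFDerivAt.2
      ⟨_, (pointwiseBilin X (.id ℝ (E →L[ℝ] F))).contDiff.comp (ih ⟨f', hf'.continuous⟩ hf'), ?_⟩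
    exact fun γ => hasFDerivAt_continuousMap_comp (.id ℝ (E →L[ℝ] F)) f ⟨f', hf'.continuous⟩ hd γ

/-- Composition with a smooth map is a smooth operator between spaces of continuous maps. -/
theorem contDiff_continuousMap_comp (f : C(E, F)) (hf : ContDiff ℝ ∞ f) :
    ContDiff ℝ ∞ fun γ : C(X, E) => f.comp γ :=
  contDiff_infty.2 fun n => contDiff_continuousMap_comp_nat n f (hf.of_le (mod_cast le_top))

end Nemytskii

section Flow

variable {E : Type*} [NormedAddCommGroup E] [NormedSpace ℝ E]

omit [NormedSpace ℝ E] in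
theorem continuous_extend_interval (γ : C(Set.Icc (-1 : ℝ) 1, E)) :
    Continuous (Set.IccExtend (by norm_num : (-1 : ℝ) ≤ 1) γ) := γ.continuous.Icc_extend'

/-- Integration from `0` as an operator on `C([-1, 1], E)`. -/
def integralFromZero (E : Type*) [NormedAddCommGroup E] [NormedSpace ℝ E] :
    C(Set.Icc (-1 : ℝ) 1, E) →L[ℝ] C(Set.Icc (-1 : ℝ) 1, E) :=
  LinearMap.mkContinuous
    { toFun := fun γ => ⟨fun s => ∫ r in (0 : ℝ)..s, Set.IccExtend (by norm_num) γ r,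
        (intervalIntegral.continuous_primitive
          (fun a b => (continuous_extend_interval γ).intervalIntegrable a b) 0).comp
          continuous_subtype_val⟩
      map_add' := fun γ γ' => by
        ext s
        exact intervalIntegral.integral_add ((continuous_extend_interval γ).intervalIntegrable _ _)
          ((continuous_extend_interval γ').intervalIntegrable _ _)
      map_smul' := fun c γ => by
        ext s
        exact intervalIntegral.integral_smul _ _ } 1
    (fun γ => by
      rw [ContinuousMap.norm_le _ (by positivity), one_mul]
      intro s
      refine (intervalIntegral.norm_integral_le_of_norm_le_const (C := ‖γ‖)
        fun r _ => γ.norm_coe_le_norm _).trans ?_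
      rw [sub_zero]
      exact mul_le_of_le_one_right (norm_nonneg _) (abs_le.2 s.2))

theorem norm_integralFromZero_le (γ : C(Set.Icc (-1 : ℝ) 1, E)) :
    ‖integralFromZero E γ‖ ≤ ‖γ‖ := by
  have h : ‖integralFromZero E‖ ≤ 1 := LinearMap.mkContinuous_norm_le _ zero_le_one _
  simpa using (integralFromZero E).le_of_opNorm_le h γ

/-- `γ` is a solution of `γ' = τ f(γ)`, `γ(0) = x` on `[-1, 1]`. -/
def IsScaledSolution (f : C(E, E)) (x : E) (τ : ℝ) (γ : C(Set.Icc (-1 : ℝ) 1, E)) : Prop :=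
  γ = ContinuousMap.const _ x + τ • integralFromZero E (f.comp γ)

theorem IsScaledSolution.unique {f : C(E, E)} {K : NNReal} (hf : LipschitzWith K f) {x : E} {τ : ℝ}
    (hτ : |τ| * K < 1) {γ γ' : C(Set.Icc (-1 : ℝ) 1, E)} (h : IsScaledSolution f x τ γ)
    (h' : IsScaledSolution f x τ γ') : γ = γ' := by
  have h1 : γ - γ' = τ • integralFromZero E (f.comp γ - f.comp γ') := by
    rw [map_sub, smul_sub]
    nth_rewrite 1 [h, h']
    abel
  have h2 : ‖f.comp γ - f.comp γ'‖ ≤ K * ‖γ - γ'‖ := by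
    rw [ContinuousMap.norm_le _ (by positivity)]
    intro t
    rw [ContinuousMap.sub_apply, ContinuousMap.comp_apply, ContinuousMap.comp_apply, ← dist_eq_norm,
      ← dist_eq_norm]
    exact (hf.dist_le_mul _ _).trans
      (mul_le_mul_of_nonneg_left (ContinuousMap.dist_apply_le_dist t) K.2)
  have h3 : ‖γ - γ'‖ ≤ |τ| * K * ‖γ - γ'‖ := by
    conv_lhs => rw [h1, norm_smul, Real.norm_eq_abs]
    rw [mul_assoc]
    exact mul_le_mul_of_nonneg_left ((norm_integralFromZero_le _).trans h2) (abs_nonneg _)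
  by_contra hne
  have h4 : 0 < ‖γ - γ'‖ := norm_pos_iff.2 (sub_ne_zero.2 hne)
  nlinarith

theorem isScaledSolution_iff {f : C(E, E)} {x : E} {τ : ℝ} {γ : C(Set.Icc (-1 : ℝ) 1, E)} :
    IsScaledSolution f x τ γ ↔ ∀ s : Set.Icc (-1 : ℝ) 1,
      γ s = x + τ • ∫ r in (0 : ℝ)..s, f (Set.IccExtend (by norm_num) γ r) := by
  constructor
  · intro h s
    conv_lhs => rw [h]
    rfl
  · intro h
    ext s
    exact h s

/-- Slowing a solution down by the factor `c` multiplies its speed parameter by `c`; this is the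
substitution `r ↦ c r` in the integral. It links the solutions for different `τ` on the fixed
interval `[-1, 1]`. -/
theorem IsScaledSolution.rescale {f : C(E, E)} {x : E} {τ c : ℝ} (hc : |c| ≤ 1)
    {γ : C(Set.Icc (-1 : ℝ) 1, E)} (h : IsScaledSolution f x τ γ) :
    IsScaledSolution f x (τ * c) ⟨fun s => Set.IccExtend (by norm_num) γ (c * s),
      (continuous_extend_interval γ).comp (continuous_const.mul continuous_subtype_val)⟩ := by
  rw [isScaledSolution_iff] at h ⊢
  have hmem : ∀ s : Set.Icc (-1 : ℝ) 1, c * s ∈ Set.Icc (-1 : ℝ) 1 := fun s => by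
    rw [Set.mem_Icc, ← abs_le, abs_mul]
    exact mul_le_one₀ hc (abs_nonneg _) (abs_le.2 s.2)
  intro s
  change Set.IccExtend _ γ (c * s) = _
  rw [Set.IccExtend_of_mem _ _ (hmem s), h, mul_smul]
  congr 2
  have h1 := intervalIntegral.smul_integral_comp_mul_left (a := 0) (b := (s : ℝ))
    (fun r => f (Set.IccExtend (by norm_num : (-1 : ℝ) ≤ 1) γ r)) c
  rw [mul_zero] at h1
  change _ = c • _
  rw [← h1]
  congr 1
  refine intervalIntegral.integral_congr fun r hr => ?_
  have hr' : r ∈ Set.Icc (-1 : ℝ) 1 := by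
    have hs := s.2
    rw [Set.mem_uIcc] at hr
    rcases hr with hr | hr <;> constructor <;> linarith [hr.1, hr.2, hs.1, hs.2]
  congr 1
  rw [Set.IccExtend_of_mem _ _ hr']
  rfl

/-- Constant maps, as a continuous linear map into `C([-1, 1], E)`. -/
def constCurve (E : Type*) [NormedAddCommGroup E] [NormedSpace ℝ E] :
    E →L[ℝ] C(Set.Icc (-1 : ℝ) 1, E) where
  toFun := ContinuousMap.const _
  map_add' _ _ := rfl
  map_smul' _ _ := rfl
  cont := ContinuousMap.continuous_const'

@[simp] theorem constCurve_apply (x : E) : constCurve E x = ContinuousMap.const _ x := rfl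

/-- Solutions are the points where the second component of `Ψ` vanishes. At `τ = 0` the variation of
the integral term in `γ` is zero, so the derivative of `Ψ` is the shear `Λ`, with explicit inverse,
and the inverse function theorem gives a smooth solution map. -/
theorem exists_smooth_scaledSolution [CompleteSpace E] (f : C(E, E)) (hf : ContDiff ℝ ∞ f) (p : E) :
    ∃ (W : Set (E × ℝ)) (Γ : E × ℝ → C(Set.Icc (-1 : ℝ) 1, E)), IsOpen W ∧ (p, 0) ∈ W ∧
      ContDiffOn ℝ ∞ Γ W ∧ ∀ q ∈ W, IsScaledSolution f q.1 q.2 (Γ q) := by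
  set c₀ := integralFromZero E (f.comp (ContinuousMap.const _ p)) with hc₀
  set ℓ : E × ℝ →L[ℝ] C(Set.Icc (-1 : ℝ) 1, E) :=
    (constCurve E).comp (.fst ℝ E ℝ) + (ContinuousLinearMap.snd ℝ E ℝ).smulRight c₀ with hℓ
  set Ψ : (E × ℝ) × C(Set.Icc (-1 : ℝ) 1, E) → (E × ℝ) × C(Set.Icc (-1 : ℝ) 1, E) := fun z =>
    (z.1, z.2 - (constCurve E z.1.1 + z.1.2 • integralFromZero E (f.comp z.2))) with hΨ
  have hcomp : ContDiff ℝ ∞ fun z : (E × ℝ) × C(Set.Icc (-1 : ℝ) 1, E) =>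
      integralFromZero E (f.comp z.2) :=
    (integralFromZero E).contDiff.comp ((contDiff_continuousMap_comp f hf).comp contDiff_snd)
  have hΨs : ContDiff ℝ ∞ Ψ := by
    refine contDiff_fst.prodMk (contDiff_snd.sub (ContDiff.add ?_ ?_))
    · exact (constCurve E).contDiff.comp (contDiff_fst.comp contDiff_fst)
    · exact (contDiff_snd.comp contDiff_fst).smul hcomp
  set Λ : ((E × ℝ) × C(Set.Icc (-1 : ℝ) 1, E)) ≃L[ℝ] ((E × ℝ) × C(Set.Icc (-1 : ℝ) 1, E)) :=
    ContinuousLinearEquiv.equivOfInverse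
      ((ContinuousLinearMap.fst ℝ _ _).prod
        (ContinuousLinearMap.snd ℝ _ _ - ℓ.comp (ContinuousLinearMap.fst ℝ _ _)))
      ((ContinuousLinearMap.fst ℝ _ _).prod
        (ContinuousLinearMap.snd ℝ _ _ + ℓ.comp (ContinuousLinearMap.fst ℝ _ _)))
      (fun z => by ext <;> simp) (fun z => by ext <;> simp) with hΛ
  have hd : HasFDerivAt Ψ (Λ : _ →L[ℝ] _) ((p, 0), ContinuousMap.const _ p) := by
    have hi := (hcomp.differentiable (by simp) ((p, 0), ContinuousMap.const _ p)).hasFDerivAt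
    have h1 := (hasFDerivAt_fst (𝕜 := ℝ) (p := ((p, (0 : ℝ)),
      (ContinuousMap.const _ p : C(Set.Icc (-1 : ℝ) 1, E)))))
    have h2 := (hasFDerivAt_snd (𝕜 := ℝ) (p := ((p, (0 : ℝ)),
      (ContinuousMap.const _ p : C(Set.Icc (-1 : ℝ) 1, E)))))
    have h3 := (constCurve E).hasFDerivAt.comp _ h1.fst
    have h4 := h1.snd.smul hi
    refine (h1.prodMk (h2.sub (h3.add h4))).congr_fderiv ?_
    ext z <;> simp [hΛ, hℓ, hc₀]
  obtain ⟨φ, hmem, -, hcoe, hsymm⟩ := exists_openPartialHomeomorph_of_contDiffOn isOpen_univ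
    hΨs.contDiffOn (Set.mem_univ _) hd
  refine ⟨(fun q => (q, (0 : C(Set.Icc (-1 : ℝ) 1, E)))) ⁻¹' φ.target,
    fun q => (φ.symm (q, 0)).2, φ.open_target.preimage (by fun_prop), ?_, ?_, ?_⟩
  · have := φ.map_source hmem
    rw [hcoe] at this
    have h0 : Ψ ((p, 0), ContinuousMap.const _ p) = ((p, 0), 0) := by
      ext <;> simp [hΨ]
    rwa [h0] at this
  · exact contDiff_snd.comp_contDiffOn (hsymm.comp
      (contDiff_id.prodMk contDiff_const).contDiffOn fun q hq => hq)
  · intro q hq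
    have h := φ.right_inv hq
    rw [hcoe, hΨ, Prod.mk.injEq, sub_eq_zero] at h
    have h1 := h.2
    rw [h.1] at h1
    exact h1

/-- The local flow of a smooth Lipschitz vector field is smooth. -/
theorem exists_smooth_flow [CompleteSpace E] {f : E → E} (hf : ContDiff ℝ ∞ f) {K : NNReal}
    (hK : LipschitzWith K f) (p : E) :
    ∃ δ > 0, ∃ Φ : E × ℝ → E, ContDiffOn ℝ ∞ Φ (Metric.ball p δ ×ˢ Metric.ball 0 δ) ∧
      (∀ x ∈ Metric.ball p δ, Φ (x, 0) = x) ∧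
      ∀ x ∈ Metric.ball p δ, ∀ τ ∈ Metric.ball (0 : ℝ) δ,
        HasDerivAt (fun τ => Φ (x, τ)) (f (Φ (x, τ))) τ := by
  obtain ⟨W, Γ, hW, hpW, hΓ, hsol⟩ := exists_smooth_scaledSolution ⟨f, hf.continuous⟩ hf p
  obtain ⟨δ₁, hδ₁, hball⟩ := Metric.isOpen_iff.1 hW _ hpW
  rw [← ball_prod_same] at hball
  -- The second bound gives `|τ| K < 1`, so that scaled solutions are unique.
  set δ := min δ₁ (1 / (K + 1)) with hδ
  have hδ0 : 0 < δ := lt_min hδ₁ (by positivity)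
  have hsub : Metric.ball p δ ×ˢ Metric.ball (0 : ℝ) δ ⊆ W := (Set.prod_mono
    (Metric.ball_subset_ball (min_le_left _ _)) (Metric.ball_subset_ball (min_le_left _ _))).trans
    hball
  have hcontr : ∀ τ ∈ Metric.ball (0 : ℝ) δ, |τ| * K < 1 := by
    intro τ hτ
    rw [mem_ball_zero_iff, Real.norm_eq_abs] at hτ
    have h1 : |τ| < 1 / (K + 1) := hτ.trans_le (min_le_right _ _)
    rw [lt_div_iff₀ (by positivity)] at h1
    nlinarith [abs_nonneg τ]
  have hone : (1 : ℝ) ∈ Set.Icc (-1 : ℝ) 1 := by norm_num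
  refine ⟨δ, hδ0, fun q => Γ q ⟨1, hone⟩, ?_, ?_, ?_⟩
  · exact (ContinuousMap.evalCLM ℝ (⟨1, hone⟩ : Set.Icc (-1 : ℝ) 1)).contDiff.comp_contDiffOn
      (hΓ.mono hsub)
  · intro x hx
    have h := isScaledSolution_iff.1 (hsol (x, 0) (hsub ⟨hx, Metric.mem_ball_self hδ0⟩)) ⟨1, hone⟩
    simpa using h
  · intro x hx τ hτ
    obtain ⟨τ₂, h1, h2⟩ := exists_between (mem_ball_zero_iff.1 hτ)
    rw [Real.norm_eq_abs] at h1
    have hτ₂ : 0 < τ₂ := (abs_nonneg _).trans_lt h1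
    have hmem₂ : τ₂ ∈ Metric.ball (0 : ℝ) δ := by
      rwa [mem_ball_zero_iff, Real.norm_of_nonneg hτ₂.le]
    have hs := hsol (x, τ₂) (hsub ⟨hx, hmem₂⟩)
    set γ := Γ (x, τ₂) with hγ
    -- The flow is the value at parameter 1 of a curve that changes with `σ`. By rescaling and
    -- uniqueness it is also the value at `σ / τ₂` of the single curve `γ`, where it can be
    -- differentiated in `σ`.
    have hval : ∀ σ, |σ| < τ₂ → Γ (x, σ) ⟨1, hone⟩ =
        Set.IccExtend (by norm_num : (-1 : ℝ) ≤ 1) γ (σ / τ₂) := by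
      intro σ hσ
      have hσδ : σ ∈ Metric.ball (0 : ℝ) δ := by
        rw [mem_ball_zero_iff, Real.norm_eq_abs]; exact hσ.trans h2
      have hc : |σ / τ₂| ≤ 1 := by
        rw [abs_div, abs_of_pos hτ₂, div_le_one hτ₂]; exact hσ.le
      have h3 := hs.rescale hc
      rw [mul_div_cancel₀ _ hτ₂.ne'] at h3
      have h4 := IsScaledSolution.unique hK (hcontr σ hσδ) (hsol (x, σ) (hsub ⟨hx, hσδ⟩)) h3
      rw [h4]
      change Set.IccExtend _ γ (σ / τ₂ * 1) = _
      rw [mul_one]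
    have hcont : Continuous fun r => f (Set.IccExtend (by norm_num : (-1 : ℝ) ≤ 1) γ r) :=
      hf.continuous.comp (continuous_extend_interval γ)
    have hD : HasDerivAt (fun σ => x + τ₂ • ∫ r in (0 : ℝ)..(σ / τ₂),
        f (Set.IccExtend (by norm_num : (-1 : ℝ) ≤ 1) γ r))
        (f (Set.IccExtend (by norm_num : (-1 : ℝ) ≤ 1) γ (τ / τ₂))) τ := by
      have h5 := (hcont.integral_hasStrictDerivAt 0 (τ / τ₂)).hasDerivAt
      have h6 := h5.scomp τ ((hasDerivAt_id τ).div_const τ₂)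
      refine ((h6.const_smul τ₂).const_add x).congr_deriv ?_
      rw [smul_smul, mul_one_div_cancel hτ₂.ne', one_smul]
    change HasDerivAt (fun τ => Γ (x, τ) ⟨1, hone⟩) (f (Γ (x, τ) ⟨1, hone⟩)) τ
    rw [hval τ h1]
    refine hD.congr_of_eventuallyEq ?_
    have hopen : IsOpen {σ : ℝ | |σ| < τ₂} := isOpen_lt continuous_abs continuous_const
    filter_upwards [hopen.mem_nhds h1] with σ hσ
    rw [hval σ hσ]
    have hm : σ / τ₂ ∈ Set.Icc (-1 : ℝ) 1 := by
      rw [Set.mem_Icc, ← abs_le, abs_div, abs_of_pos hτ₂, div_le_one hτ₂]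
      exact le_of_lt hσ
    rw [Set.IccExtend_of_mem _ _ hm]
    exact isScaledSolution_iff.1 hs ⟨σ / τ₂, hm⟩

end Flow
end

noncomputable section

/-! ### Flow boxes adapted to a closed one-form -/

/-- The last `m` coordinates. -/
def tailL (m : ℕ) : EuclideanSpace ℝ (Fin (m + 1)) →L[ℝ] EuclideanSpace ℝ (Fin m) :=
  LinearMap.toContinuousLinearMap
    { toFun := fun x => WithLp.toLp 2 fun μ : Fin m => x μ.succ
      map_add' := fun _ _ => rfl
      map_smul' := fun _ _ => rfl }

theorem tailL_apply {m : ℕ} (x : EuclideanSpace ℝ (Fin (m + 1))) :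
    tailL m x = WithLp.toLp 2 fun μ : Fin m => x μ.succ := rfl

/-- The point with first coordinate `t` and remaining coordinates `y`. -/
def consPoint {m : ℕ} (q : ℝ × EuclideanSpace ℝ (Fin m)) : EuclideanSpace ℝ (Fin (m + 1)) :=
  WithLp.toLp 2 (Fin.cons q.1 q.2.ofLp)

theorem contDiff_consPoint {m : ℕ} : ContDiff ℝ ∞ (consPoint (m := m)) := by
  rw [contDiff_euclidean]
  intro i
  refine Fin.cases ?_ (fun j => ?_) i
  · exact contDiff_fst
  · exact (contDiff_euclidean.1 contDiff_id j).comp contDiff_snd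

theorem consPoint_tailL {m : ℕ} (x : EuclideanSpace ℝ (Fin (m + 1))) :
    consPoint (x 0, tailL m x) = x := by
  ext i
  refine Fin.cases ?_ (fun j => ?_) i <;> rfl

/-- Extend a vector field, smooth near a point, to a smooth Lipschitz vector field. -/
theorem exists_contDiff_lipschitz_eqOn {E : Type*} [NormedAddCommGroup E] [InnerProductSpace ℝ E]
    [FiniteDimensional ℝ E] {v : E → E} {p : E} {r : ℝ} (hr : 0 < r)
    (hv : ContDiffOn ℝ ∞ v (Metric.ball p r)) :
    ∃ (f : E → E) (K : NNReal), ContDiff ℝ ∞ f ∧ LipschitzWith K f ∧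
      Set.EqOn f v (Metric.ball p (r / 4)) := by
  let χ : ContDiffBump p := ⟨r / 4, r / 2, by positivity, by linarith⟩
  have hχ : tsupport χ = Metric.closedBall p (r / 2) := χ.tsupport_eq
  have hsmooth : ContDiff ℝ ∞ fun x => χ x • v x := by
    rw [contDiff_iff_contDiffAt]
    intro x
    by_cases hx : x ∈ tsupport χ
    · have hx' : x ∈ Metric.ball p r := by
        rw [hχ] at hx
        exact Metric.closedBall_subset_ball (by linarith) hx
      exact χ.contDiff.contDiffAt.smul (hv.contDiffAt (Metric.isOpen_ball.mem_nhds hx'))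
    · have h0 : (fun x => χ x • v x) =ᶠ[nhds x] fun _ => 0 := by
        filter_upwards [(isClosed_tsupport χ).isOpen_compl.mem_nhds hx] with y hy
        rw [image_eq_zero_of_notMem_tsupport hy, zero_smul]
      exact contDiffAt_const.congr_of_eventuallyEq h0
  have hcs : HasCompactSupport fun x => χ x • v x := χ.hasCompactSupport.smul_right
  obtain ⟨K, hK⟩ := hsmooth.lipschitzWith_of_hasCompactSupport hcs (by simp)
  refine ⟨_, K, hsmooth, hK, fun x hx => ?_⟩
  have : χ x = 1 := χ.one_of_mem_closedBall (Metric.ball_subset_closedBall hx)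
  simp [this]

/-- A closed one-form on a ball has a smooth primitive vanishing at the centre. -/
theorem exists_smooth_primitive {E : Type*} [NormedAddCommGroup E] [NormedSpace ℝ E]
    {η : E → E →L[ℝ] ℝ} {p : E} {r : ℝ} (hη : ContDiffOn ℝ ∞ η (Metric.ball p r))
    (hclosed : ∀ a ∈ Metric.ball p r, ∀ x y, fderiv ℝ η a x y = fderiv ℝ η a y x) :
    ∃ T : E → ℝ, T p = 0 ∧ ContDiffOn ℝ ∞ T (Metric.ball p r) ∧
      ∀ a ∈ Metric.ball p r, HasFDerivAt T (η a) a := by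
  obtain ⟨T, hT⟩ := (convex_ball p r).exists_forall_hasFDerivAt_of_fderiv_symmetric
    Metric.isOpen_ball (hη.differentiableOn (by simp)) hclosed
  refine ⟨fun x => T x - T p, sub_self _, ?_, fun a ha => (hT a ha).sub_const _⟩
  refine ContDiffOn.sub ?_ contDiffOn_const
  rw [contDiffOn_infty_iff_fderiv_of_isOpen Metric.isOpen_ball]
  exact ⟨fun a ha => (hT a ha).differentiableAt.differentiableWithinAt,
    hη.congr fun a ha => (hT a ha).fderiv⟩

/-- The derivative of a local flow at time zero. -/
theorem hasFDerivAt_flow_zero {E : Type*} [NormedAddCommGroup E] [NormedSpace ℝ E]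
    {Φ : E × ℝ → E} {p : E} {δ : ℝ} (hδ : 0 < δ)
    (hΦ : ContDiffOn ℝ ∞ Φ (Metric.ball p δ ×ˢ Metric.ball 0 δ))
    (h0 : ∀ x ∈ Metric.ball p δ, Φ (x, 0) = x) {w : E}
    (hw : HasDerivAt (fun τ => Φ (p, τ)) w 0) :
    HasFDerivAt Φ (.fst ℝ E ℝ + (ContinuousLinearMap.snd ℝ E ℝ).smulRight w) (p, 0) := by
  have hmem : Metric.ball p δ ×ˢ Metric.ball (0 : ℝ) δ ∈ nhds (p, (0 : ℝ)) :=
    prod_mem_nhds (Metric.ball_mem_nhds p hδ) (Metric.ball_mem_nhds 0 hδ)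
  have hd : HasFDerivAt Φ (fderiv ℝ Φ (p, 0)) (p, 0) :=
    ((hΦ.contDiffAt hmem).differentiableAt (by simp)).hasFDerivAt
  have h1 : (fderiv ℝ Φ (p, 0)).comp (.inl ℝ E ℝ) = .id ℝ E := by
    have e1 : HasFDerivAt (fun x => Φ (x, 0)) ((fderiv ℝ Φ (p, 0)).comp (.inl ℝ E ℝ)) p :=
      HasFDerivAt.comp p (f := fun x : E => (x, (0 : ℝ))) hd (hasFDerivAt_prodMk_left p 0)
    refine e1.unique ((hasFDerivAt_id p).congr_of_eventuallyEq ?_)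
    filter_upwards [Metric.ball_mem_nhds p hδ] with x hx using h0 x hx
  have h2 : fderiv ℝ Φ (p, 0) (0, 1) = w := by
    have e2 := HasFDerivAt.comp (0 : ℝ) (f := fun τ : ℝ => (p, τ)) hd (hasFDerivAt_prodMk_right p 0)
    have e3 := e2.hasDerivAt.unique hw
    simpa using e3
  convert hd using 1
  ext z
  · have := congrArg (fun M => M z) h1
    simpa using this.symm
  · simpa using h2.symm

/-- A primitive `T` of `η` grows at unit rate along `v`. Parametrizing by the value of `T` and by
the flow line gives coordinates in which `v` is the first basis vector and `η` is the first
coordinate form. -/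
theorem exists_flowBox {m : ℕ} {O : Set (EuclideanSpace ℝ (Fin (m + 1)))} (hO : IsOpen O)
    {v : EuclideanSpace ℝ (Fin (m + 1)) → EuclideanSpace ℝ (Fin (m + 1))}
    (hv : ContDiffOn ℝ ∞ v O)
    {η : EuclideanSpace ℝ (Fin (m + 1)) → EuclideanSpace ℝ (Fin (m + 1)) →L[ℝ] ℝ}
    (hη : ContDiffOn ℝ ∞ η O)
    (hclosed : ∀ a ∈ O, ∀ x y, fderiv ℝ η a x y = fderiv ℝ η a y x)
    (hηv : ∀ a ∈ O, η a (v a) = 1) {p : EuclideanSpace ℝ (Fin (m + 1))} (hp : p ∈ O) :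
    ∃ (φ : OpenPartialHomeomorph (EuclideanSpace ℝ (Fin (m + 1)))
        (EuclideanSpace ℝ (Fin (m + 1)))) (ε : ℝ), 0 < ε ∧ p ∈ φ.target ∧ φ.target ⊆ O ∧
      φ.source = {x | x 0 ∈ Set.Ioo (-ε) ε ∧ tailL m x ∈ Metric.ball 0 ε} ∧
      ContDiffOn ℝ ∞ φ φ.source ∧ ContDiffOn ℝ ∞ φ.symm φ.target ∧
      ∀ x ∈ φ.source, fderiv ℝ φ x (EuclideanSpace.single 0 1) = v (φ x) ∧
        ∀ w, η (φ x) (fderiv ℝ φ x w) = w 0 := by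
  obtain ⟨r, hr, hball⟩ := Metric.isOpen_iff.1 hO p hp
  obtain ⟨T, hT0, hTs, hTd⟩ := exists_smooth_primitive (hη.mono hball)
    fun a ha => hclosed a (hball ha)
  obtain ⟨f, K, hf, hK, hfv⟩ := exists_contDiff_lipschitz_eqOn hr (hv.mono hball)
  have hr4 : Metric.ball p (r / 4) ⊆ Metric.ball p r := Metric.ball_subset_ball (by linarith)
  obtain ⟨δ₁, hδ₁, Φ, hΦs, hΦ0, hΦd⟩ := exists_smooth_flow hf hK p
  -- Flow lines must stay in the ball of radius `r / 4`, where the cut-off field `f` equals `v`.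
  obtain ⟨δ, hδ, hδδ₁, hδr, hstay⟩ : ∃ δ > 0, δ ≤ δ₁ ∧ δ ≤ r ∧
      ∀ x ∈ Metric.ball p δ, ∀ τ ∈ Metric.ball (0 : ℝ) δ, Φ (x, τ) ∈ Metric.ball p (r / 4) := by
    have hopen := hΦs.continuousOn.isOpen_inter_preimage
      (Metric.isOpen_ball.prod Metric.isOpen_ball) (Metric.isOpen_ball (x := p) (ε := r / 4))
    have hmem : (p, (0 : ℝ)) ∈ Metric.ball p δ₁ ×ˢ Metric.ball (0 : ℝ) δ₁ ∩
        Φ ⁻¹' Metric.ball p (r / 4) := by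
      refine ⟨⟨Metric.mem_ball_self hδ₁, Metric.mem_ball_self hδ₁⟩, ?_⟩
      rw [Set.mem_preimage, hΦ0 p (Metric.mem_ball_self hδ₁)]
      exact Metric.mem_ball_self (by positivity)
    obtain ⟨δ₂, hδ₂, h⟩ := Metric.isOpen_iff.1 hopen _ hmem
    rw [← ball_prod_same] at h
    refine ⟨min δ₂ (min δ₁ r), by positivity, (min_le_right _ _).trans (min_le_left _ _),
      (min_le_right _ _).trans (min_le_right _ _), fun x hx τ hτ => (h ⟨?_, ?_⟩).2⟩
    · exact Metric.ball_subset_ball (min_le_left _ _) hx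
    · exact Metric.ball_subset_ball (min_le_left _ _) hτ
  have hbx : Metric.ball p δ ⊆ Metric.ball p δ₁ := Metric.ball_subset_ball hδδ₁
  have hbτ : Metric.ball (0 : ℝ) δ ⊆ Metric.ball 0 δ₁ := Metric.ball_subset_ball hδδ₁
  have hbr : Metric.ball p δ ⊆ Metric.ball p r := Metric.ball_subset_ball hδr
  have hTΦ : ∀ x ∈ Metric.ball p δ, ∀ τ ∈ Metric.ball (0 : ℝ) δ, T (Φ (x, τ)) = T x + τ := by
    intro x hx τ hτ
    have hd : ∀ σ ∈ Metric.ball (0 : ℝ) δ, HasDerivAt (fun σ => T (Φ (x, σ)) - σ) 0 σ := by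
      intro σ hσ
      have hm := hstay x hx σ hσ
      have h1 := (hTd _ (hr4 hm)).comp_hasDerivAt σ (hΦd x (hbx hx) σ (hbτ hσ))
      rw [hfv hm, hηv _ (hball (hr4 hm))] at h1
      exact (h1.sub (hasDerivAt_id σ)).congr_deriv (sub_self 1)
    have h2 := Metric.isOpen_ball.is_const_of_deriv_eq_zero (convex_ball (0 : ℝ) δ).isPreconnected
      (fun σ hσ => (hd σ hσ).differentiableAt.differentiableWithinAt)
      (fun σ hσ => (hd σ hσ).deriv) hτ (Metric.mem_ball_self hδ)
    simp only [hΦ0 x (hbx hx)] at h2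
    linarith
  have hηp : η p ≠ 0 := fun h => by simpa [h] using hηv p hp
  obtain ⟨L⟩ : Nonempty (EuclideanSpace ℝ (Fin m) ≃L[ℝ] LinearMap.ker (η p).toLinearMap) := by
    refine FiniteDimensional.nonempty_continuousLinearEquiv_of_finrank_eq ?_
    have h1 := Module.Dual.finrank_ker_add_one_of_ne_zero (f := (η p).toLinearMap)
      (fun h => hηp (ContinuousLinearMap.coe_injective h))
    simp only [finrank_euclideanSpace, Fintype.card_fin] at h1 ⊢
    omega
  set ℓ : EuclideanSpace ℝ (Fin (m + 1)) →L[ℝ] EuclideanSpace ℝ (Fin (m + 1)) :=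
    (Submodule.subtypeL (LinearMap.ker (η p).toLinearMap)).comp
      (L.toContinuousLinearMap.comp (tailL m)) with hℓ
  have hℓη : ∀ w, η p (ℓ w) = 0 := fun w => (L (tailL m w)).2
  have hℓ0 : ℓ (EuclideanSpace.single 0 1) = 0 := by
    have : tailL m (EuclideanSpace.single 0 1) = 0 := by
      ext i; simp [tailL_apply]
    simp [hℓ, this]
  -- Starting at `p + ℓ x` in the hyperplane `p + ker η_p`, the flow runs for exactly the time that
  -- brings it to the level `T = x 0`. As `ℓ` ignores `x 0`, changing `x 0` moves along a flow line.
  set F : EuclideanSpace ℝ (Fin (m + 1)) → EuclideanSpace ℝ (Fin (m + 1)) :=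
    fun x => Φ (p + ℓ x, x 0 - T (p + ℓ x)) with hF
  have hproj : ContDiff ℝ ∞ fun x : EuclideanSpace ℝ (Fin (m + 1)) => x 0 :=
    contDiff_euclidean.1 contDiff_id 0
  have hbase : ContDiff ℝ ∞ fun x => p + ℓ x := contDiff_const.add ℓ.contDiff
  have hD₁ : IsOpen ((fun x => p + ℓ x) ⁻¹' Metric.ball p δ) :=
    Metric.isOpen_ball.preimage hbase.continuous
  have harg : ContDiffOn ℝ ∞ (fun x => x 0 - T (p + ℓ x)) ((fun x => p + ℓ x) ⁻¹' Metric.ball p δ) :=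
    hproj.contDiffOn.sub (hTs.comp hbase.contDiffOn fun x hx => hbr hx)
  set D := ((fun x => p + ℓ x) ⁻¹' Metric.ball p δ) ∩
    (fun x => x 0 - T (p + ℓ x)) ⁻¹' Metric.ball (0 : ℝ) δ with hDdef
  have hD : IsOpen D := harg.continuousOn.isOpen_inter_preimage hD₁ Metric.isOpen_ball
  have h0D : (0 : EuclideanSpace ℝ (Fin (m + 1))) ∈ D := by
    simp [hDdef, hT0, hδ]
  have hFs : ContDiffOn ℝ ∞ F D := hΦs.comp
    (hbase.contDiffOn.prodMk (harg.mono Set.inter_subset_left))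
    fun x hx => ⟨hbx hx.1, hbτ hx.2⟩
  have hF0 : F 0 = p := by simp [hF, hT0, hΦ0 p (Metric.mem_ball_self hδ₁)]
  have hFd : ∀ x ∈ D, HasFDerivAt F (fderiv ℝ F x) x := fun x hx =>
    ((hFs.contDiffAt (hD.mem_nhds hx)).differentiableAt (by simp)).hasFDerivAt
  have hFstay : ∀ x ∈ D, F x ∈ Metric.ball p (r / 4) := fun x hx => hstay _ hx.1 _ hx.2
  have hTF : ∀ x ∈ D, T (F x) = x 0 := fun x hx => by
    rw [hF]; simp only; rw [hTΦ _ hx.1 _ hx.2]; ring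
  have hηF : ∀ x ∈ D, ∀ w, η (F x) (fderiv ℝ F x w) = w 0 := by
    intro x hx w
    have h1 := (hTd _ (hr4 (hFstay x hx))).comp x (hFd x hx)
    have h2 : HasFDerivAt (T ∘ F) (EuclideanSpace.proj (𝕜 := ℝ) (0 : Fin (m + 1))) x := by
      refine (EuclideanSpace.proj (𝕜 := ℝ) (0 : Fin (m + 1))).hasFDerivAt.congr_of_eventuallyEq ?_
      filter_upwards [hD.mem_nhds hx] with y hy using hTF y hy
    have h3 := congrArg (fun M => M w) (h1.unique h2)
    simpa using h3
  have hFv : ∀ x ∈ D, fderiv ℝ F x (EuclideanSpace.single 0 1) = v (F x) := by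
    intro x hx
    have h1 : HasDerivAt (fun s : ℝ => F (x + s • EuclideanSpace.single 0 1))
        (fderiv ℝ F x (EuclideanSpace.single 0 1)) 0 := by
      have h2 : HasDerivAt (fun s : ℝ => x + s • EuclideanSpace.single (0 : Fin (m + 1)) (1 : ℝ))
          (EuclideanSpace.single 0 1) 0 := by
        simpa using ((hasDerivAt_id (0 : ℝ)).smul_const
          (EuclideanSpace.single (0 : Fin (m + 1)) (1 : ℝ))).const_add x
      refine HasFDerivAt.comp_hasDerivAt (l := F) (0 : ℝ) ?_ h2
      simpa using hFd x hx
    have h3 : (fun s : ℝ => F (x + s • EuclideanSpace.single 0 1)) =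
        fun s => Φ (p + ℓ x, (x 0 - T (p + ℓ x)) + s) := by
      funext s
      simp only [hF, map_add, map_smul, hℓ0, smul_zero, add_zero]
      congr 2
      simp
      ring
    rw [h3] at h1
    have h4 := hΦd (p + ℓ x) (hbx hx.1) (x 0 - T (p + ℓ x)) (hbτ hx.2)
    rw [← hfv (hFstay x hx)]
    refine h1.unique (HasDerivAt.comp_const_add (f := fun σ => Φ (p + ℓ x, σ))
      (x 0 - T (p + ℓ x)) 0 ?_)
    simpa using h4
  have hinj : Function.Injective (fderiv ℝ F 0) := by
    rw [injective_iff_map_eq_zero]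
    intro w hw
    have hw0 : w 0 = 0 := by rw [← hηF 0 h0D w, hw, map_zero]
    -- At the origin the derivative is `w ↦ ℓ w + (w 0) f(p)`. With `w 0 = 0` already known, its
    -- kernel is governed by `ℓ`, which is injective on the last `m` coordinates.
    have hP : HasFDerivAt F ((ContinuousLinearMap.fst ℝ _ ℝ +
        (ContinuousLinearMap.snd ℝ _ ℝ).smulRight (f p)).comp
        (ℓ.prod (EuclideanSpace.proj (𝕜 := ℝ) (0 : Fin (m + 1)) - (η p).comp ℓ))) 0 := by
      have h1 := hasFDerivAt_flow_zero hδ₁ hΦs hΦ0 (w := f p) (by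
        simpa [hΦ0 p (Metric.mem_ball_self hδ₁)] using
          hΦd p (Metric.mem_ball_self hδ₁) 0 (Metric.mem_ball_self hδ₁))
      have hb : HasFDerivAt (fun x => p + ℓ x) ℓ 0 := ℓ.hasFDerivAt.const_add p
      have hT' : HasFDerivAt (fun x => T (p + ℓ x)) ((η p).comp ℓ) 0 := by
        refine HasFDerivAt.comp (0 : EuclideanSpace ℝ (Fin (m + 1))) (g := T) ?_ hb
        simpa using hTd p (Metric.mem_ball_self hr)
      refine HasFDerivAt.comp (0 : EuclideanSpace ℝ (Fin (m + 1))) (g := Φ)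
        (f := fun x => (p + ℓ x, x 0 - T (p + ℓ x))) ?_
        (hb.prodMk ((EuclideanSpace.proj (𝕜 := ℝ) (0 : Fin (m + 1))).hasFDerivAt.sub hT'))
      simpa [hT0] using h1
    rw [hP.fderiv] at hw
    have hℓw : ℓ w = 0 := by simpa [hℓη, hw0] using hw
    have htail : tailL m w = 0 := by
      have : L (tailL m w) = 0 := Subtype.ext hℓw
      simpa using this
    rw [← consPoint_tailL w, hw0, htail]
    ext i
    refine Fin.cases ?_ (fun j => ?_) i <;> rfl
  set Λ := (LinearEquiv.ofInjectiveEndo (fderiv ℝ F 0).toLinearMap hinj).toContinuousLinearEquiv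
    with hΛ
  have hΛF : HasFDerivAt F (Λ : EuclideanSpace ℝ (Fin (m + 1)) →L[ℝ] _) 0 := by
    convert hFd 0 h0D using 1
    ext1 w
    rfl
  obtain ⟨φ₀, h0φ, hφD, hφF, hφsymm⟩ := exists_openPartialHomeomorph_of_contDiffOn hD hFs h0D hΛF
  obtain ⟨ε, hε, hbox⟩ : ∃ ε > 0, {x : EuclideanSpace ℝ (Fin (m + 1)) | x 0 ∈ Set.Ioo (-ε) ε ∧
      tailL m x ∈ Metric.ball 0 ε} ⊆ φ₀.source := by
    have hopen : IsOpen (consPoint ⁻¹' φ₀.source) :=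
      φ₀.open_source.preimage (contDiff_consPoint (m := m)).continuous
    have h00 : ((0 : ℝ), (0 : EuclideanSpace ℝ (Fin m))) ∈ consPoint ⁻¹' φ₀.source := by
      have := consPoint_tailL (0 : EuclideanSpace ℝ (Fin (m + 1)))
      rw [map_zero] at this
      rw [Set.mem_preimage]
      exact this ▸ h0φ
    obtain ⟨ε, hε, h⟩ := Metric.isOpen_iff.1 hopen _ h00
    refine ⟨ε, hε, fun x hx => ?_⟩
    rw [← consPoint_tailL x]
    refine h ?_
    rw [← ball_prod_same]
    refine ⟨?_, hx.2⟩
    simpa [Real.ball_eq_Ioo] using hx.1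
  have hboxO : IsOpen {x : EuclideanSpace ℝ (Fin (m + 1)) | x 0 ∈ Set.Ioo (-ε) ε ∧
      tailL m x ∈ Metric.ball 0 ε} :=
    (isOpen_Ioo.preimage hproj.continuous).inter
      (Metric.isOpen_ball.preimage (tailL m).continuous)
  have hcoe : ⇑φ₀ = F := funext hφF
  refine ⟨φ₀.restrOpen _ hboxO, ε, hε, ?_, ?_, ?_, ?_, ?_, ?_⟩
  · have h0 : (0 : EuclideanSpace ℝ (Fin (m + 1))) ∈ (φ₀.restrOpen _ hboxO).source :=
      ⟨h0φ, by simp [hε]⟩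
    have := (φ₀.restrOpen _ hboxO).map_source h0
    change φ₀ 0 ∈ _ at this
    rwa [hφF, hF0] at this
  · intro y hy
    have hy1 : y ∈ φ₀.target := hy.1
    have := hFstay _ (hφD (φ₀.map_target hy1))
    rw [← hφF, φ₀.right_inv hy1] at this
    exact hball (hr4 this)
  · exact Set.inter_eq_right.2 hbox
  · change ContDiffOn ℝ ∞ φ₀ _
    rw [hcoe]
    exact hFs.mono fun x hx => hφD hx.1
  · exact hφsymm.mono fun y hy => hy.1
  · intro x hx
    have hxD := hφD hx.1
    change fderiv ℝ φ₀ x _ = v (φ₀ x) ∧ ∀ w, η (φ₀ x) (fderiv ℝ φ₀ x w) = w 0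
    rw [hcoe]
    exact ⟨hFv x hxD, hηF x hxD⟩
end

noncomputable section

namespace LorentzianMetric

variable {n : ℕ} {M : Type*} [TopologicalSpace M] [ChartedSpace (EuclideanSpace ℝ (Fin n)) M]
  [IsManifold (𝓡 n) ∞ M] {g : LorentzianMetric n M} {u : ∀ p : M, TangentSpace (𝓡 n) p}
  {e : OpenPartialHomeomorph M (EuclideanSpace ℝ (Fin n))} {x : EuclideanSpace ℝ (Fin n)}

/-! ### Components in a chart -/

/-- A nonzero vector orthogonal to a time-like vector is space-like. -/
theorem inner_self_pos_of_orthogonal {p : M} {v w : TangentSpace (𝓡 n) p} (hv : g.inner p v v < 0)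
    (hvw : g.inner p v w = 0) (hw : w ≠ 0) : 0 < g.inner p w w := by
  obtain ⟨z, hz, hpos⟩ := g.lorentzian p
  by_contra hneg
  push Not at hneg
  set a := g.inner p z w with ha
  set b := g.inner p z v with hb
  -- The combination is chosen orthogonal to `z`. If `w` were not space-like its square would be
  -- nonpositive, so it would vanish; this forces `a = 0`, and then `w` itself is orthogonal to `z`.
  have h1 : g.inner p z (a • v - b • w) = 0 := by
    simp only [map_sub, map_smul, smul_eq_mul, ← ha, ← hb]; ring
  have hwv : g.inner p w v = 0 := by rw [g.symm, hvw]
  have h2 : g.inner p (a • v - b • w) (a • v - b • w) =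
      a ^ 2 * g.inner p v v + b ^ 2 * g.inner p w w := by
    simp only [map_sub, map_smul, smul_eq_mul, sub_apply, smul_apply, hvw, hwv]
    ring
  have h3 : g.inner p (a • v - b • w) (a • v - b • w) ≤ 0 := by
    rw [h2]; nlinarith [sq_nonneg a, sq_nonneg b]
  have h4 : a • v - b • w = 0 := by
    by_contra hne
    exact absurd (hpos _ h1 hne) (not_lt.2 h3)
  have ha0 : a = 0 := by
    rw [h4] at h2
    simp only [map_zero] at h2
    have : a ^ 2 * g.inner p v v = 0 := by nlinarith [sq_nonneg a, sq_nonneg b]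
    simpa [hv.ne] using this
  have := hpos w ha0 hw
  linarith

theorem inner_eq_zero_imp {p : M} {w : TangentSpace (𝓡 n) p} (h : ∀ v, g.inner p v w = 0) :
    w = 0 := by
  obtain ⟨z, -, hpos⟩ := g.lorentzian p
  by_contra hw
  exact (hpos w (h z) hw).ne' (h w)

omit [IsManifold (𝓡 n) ∞ M] in
theorem mdifferentiable_of_mem_maximalAtlas (he : e ∈ IsManifold.maximalAtlas (𝓡 n) ∞ M) :
    e.MDifferentiable (𝓡 n) (𝓡 n) :=
  ⟨(contMDiffOn_of_mem_maximalAtlas he).mdifferentiableOn (by simp),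
    (contMDiffOn_symm_of_mem_maximalAtlas he).mdifferentiableOn (by simp)⟩

/-- The tangent vector with components `w` in the chart `e` at the point with coordinates `x`. -/
def chartVec (e : OpenPartialHomeomorph M (EuclideanSpace ℝ (Fin n)))
    (x : EuclideanSpace ℝ (Fin n)) :
    EuclideanSpace ℝ (Fin n) →L[ℝ] TangentSpace (𝓡 n) (e.symm x) :=
  mfderiv (𝓡 n) (𝓡 n) e.symm x

/-- The components in the chart `e` of tangent vectors at the point with coordinates `x`. -/
def chartComp (e : OpenPartialHomeomorph M (EuclideanSpace ℝ (Fin n)))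
    (x : EuclideanSpace ℝ (Fin n)) :
    TangentSpace (𝓡 n) (e.symm x) →L[ℝ] EuclideanSpace ℝ (Fin n) :=
  mfderiv (𝓡 n) (𝓡 n) e (e.symm x)

omit [IsManifold (𝓡 n) ∞ M] in
theorem coordVector_eq (i : Fin n) :
    coordVector e x i = chartVec e x (EuclideanSpace.single i 1) := rfl

omit [IsManifold (𝓡 n) ∞ M] in
theorem vecComp_eq : vecComp u e x = (chartComp e x (u (e.symm x))).ofLp := rfl

omit [IsManifold (𝓡 n) ∞ M] in
theorem chartComp_chartVec (he : e ∈ IsManifold.maximalAtlas (𝓡 n) ∞ M) (hx : x ∈ e.target)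
    (w : EuclideanSpace ℝ (Fin n)) : chartComp e x (chartVec e x w) = w := by
  have := (mdifferentiable_of_mem_maximalAtlas he).comp_symm_deriv hx
  exact congrArg (fun L => L w) this

omit [IsManifold (𝓡 n) ∞ M] in
theorem chartVec_chartComp (he : e ∈ IsManifold.maximalAtlas (𝓡 n) ∞ M) (hx : x ∈ e.target)
    (w : TangentSpace (𝓡 n) (e.symm x)) : chartVec e x (chartComp e x w) = w := by
  have h1 : Function.Surjective (chartVec e x) :=
    (mdifferentiable_of_mem_maximalAtlas he).symm.mfderiv_surjective hx
  obtain ⟨z, rfl⟩ := h1 w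
  rw [chartComp_chartVec he hx]

omit [IsManifold (𝓡 n) ∞ M] in
theorem chartVec_eq_sum (w : EuclideanSpace ℝ (Fin n)) :
    chartVec e x w = ∑ i, w i • coordVector e x i := by
  simp only [coordVector_eq, ← map_smul, ← map_sum]
  congr 1
  ext j
  simp [Finset.sum_apply, Pi.single_apply]

omit [IsManifold (𝓡 n) ∞ M] in
theorem chartVec_vecComp (he : e ∈ IsManifold.maximalAtlas (𝓡 n) ∞ M) (hx : x ∈ e.target) :
    chartVec e x (WithLp.toLp 2 (vecComp u e x)) = u (e.symm x) :=
  chartVec_chartComp he hx _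

theorem inner_chartVec (w : EuclideanSpace ℝ (Fin n)) (v : TangentSpace (𝓡 n) (e.symm x)) :
    g.inner (e.symm x) (chartVec e x w) v =
      ∑ i, w i * g.inner (e.symm x) (coordVector e x i) v := by
  rw [chartVec_eq_sum]
  simp

theorem lowComp_eq (he : e ∈ IsManifold.maximalAtlas (𝓡 n) ∞ M) (hx : x ∈ e.target) (i : Fin n) :
    g.lowComp u e i x = g.inner (e.symm x) (coordVector e x i) (u (e.symm x)) := by
  have h := inner_chartVec (g := g) (e := e) (WithLp.toLp 2 (vecComp u e x)) (coordVector e x i)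
  rw [chartVec_vecComp he hx] at h
  rw [g.symm, h]
  change ∑ k, g.comp e x i k * vecComp u e x k = _
  refine Finset.sum_congr rfl fun k _ => ?_
  rw [g.symm, mul_comm]
  rfl

theorem inner_chartVec_vec (he : e ∈ IsManifold.maximalAtlas (𝓡 n) ∞ M) (hx : x ∈ e.target)
    (w : EuclideanSpace ℝ (Fin n)) :
    g.inner (e.symm x) (chartVec e x w) (u (e.symm x)) = ∑ i, w i * g.lowComp u e i x := by
  simp only [inner_chartVec, lowComp_eq he hx]

theorem comp_apply_comm (i j : Fin n) : g.comp e x i j = g.comp e x j i := g.symm _ _ _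

theorem isUnit_det_comp (he : e ∈ IsManifold.maximalAtlas (𝓡 n) ∞ M) (hx : x ∈ e.target) :
    IsUnit (g.comp e x).det := by
  rw [← Matrix.isUnit_iff_isUnit_det, ← Matrix.mulVec_injective_iff_isUnit,
    ← Matrix.coe_mulVecLin, injective_iff_map_eq_zero]
  intro w hw
  have h0 : ∀ i, g.inner (e.symm x) (coordVector e x i) (chartVec e x (WithLp.toLp 2 w)) = 0 := by
    intro i
    have h := congrFun hw i
    change ∑ k, g.comp e x i k * w k = 0 at h
    rw [g.symm, inner_chartVec, ← h]
    refine Finset.sum_congr rfl fun k _ => ?_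
    rw [g.symm, mul_comm]
    rfl
  have h1 : chartVec e x (WithLp.toLp 2 w) = 0 := by
    refine inner_eq_zero_imp (g := g) fun v => ?_
    rw [← chartVec_chartComp he hx v, inner_chartVec]
    exact Finset.sum_eq_zero fun i _ => by rw [h0, mul_zero]
  have h2 := chartComp_chartVec he hx (WithLp.toLp 2 w)
  rw [h1, map_zero] at h2
  exact (congrArg WithLp.ofLp h2).symm

theorem contMDiffOn_coordVector (he : e ∈ IsManifold.maximalAtlas (𝓡 n) ∞ M) (i : Fin n) :
    ContMDiffOn 𝓘(ℝ, EuclideanSpace ℝ (Fin n)) (𝓡 n).tangent ∞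
      (fun x => (⟨e.symm x, coordVector e x i⟩ : TangentBundle (𝓡 n) M)) e.target := by
  have h1 : ContMDiffOn 𝓘(ℝ, EuclideanSpace ℝ (Fin n)) 𝓘(ℝ, EuclideanSpace ℝ (Fin n)).tangent ∞
      (fun x => (⟨x, EuclideanSpace.single i (1 : ℝ)⟩ :
        TangentBundle 𝓘(ℝ, EuclideanSpace ℝ (Fin n)) (EuclideanSpace ℝ (Fin n)))) e.target :=
    contMDiffOn_vectorSpace_iff_contDiffOn.2 contDiffOn_const
  have h2 := (contMDiffOn_symm_of_mem_maximalAtlas he).contMDiffOn_tangentMapWithin (m := ∞)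
    (by simp) e.open_target.uniqueMDiffOn
  refine (h2.comp h1 fun x hx => hx).congr fun x hx => ?_
  simp only [Function.comp, tangentMapWithin, coordVector]
  rw [mfderivWithin_of_isOpen e.open_target hx]

theorem contDiffOn_vecComp (he : e ∈ IsManifold.maximalAtlas (𝓡 n) ∞ M)
    (hu : ContMDiff (𝓡 n) (𝓡 n).tangent ∞ (fun p => (⟨p, u p⟩ : TangentBundle (𝓡 n) M))) :
    ContDiffOn ℝ ∞ (fun x => WithLp.toLp 2 (vecComp u e x)) e.target := by
  have h1 : ContMDiffOn 𝓘(ℝ, EuclideanSpace ℝ (Fin n)) (𝓡 n).tangent ∞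
      (fun x => (⟨e.symm x, u (e.symm x)⟩ : TangentBundle (𝓡 n) M)) e.target :=
    hu.comp_contMDiffOn (contMDiffOn_symm_of_mem_maximalAtlas he)
  have h2 := (contMDiffOn_of_mem_maximalAtlas he).contMDiffOn_tangentMapWithin (m := ∞)
    (by simp) e.open_source.uniqueMDiffOn
  refine contMDiffOn_vectorSpace_iff_contDiffOn.1
    ((h2.comp h1 fun x hx => e.map_target hx).congr fun x hx => ?_)
  simp only [Function.comp, tangentMapWithin]
  rw [mfderivWithin_of_isOpen e.open_source (e.map_target hx)]
  exact Bundle.TotalSpace.ext (e.right_inv hx).symm HEq.rfl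

theorem contDiffOn_comp (he : e ∈ IsManifold.maximalAtlas (𝓡 n) ∞ M) (i j : Fin n) :
    ContDiffOn ℝ ∞ (fun x => g.comp e x i j) e.target := by
  rw [← contMDiffOn_iff_contDiffOn]
  have h : ContMDiffOn 𝓘(ℝ, EuclideanSpace ℝ (Fin n)) ((𝓡 n).prod 𝓘(ℝ)) ∞
      (fun x => Bundle.TotalSpace.mk' ℝ (E := Bundle.Trivial M ℝ) (e.symm x)
        (g.inner (e.symm x) (coordVector e x i) (coordVector e x j))) e.target := by
    apply ContMDiffOn.clm_bundle_apply₂ (F₁ := EuclideanSpace ℝ (Fin n))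
      (F₂ := EuclideanSpace ℝ (Fin n))
    · exact g.contMDiff.comp_contMDiffOn (contMDiffOn_symm_of_mem_maximalAtlas he)
    · exact contMDiffOn_coordVector he i
    · exact contMDiffOn_coordVector he j
  intro x hx
  have h1 := h x hx
  simp only [Bundle.contMDiffWithinAt_totalSpace] at h1
  exact h1.2

/-! ### The fluid equations in a chart -/

theorem isMetricOn_comp (he : e ∈ IsManifold.maximalAtlas (𝓡 n) ∞ M) :
    Coord.IsMetricOn (g.comp e) e.target where
  isOpen := e.open_target
  smooth := contDiffOn_comp he
  symm _ _ := Matrix.ext fun _ _ => comp_apply_comm _ _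
  isUnit_det _ hx := isUnit_det_comp he hx

theorem sum_vecComp_mul_lowComp (hunit : ∀ p, g.inner p (u p) (u p) = -1)
    (he : e ∈ IsManifold.maximalAtlas (𝓡 n) ∞ M) (hx : x ∈ e.target) :
    ∑ k, vecComp u e x k * g.lowComp u e k x = -1 := by
  rw [← hunit (e.symm x), ← inner_chartVec_vec he hx (WithLp.toLp 2 (vecComp u e x)),
    chartVec_vecComp he hx]

variable {A B : M → ℝ}

theorem isFluidOn_comp
    (hu : ContMDiff (𝓡 n) (𝓡 n).tangent ∞ (fun p => (⟨p, u p⟩ : TangentBundle (𝓡 n) M)))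
    (hunit : ∀ p, g.inner p (u p) (u p) = -1)
    (hAB : ∀ e ∈ IsManifold.maximalAtlas (𝓡 n) ∞ M, ∀ x ∈ e.target, ∀ k l,
      Coord.ricci (g.comp e) k l x =
        A (e.symm x) * g.comp e x k l + B (e.symm x) * (g.lowComp u e k x * g.lowComp u e l x))
    (he : e ∈ IsManifold.maximalAtlas (𝓡 n) ∞ M) :
    Coord.IsFluidOn (g.comp e) (vecComp u e) (fun x => A (e.symm x)) (fun x => B (e.symm x))
      e.target where
  toIsMetricOn := isMetricOn_comp he
  smooth_vec := contDiffOn_euclidean.1 (contDiffOn_vecComp he hu)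
  unit _ hx := sum_vecComp_mul_lowComp hunit he hx
  ricci_eq := hAB e he

omit [IsManifold (𝓡 n) ∞ M] in
theorem contMDiff_of_charts {f : M → ℝ} [IsManifold (𝓡 n) ∞ M]
    (hf : ∀ e ∈ IsManifold.maximalAtlas (𝓡 n) ∞ M,
      ContDiffOn ℝ ∞ (fun x => f (e.symm x)) e.target) : ContMDiff (𝓡 n) 𝓘(ℝ, ℝ) ∞ f := by
  intro p
  have he := IsManifold.chart_mem_maximalAtlas (I := 𝓡 n) (n := ∞) p
  have h1 := ((hf _ he).contMDiffOn.comp (contMDiffOn_of_mem_maximalAtlas he)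
    (fun y hy => (chartAt _ p).map_source hy)).congr (f₁ := f) (fun y hy => by
      simp only [Function.comp]; rw [(chartAt _ p).left_inv hy])
  exact h1.contMDiffAt ((chartAt (EuclideanSpace ℝ (Fin n)) p).open_source.mem_nhds
    (mem_chart_source _ p))

/-- The derivative `u(f)` of a function along a vector field. -/
def velDeriv (u : ∀ p : M, TangentSpace (𝓡 n) p) (f : M → ℝ) (p : M) : ℝ :=
  mfderiv (𝓡 n) 𝓘(ℝ, ℝ) f p (u p)

omit [IsManifold (𝓡 n) ∞ M] in
-- Identifies the derivatives along `u` found in charts with chart-free ones, so that the factor `φ`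
-- is one function on `M`.
theorem dirDeriv_comp_symm {f : M → ℝ} (hf : ContMDiff (𝓡 n) 𝓘(ℝ, ℝ) ∞ f)
    (he : e ∈ IsManifold.maximalAtlas (𝓡 n) ∞ M) (hx : x ∈ e.target) :
    Coord.dirDeriv (vecComp u e) (fun y => f (e.symm y)) x =
      velDeriv u f (e.symm x) := by
  have h1 : fderiv ℝ (fun y => f (e.symm y)) x =
      (mfderiv (𝓡 n) 𝓘(ℝ, ℝ) f (e.symm x)).comp (chartVec e x) := by
    rw [← mfderiv_eq_fderiv]
    exact mfderiv_comp x (hf.mdifferentiable (by simp) _)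
      ((mdifferentiable_of_mem_maximalAtlas he).mdifferentiableAt_symm hx)
  have h2 : Coord.dirDeriv (vecComp u e) (fun y => f (e.symm y)) x =
      fderiv ℝ (fun y => f (e.symm y)) x (WithLp.toLp 2 (vecComp u e x)) := by
    have : WithLp.toLp 2 (vecComp u e x) =
        ∑ k, vecComp u e x k • EuclideanSpace.single k (1 : ℝ) := by
      ext j
      simp [Finset.sum_apply, Pi.single_apply]
    rw [this, map_sum]
    simp only [map_smul, smul_eq_mul]
    rfl
  rw [h2, h1]
  change mfderiv (𝓡 n) 𝓘(ℝ, ℝ) f (e.symm x) (chartVec e x (WithLp.toLp 2 (vecComp u e x))) = _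
  rw [chartVec_vecComp he hx]
  rfl

theorem contMDiff_velDeriv {f : M → ℝ} (hf : ContMDiff (𝓡 n) 𝓘(ℝ, ℝ) ∞ f)
    (hu : ContMDiff (𝓡 n) (𝓡 n).tangent ∞ (fun p => (⟨p, u p⟩ : TangentBundle (𝓡 n) M))) :
    ContMDiff (𝓡 n) 𝓘(ℝ, ℝ) ∞ (velDeriv u f) := by
  refine contMDiff_of_charts fun e he => ?_
  have hfe : ContDiffOn ℝ ∞ (fun y => f (e.symm y)) e.target :=
    contMDiffOn_iff_contDiffOn.1 (hf.comp_contMDiffOn (contMDiffOn_symm_of_mem_maximalAtlas he))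
  refine ContDiffOn.congr (f := Coord.dirDeriv (vecComp u e) fun y => f (e.symm y)) ?_
    fun x hx => (dirDeriv_comp_symm hf he hx).symm
  exact ContDiffOn.sum fun k _ => (contDiffOn_euclidean.1 (contDiffOn_vecComp he hu) k).mul
    (Coord.contDiffOn_pd e.open_target hfe k)

end LorentzianMetric
end

/-! ### The warped product form of the metric in comoving coordinates. -/

noncomputable section

namespace Coord

variable {m n : ℕ}

theorem fderiv_apply_eq_sum (f : EuclideanSpace ℝ (Fin n) → ℝ) (x w : EuclideanSpace ℝ (Fin n)) :
    fderiv ℝ f x w = ∑ k, w k * pd k f x := by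
  have : w = ∑ k, w k • EuclideanSpace.single k (1 : ℝ) := by
    ext j
    simp [Finset.sum_apply, Pi.single_apply]
  conv_lhs => rw [this, map_sum]
  simp only [map_smul, smul_eq_mul]
  rfl

/-- The product of the interval `(-ε, ε)` and a ball. -/
def box (m : ℕ) (ε : ℝ) : Set (EuclideanSpace ℝ (Fin (m + 1))) :=
  {x | x 0 ∈ Set.Ioo (-ε) ε ∧ tailL m x ∈ Metric.ball 0 ε}

theorem convex_box (ε : ℝ) : Convex ℝ (box m ε) :=
  ((convex_Ioo (-ε) ε).linear_preimage
    (EuclideanSpace.proj (𝕜 := ℝ) (0 : Fin (m + 1))).toLinearMap).inter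
    ((convex_ball (0 : EuclideanSpace ℝ (Fin m)) ε).linear_preimage (tailL m).toLinearMap)

/-- The box is convex, and the segment joining two points of equal time has a purely spatial
direction. -/
theorem eq_of_pd_succ_eq_zero {ε : ℝ} {f : EuclideanSpace ℝ (Fin (m + 1)) → ℝ}
    (hf : ∀ x ∈ box m ε, DifferentiableAt ℝ f x)
    (hd : ∀ x ∈ box m ε, ∀ μ : Fin m, pd μ.succ f x = 0)
    {x y : EuclideanSpace ℝ (Fin (m + 1))} (hx : x ∈ box m ε) (hy : y ∈ box m ε)
    (hxy : x 0 = y 0) : f x = f y := by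
  have hmem : ∀ s ∈ Set.Icc (0 : ℝ) 1, x + s • (y - x) ∈ box m ε := fun s hs =>
    (convex_box ε).add_smul_sub_mem hx hy hs
  have hder : ∀ s ∈ Set.Icc (0 : ℝ) 1,
      HasDerivWithinAt (fun s : ℝ => f (x + s • (y - x))) 0 (Set.Icc 0 1) s := by
    intro s hs
    have h1 : HasDerivAt (fun s : ℝ => x + s • (y - x)) (y - x) s := by
      simpa using ((hasDerivAt_id s).smul_const (y - x)).const_add x
    have h2 := (hf _ (hmem s hs)).hasFDerivAt.comp_hasDerivAt s h1
    rw [fderiv_apply_eq_sum, Fin.sum_univ_succ] at h2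
    simp only [hd _ (hmem s hs), mul_zero, Finset.sum_const_zero, add_zero, PiLp.sub_apply, hxy,
      sub_self, zero_mul] at h2
    exact h2.hasDerivWithinAt
  have h := (convex_Icc (0 : ℝ) 1).norm_image_sub_le_of_norm_hasDerivWithin_le (C := 0) hder
    (fun s _ => by simp) (Set.left_mem_Icc.2 zero_le_one) (Set.right_mem_Icc.2 zero_le_one)
  simp only [zero_mul, norm_le_zero_iff, sub_eq_zero] at h
  simpa using h.symm

theorem consPoint_mem_box {ε t : ℝ} {y : EuclideanSpace ℝ (Fin m)} (ht : t ∈ Set.Ioo (-ε) ε)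
    (hy : y ∈ Metric.ball 0 ε) : consPoint (t, y) ∈ box m ε := ⟨ht, hy⟩

theorem hasDerivAt_consPoint {f : EuclideanSpace ℝ (Fin (m + 1)) → ℝ} {t : ℝ}
    {y : EuclideanSpace ℝ (Fin m)} (hf : DifferentiableAt ℝ f (consPoint (t, y))) :
    HasDerivAt (fun s => f (consPoint (s, y))) (pd 0 f (consPoint (t, y))) t := by
  have h1 : HasDerivAt (fun s : ℝ => consPoint (s, y))
      (EuclideanSpace.single (0 : Fin (m + 1)) (1 : ℝ)) t := by
    have h2 : (fun s : ℝ => consPoint (s, y)) = fun s =>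
        consPoint (0, y) + s • EuclideanSpace.single (0 : Fin (m + 1)) (1 : ℝ) := by
      funext s
      ext i
      refine Fin.cases ?_ (fun j => ?_) i <;> simp [consPoint]
    rw [h2]
    simpa using ((hasDerivAt_id t).smul_const
      (EuclideanSpace.single (0 : Fin (m + 1)) (1 : ℝ))).const_add (consPoint (0, y))
  exact hf.hasFDerivAt.comp_hasDerivAt t h1

variable {G : EuclideanSpace ℝ (Fin (m + 1)) → Matrix (Fin (m + 1)) (Fin (m + 1)) ℝ}
  {v : EuclideanSpace ℝ (Fin (m + 1)) → Fin (m + 1) → ℝ}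
  {A B : EuclideanSpace ℝ (Fin (m + 1)) → ℝ} {ε : ℝ}

/-- In coordinates comoving with a geodesic perfect fluid, the spatial part of the metric is a
multiple, depending only on time, of its value at time zero. -/
theorem IsFluidOn.exists_scale (h : IsFluidOn G v A B (box m ε)) (hε : 0 < ε) (hn : 3 < m + 1)
    (hW : ∀ y ∈ box m ε, ∀ k l, ∑ j, v y j * divWeyl G j k l y = 0)
    (hgeo : ∀ y ∈ box m ε, ∀ j, ∑ k, v y k * covLower G v k j y = 0)
    (hB : ∀ y ∈ box m ε, B y ≠ 0) (hv : ∀ y ∈ box m ε, v y = Pi.single 0 1)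
    (hG : ∀ y ∈ box m ε, ∀ μ : Fin m, G y μ.succ 0 = 0)
    (hpos : ∀ y ∈ box m ε, ∀ μ : Fin m, 0 < G y μ.succ μ.succ) :
    ∃ a : ℝ → ℝ, ContDiffOn ℝ ∞ a (Set.Ioo (-ε) ε) ∧ (∀ t ∈ Set.Ioo (-ε) ε, 0 < a t) ∧
      ∀ x ∈ box m ε, ∀ μ ν : Fin m, G x μ.succ ν.succ =
        a (x 0) ^ 2 * G (consPoint (0, tailL m x)) μ.succ ν.succ := by
  have hO := h.isOpen
  have hlow : ∀ y ∈ box m ε, ∀ i, lower G v i y = G y i 0 := fun y hy i => by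
    simp [lower, hv y hy, Pi.single_apply]
  have hdir : ∀ f, ∀ y ∈ box m ε, dirDeriv v f y = pd 0 f y := fun f y hy => by
    simp [dirDeriv, hv y hy, Pi.single_apply]
  obtain ⟨hAs, hBs⟩ := h.contDiffOn_coeff (by omega)
  have hpA : ∀ y ∈ box m ε, ∀ μ : Fin m, pd μ.succ A y = 0 ∧ pd μ.succ B y = 0 := by
    intro y hy μ
    obtain ⟨h1, h2⟩ := h.pd_coeff hn hW hgeo hy μ.succ
    simp only [hlow y hy, hG y hy, zero_mul, neg_zero] at h1 h2
    exact ⟨h1, h2⟩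
  -- If `f` depends on time only, so does `∂_t f`, because `∂_μ ∂_t f = ∂_t ∂_μ f = 0`.
  have hslice : ∀ f : EuclideanSpace ℝ (Fin (m + 1)) → ℝ, ContDiffOn ℝ ∞ f (box m ε) →
      (∀ y ∈ box m ε, ∀ μ : Fin m, pd μ.succ f y = 0) → ∀ y ∈ box m ε, ∀ z ∈ box m ε,
      y 0 = z 0 → f y = f z ∧ pd 0 f y = pd 0 f z := by
    intro f hf hd y hy z hz hyz
    refine ⟨eq_of_pd_succ_eq_zero (fun x hx => differentiableAt_of_contDiffOn hO hf hx) hd hy hz hyz,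
      eq_of_pd_succ_eq_zero (fun x hx => differentiableAt_of_contDiffOn hO
        (contDiffOn_pd hO hf 0) hx) (fun x hx μ => ?_) hy hz hyz⟩
    rw [pd_pd_comm hO hf hx, pd_congr hO hx (fun w hw => hd w hw μ), pd_const]
  set φ : EuclideanSpace ℝ (Fin (m + 1)) → ℝ := fun y => -(pd 0 A y -
    1 / (2 * (((m + 1 : ℕ) : ℝ) - 1)) * (((m + 1 : ℕ) : ℝ) * pd 0 A y - pd 0 B y)) / B y with hφ
  have hφslice : ∀ y ∈ box m ε, ∀ z ∈ box m ε, y 0 = z 0 → φ y = φ z := by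
    intro y hy z hz hyz
    obtain ⟨-, h1⟩ := hslice A hAs (fun w hw μ => (hpA w hw μ).1) y hy z hz hyz
    obtain ⟨h2, h3⟩ := hslice B hBs (fun w hw μ => (hpA w hw μ).2) y hy z hz hyz
    simp only [hφ, h1, h2, h3]
  have hder : ∀ y ∈ box m ε, ∀ μ ν : Fin m,
      pd 0 (fun z => G z μ.succ ν.succ) y = 2 * φ y * G y μ.succ ν.succ := by
    intro y hy μ ν
    have hp0 : ∀ k (κ : Fin m), pd k (fun z => G z κ.succ 0) y = 0 := fun k κ => by
      rw [pd_congr hO hy (fun w hw => hG w hw κ), pd_const]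
    -- The covector `v_i = g_{i0}` has zero spatial components, so only `-Γ_{0μν}` with its index
    -- lowered survives, and `g_{0μ} = 0` reduces it to `½ ∂_t g_{μν}`.
    have h1 : covLower G v μ.succ ν.succ y = 1 / 2 * pd 0 (fun z => G z μ.succ ν.succ) y := by
      have h2 : pd μ.succ (lower G v ν.succ) y = 0 := by
        rw [pd_congr hO hy (fun w hw => hlow w hw ν.succ), hp0]
      have h3 : ∑ q, christoffel G q μ.succ ν.succ y * lower G v q y =
          ∑ q, G y 0 q * christoffel G q μ.succ ν.succ y :=
        Finset.sum_congr rfl fun q _ => by rw [hlow y hy, h.apply_comm hy, mul_comm]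
      rw [covLower, h2, h3, h.sum_mul_christoffel hy, h.pd_comm hy 0 ν.succ, h.pd_comm hy 0 μ.succ,
        hp0, hp0]
      ring
    have h4 := h.neg_mul_covLower hn hW hgeo hy μ.succ ν.succ
    rw [h1, hdir A y hy, hdir B y hy, hlow y hy, hG y hy, zero_mul, add_zero] at h4
    have hBy := hB y hy
    rw [hφ]
    simp only
    generalize 1 / (2 * (((m + 1 : ℕ) : ℝ) - 1)) = c at h4 ⊢
    field_simp
    linear_combination (-2) * h4
  have hdiff : ∀ y ∈ box m ε, ∀ i j, DifferentiableAt ℝ (fun z => G z i j) y := fun y hy i j =>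
    h.smooth.differentiableAt hO hy i j
  have h00 : (0 : EuclideanSpace ℝ (Fin m)) ∈ Metric.ball 0 ε := Metric.mem_ball_self hε
  have ht0 : (0 : ℝ) ∈ Set.Ioo (-ε) ε := ⟨by linarith, hε⟩
  let κ : Fin m := ⟨0, by omega⟩
  -- Any positive solution of `r' = 2φ r` serves as reference; a diagonal spatial component along
  -- the axis `y = 0` is one. With `a² = r(t)/r(0)`, the spatial metric `g*` is the slice at time
  -- zero.
  set r : ℝ → ℝ := fun t => G (consPoint (t, 0)) κ.succ κ.succ with hr
  have hrpos : ∀ t ∈ Set.Ioo (-ε) ε, 0 < r t := fun t ht => hpos _ (consPoint_mem_box ht h00) κ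
  have hrs : ContDiffOn ℝ ∞ r (Set.Ioo (-ε) ε) :=
    (h.smooth κ.succ κ.succ).comp
      (contDiff_consPoint.comp (contDiff_id.prodMk contDiff_const)).contDiffOn
      fun t ht => consPoint_mem_box ht h00
  have hquot : ∀ t ∈ Set.Ioo (-ε) ε, 0 < r t / r 0 := fun t ht => div_pos (hrpos t ht) (hrpos 0 ht0)
  refine ⟨fun t => Real.sqrt (r t / r 0), (hrs.div_const _).sqrt fun t ht => (hquot t ht).ne',
    fun t ht => Real.sqrt_pos.2 (hquot t ht), fun x hx μ ν => ?_⟩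
  rw [Real.sq_sqrt (hquot _ hx.1).le]
  -- Numerator and denominator satisfy the same linear equation, since `φ` has the same value at
  -- both points of the time slice.
  have hd : ∀ t ∈ Set.Ioo (-ε) ε,
      HasDerivAt (fun t => G (consPoint (t, tailL m x)) μ.succ ν.succ / r t) 0 t := by
    intro t ht
    have hm1 := consPoint_mem_box ht hx.2
    have hm2 := consPoint_mem_box ht h00
    have d1 := hasDerivAt_consPoint (hdiff _ hm1 μ.succ ν.succ)
    have d2 := hasDerivAt_consPoint (hdiff _ hm2 κ.succ κ.succ)
    refine (d1.div d2 (hrpos t ht).ne').congr_deriv ?_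
    rw [hder _ hm1, hder _ hm2, hφslice _ hm1 _ hm2 rfl]
    ring
  have hconst := isOpen_Ioo.is_const_of_deriv_eq_zero (isPreconnected_Ioo)
    (fun t ht => (hd t ht).differentiableAt.differentiableWithinAt)
    (fun t ht => (hd t ht).deriv) hx.1 ht0
  simp only [consPoint_tailL] at hconst
  have hr0 := (hrpos 0 ht0).ne'
  have hrx := (hrpos _ hx.1).ne'
  field_simp at hconst ⊢
  linarith

end Coord
end

/-! ### From coordinates to the manifold: curvature scalars and comoving charts. -/

noncomputable section

namespace LorentzianMetric

section Pointwise

variable {n : ℕ} {M : Type*} [TopologicalSpace M] [ChartedSpace (EuclideanSpace ℝ (Fin n)) M]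
  [IsManifold (𝓡 n) ∞ M] {g : LorentzianMetric n M} {u : ∀ p : M, TangentSpace (𝓡 n) p}
  {A B : M → ℝ}

theorem scalarCurvature_eq
    (hu : ContMDiff (𝓡 n) (𝓡 n).tangent ∞ (fun p => (⟨p, u p⟩ : TangentBundle (𝓡 n) M)))
    (hunit : ∀ p, g.inner p (u p) (u p) = -1)
    (hAB : ∀ e ∈ IsManifold.maximalAtlas (𝓡 n) ∞ M, ∀ x ∈ e.target, ∀ k l,
      Coord.ricci (g.comp e) k l x =
        A (e.symm x) * g.comp e x k l + B (e.symm x) * (g.lowComp u e k x * g.lowComp u e l x))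
    (p : M) : g.scalarCurvature p = n * A p - B p := by
  have h := (isFluidOn_comp hu hunit hAB (IsManifold.chart_mem_maximalAtlas p)).scalar_eq
    ((chartAt (EuclideanSpace ℝ (Fin n)) p).map_source (mem_chart_source _ p))
  rwa [(chartAt (EuclideanSpace ℝ (Fin n)) p).left_inv (mem_chart_source _ p)] at h

theorem ricciEigenvalue_eq
    (hu : ContMDiff (𝓡 n) (𝓡 n).tangent ∞ (fun p => (⟨p, u p⟩ : TangentBundle (𝓡 n) M)))
    (hunit : ∀ p, g.inner p (u p) (u p) = -1)
    (hAB : ∀ e ∈ IsManifold.maximalAtlas (𝓡 n) ∞ M, ∀ x ∈ e.target, ∀ k l,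
      Coord.ricci (g.comp e) k l x =
        A (e.symm x) * g.comp e x k l + B (e.symm x) * (g.lowComp u e k x * g.lowComp u e l x))
    {ξ : M → ℝ} (hξ : g.IsRicciEigenvector u ξ) (p : M) : ξ p = A p - B p := by
  have he := IsManifold.chart_mem_maximalAtlas (I := 𝓡 n) (n := ∞) p
  have hx := (chartAt (EuclideanSpace ℝ (Fin n)) p).map_source (mem_chart_source _ p)
  have h1 := (isFluidOn_comp hu hunit hAB he).sum_ricci_mul hx
  have h2 := hξ _ he _ hx
  have h3 := sum_vecComp_mul_lowComp hunit he hx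
  -- Some component `u_k` is nonzero because `u` is unit; the eigenvalue is read off there.
  obtain ⟨k, -, hk⟩ := Finset.exists_ne_zero_of_sum_ne_zero (h3.trans_ne (by norm_num))
  have h4 := (h1 k).symm.trans (h2 k)
  rw [(chartAt (EuclideanSpace ℝ (Fin n)) p).left_inv (mem_chart_source _ p)] at h4
  exact (mul_right_cancel₀ (right_ne_zero_of_mul hk) h4).symm

end Pointwise

section Comoving

variable {n : ℕ} {M : Type*} [TopologicalSpace M] [ChartedSpace (EuclideanSpace ℝ (Fin n)) M]
  [IsManifold (𝓡 n) ∞ M] {g : LorentzianMetric n M} {u : ∀ p : M, TangentSpace (𝓡 n) p}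
  {e : OpenPartialHomeomorph M (EuclideanSpace ℝ (Fin n))}

/-- Composing a chart with a diffeomorphism of open subsets of `ℝⁿ`. -/
theorem trans_symm_mem_maximalAtlas (he : e ∈ IsManifold.maximalAtlas (𝓡 n) ∞ M)
    {φ : OpenPartialHomeomorph (EuclideanSpace ℝ (Fin n)) (EuclideanSpace ℝ (Fin n))}
    (hφ : ContDiffOn ℝ ∞ φ φ.source) (hφs : ContDiffOn ℝ ∞ φ.symm φ.target) :
    e.trans φ.symm ∈ IsManifold.maximalAtlas (𝓡 n) ∞ M := by
  refine OpenPartialHomeomorph.mem_maximalAtlas_of_contMDiffOn (e.trans φ.symm) ?_ ?_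
  · exact hφs.contMDiffOn.comp ((contMDiffOn_of_mem_maximalAtlas he).mono Set.inter_subset_left)
      fun y hy => hy.2
  · exact (contMDiffOn_symm_of_mem_maximalAtlas he).comp (hφ.contMDiffOn.mono fun y hy => hy.1)
      fun y hy => hy.2

omit [IsManifold (𝓡 n) ∞ M] in
theorem chartVec_trans_symm (he : e ∈ IsManifold.maximalAtlas (𝓡 n) ∞ M)
    {φ : OpenPartialHomeomorph (EuclideanSpace ℝ (Fin n)) (EuclideanSpace ℝ (Fin n))}
    (hφ : ContDiffOn ℝ ∞ φ φ.source) {x : EuclideanSpace ℝ (Fin n)} (hx : x ∈ φ.source)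
    (hx' : φ x ∈ e.target) (w : EuclideanSpace ℝ (Fin n)) :
    chartVec (e.trans φ.symm) x w = chartVec e (φ x) (fderiv ℝ φ x w) := by
  have h1 : MDifferentiableAt (𝓡 n) (𝓡 n) φ x :=
    ((hφ.contDiffAt (φ.open_source.mem_nhds hx)).differentiableAt (by simp)).mdifferentiableAt
  have h2 := mfderiv_comp x
    ((mdifferentiable_of_mem_maximalAtlas he).mdifferentiableAt_symm hx') h1
  rw [mfderiv_eq_fderiv] at h2
  exact congrArg (fun L => L w) h2

end Comoving

variable {m : ℕ} {M : Type*} [TopologicalSpace M]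
  [ChartedSpace (EuclideanSpace ℝ (Fin (m + 1))) M] [IsManifold (𝓡 (m + 1)) ∞ M]
  {g : LorentzianMetric (m + 1) M} {u : ∀ p : M, TangentSpace (𝓡 (m + 1)) p}
  {e : OpenPartialHomeomorph M (EuclideanSpace ℝ (Fin (m + 1)))} {A B : M → ℝ}

/-- Comoving synchronous coordinates for a unit time-like field whose covariant derivative is
symmetric. -/
theorem exists_comoving_chart
    (hu : ContMDiff (𝓡 (m + 1)) (𝓡 (m + 1)).tangent ∞
      (fun p => (⟨p, u p⟩ : TangentBundle (𝓡 (m + 1)) M)))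
    (hunit : ∀ p, g.inner p (u p) (u p) = -1)
    (he : e ∈ IsManifold.maximalAtlas (𝓡 (m + 1)) ∞ M)
    {O : Set (EuclideanSpace ℝ (Fin (m + 1)))} (hO : IsOpen O) (hOe : O ⊆ e.target)
    (hsymm : ∀ x ∈ O, ∀ k l, Coord.covLower (g.comp e) (vecComp u e) k l x =
      Coord.covLower (g.comp e) (vecComp u e) l k x)
    {p : M} (hp : p ∈ e.source) (hpO : e p ∈ O) :
    ∃ e' ∈ IsManifold.maximalAtlas (𝓡 (m + 1)) ∞ M, ∃ ε > 0, p ∈ e'.source ∧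
      e'.target = Coord.box m ε ∧ (∀ x ∈ e'.target, e'.symm x ∈ e.symm '' O) ∧
      (∀ x ∈ e'.target, coordVector e' x 0 = u (e'.symm x)) ∧
      ∀ x ∈ e'.target, ∀ w,
        g.inner (e'.symm x) (chartVec e' x w) (u (e'.symm x)) = -w 0 := by
  have hG := isMetricOn_comp (g := g) he
  have hvs := contDiffOn_vecComp he hu
  have hls : ∀ i, ContDiffOn ℝ ∞ (g.lowComp u e i) e.target := fun i =>
    show ContDiffOn ℝ ∞ (fun x => ∑ k, g.comp e x i k * vecComp u e x k) e.target from
      ContDiffOn.sum fun k _ => (contDiffOn_comp he i k).mul (contDiffOn_euclidean.1 hvs k)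
  -- The sign makes `η(u) = 1`. Symmetry of `∇u` gives closedness, as the Christoffel terms are
  -- symmetric and cancel.
  set η : EuclideanSpace ℝ (Fin (m + 1)) → EuclideanSpace ℝ (Fin (m + 1)) →L[ℝ] ℝ :=
    fun a => ∑ i, (-g.lowComp u e i a) • EuclideanSpace.proj (𝕜 := ℝ) i with hη
  have hη_apply : ∀ a w, η a w = -∑ i, w i * g.lowComp u e i a := fun a w => by
    simp [hη, mul_comm]
  have hηs : ContDiffOn ℝ ∞ η O := ContDiffOn.sum fun i _ =>
    ((hls i).neg.smul contDiffOn_const).mono hOe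
  have hclosed : ∀ a ∈ O, ∀ x y, fderiv ℝ η a x y = fderiv ℝ η a y x := by
    intro a ha x y
    have hld : ∀ i, DifferentiableAt ℝ (g.lowComp u e i) a := fun i =>
      Coord.differentiableAt_of_contDiffOn e.open_target (hls i) (hOe ha)
    have hpd : ∀ k l, Coord.pd k (g.lowComp u e l) a = Coord.pd l (g.lowComp u e k) a := by
      intro k l
      have h := hsymm a ha k l
      simp only [Coord.covLower, hG.christoffel_comm (hOe ha) _ k l] at h
      exact sub_left_inj.1 h
    have hd : HasFDerivAt η (∑ i, (-fderiv ℝ (g.lowComp u e i) a).smulRight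
        (EuclideanSpace.proj (𝕜 := ℝ) i)) a :=
      HasFDerivAt.fun_sum fun i _ => (hld i).hasFDerivAt.neg.smul_const
        (EuclideanSpace.proj (𝕜 := ℝ) i : EuclideanSpace ℝ (Fin (m + 1)) →L[ℝ] ℝ)
    have hd' : ∀ x y, fderiv ℝ η a x y =
        -∑ i, ∑ k, x k * y i * Coord.pd k (g.lowComp u e i) a := by
      intro x y
      rw [hd.fderiv]
      simp only [sum_apply, ContinuousLinearMap.smulRight_apply,
        neg_apply, smul_apply, PiLp.proj_apply,
        smul_eq_mul, Coord.fderiv_apply_eq_sum, ← Finset.sum_neg_distrib, Finset.sum_mul]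
      exact Finset.sum_congr rfl fun i _ => Finset.sum_congr rfl fun k _ => by ring
    rw [hd', hd', Finset.sum_comm]
    congr 1
    exact Finset.sum_congr rfl fun i _ => Finset.sum_congr rfl fun k _ => by rw [hpd]; ring
  obtain ⟨φ, ε, hε, hpφ, hφO, hφsrc, hφ, hφs, hφd⟩ := exists_flowBox hO (hvs.mono hOe) hηs
    hclosed (fun a ha => by
      rw [hη_apply, neg_eq_iff_eq_neg]
      exact sum_vecComp_mul_lowComp hunit he (hOe ha)) hpO
  have htgt : (e.trans φ.symm).target = φ.source :=
    Set.inter_eq_left.2 fun x hx => hOe (hφO (φ.map_source hx))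
  have hmem : ∀ x ∈ (e.trans φ.symm).target, x ∈ φ.source ∧ φ x ∈ e.target := fun x hx => hx
  refine ⟨e.trans φ.symm, trans_symm_mem_maximalAtlas he hφ hφs, ε, hε, ⟨hp, hpφ⟩,
    htgt.trans hφsrc, fun x hx => ⟨φ x, hφO (φ.map_source (hmem x hx).1), rfl⟩,
    fun x hx => ?_, fun x hx w => ?_⟩
  · obtain ⟨h1, h2⟩ := hmem x hx
    rw [coordVector_eq, chartVec_trans_symm he hφ h1 h2, (hφd x h1).1]
    exact chartVec_vecComp he h2
  · obtain ⟨h1, h2⟩ := hmem x hx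
    have h3 := (hφd x h1).2 w
    rw [hη_apply, neg_eq_iff_eq_neg] at h3
    rw [← h3, chartVec_trans_symm he hφ h1 h2]
    exact inner_chartVec_vec he h2 _

/-- A chart comoving with the velocity of a geodesic perfect fluid exhibits the metric as a
warped product. -/
theorem isGRWNear_of_comoving_chart (hm : 3 < m + 1)
    (hunit : ∀ p, g.inner p (u p) (u p) = -1)
    (hW : g.ContractedDivWeylVanishes u) (hgeo : g.IsGeodesicField u)
    (he : e ∈ IsManifold.maximalAtlas (𝓡 (m + 1)) ∞ M)
    (hF : Coord.IsFluidOn (g.comp e) (vecComp u e) (fun x => A (e.symm x))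
      (fun x => B (e.symm x)) e.target)
    (hB : ∀ x ∈ e.target, B (e.symm x) ≠ 0) {ε : ℝ} (hε : 0 < ε)
    (htgt : e.target = Coord.box m ε)
    (h0 : ∀ x ∈ e.target, coordVector e x 0 = u (e.symm x))
    (hperp : ∀ x ∈ e.target, ∀ w,
      g.inner (e.symm x) (chartVec e x w) (u (e.symm x)) = -w 0)
    {p : M} (hp : p ∈ e.source) : g.IsGRWNear p := by
  -- Spatial vectors are orthogonal to the time-like `u`, hence space-like; this gives both the
  -- positive reference component and a Riemannian `g*`.
  have hpos : ∀ x ∈ e.target, ∀ w : EuclideanSpace ℝ (Fin (m + 1)), w 0 = 0 → w ≠ 0 →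
      0 < g.inner (e.symm x) (chartVec e x w) (chartVec e x w) := by
    intro x hx w hw0 hw
    refine inner_self_pos_of_orthogonal (v := u (e.symm x)) (by rw [hunit]; norm_num) ?_ ?_
    · rw [g.symm, hperp x hx, hw0, neg_zero]
    · intro h
      have := chartComp_chartVec he hx w
      rw [h, map_zero] at this
      exact hw this.symm
  have hG0 : ∀ x ∈ e.target, ∀ i, g.comp e x i 0 = -(EuclideanSpace.single i (1 : ℝ)) 0 := by
    intro x hx i
    rw [← hperp x hx, ← h0 x hx]
    rfl
  have hG : ∀ x ∈ e.target, ∀ μ : Fin m, g.comp e x μ.succ 0 = 0 := fun x hx μ => by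
    rw [hG0 x hx]; simp
  have hv : ∀ x ∈ e.target, vecComp u e x = Pi.single 0 1 := by
    intro x hx
    rw [vecComp_eq, ← h0 x hx, coordVector_eq, chartComp_chartVec he hx]
    rfl
  rw [htgt] at hF
  obtain ⟨a, has, hapos, ha⟩ := hF.exists_scale hε hm (htgt ▸ hW e he) (htgt ▸ hgeo e he)
    (htgt ▸ hB) (htgt ▸ hv) (htgt ▸ hG) (fun x hx μ => hpos x (htgt ▸ hx) _ (by simp) (by simp))
  have ht0 : (0 : ℝ) ∈ Set.Ioo (-ε) ε := ⟨by linarith, hε⟩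
  refine ⟨e, he, hp, Set.Ioo (-ε) ε, Metric.ball 0 ε, a,
    fun y => Matrix.of fun μ ν => g.comp e (consPoint (0, y)) μ.succ ν.succ, isOpen_Ioo,
    Set.ordConnected_Ioo, Metric.isOpen_ball, htgt, has, hapos, fun μ ν => ?_, fun y hy => ?_,
    fun x hx => ⟨?_, fun μ => ⟨?_, hG x hx μ⟩, fun μ ν => ha x (htgt ▸ hx) μ ν⟩⟩
  · exact (contDiffOn_comp he μ.succ ν.succ).comp
      (contDiff_consPoint.comp (contDiff_const.prodMk contDiff_id)).contDiffOn
      fun y hy => htgt ▸ Coord.consPoint_mem_box ht0 hy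
  · have hx : consPoint (0, y) ∈ e.target := htgt ▸ Coord.consPoint_mem_box ht0 hy
    refine Matrix.posDef_iff_dotProduct_mulVec.2
      ⟨Matrix.ext fun μ ν => comp_apply_comm _ _, fun z hz => ?_⟩
    have h1 := hpos _ hx (consPoint (0, WithLp.toLp 2 z)) rfl fun h => hz <| by
      funext μ
      exact congrArg (fun w : EuclideanSpace ℝ (Fin (m + 1)) => w μ.succ) h
    refine h1.trans_eq ?_
    rw [inner_chartVec, Fin.sum_univ_succ]
    have h2 : consPoint (0, WithLp.toLp 2 z) (0 : Fin (m + 1)) = 0 := rfl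
    rw [h2, zero_mul, zero_add]
    refine Finset.sum_congr rfl fun μ _ => congrArg (z μ * ·) ?_
    rw [g.symm, inner_chartVec, Fin.sum_univ_succ, h2, zero_mul, zero_add]
    refine Finset.sum_congr rfl fun ν _ => ?_
    rw [g.symm, mul_comm]
    rfl
  · rw [hG0 x hx]; simp
  · rw [comp_apply_comm, hG x hx]

end LorentzianMetric
end

/-! ### The main theorem. -/

noncomputable section
open LorentzianMetric

theorem mainTheorem3 {m : ℕ} (hm : 3 < m + 1) {M : Type*} [TopologicalSpace M]
    [ChartedSpace (EuclideanSpace ℝ (Fin (m + 1))) M] [IsManifold (𝓡 (m + 1)) ∞ M]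
    (g : LorentzianMetric (m + 1) M)
    (u : ∀ p : M, TangentSpace (𝓡 (m + 1)) p)
    (hu : ContMDiff (𝓡 (m + 1)) (𝓡 (m + 1)).tangent ∞
      (fun p => (⟨p, u p⟩ : TangentBundle (𝓡 (m + 1)) M)))
    (hunit : ∀ p, g.inner p (u p) (u p) = -1)
    (hpf : g.IsPerfectFluid u)
    (ξ : M → ℝ) (hξ : g.IsRicciEigenvector u ξ)
    (hW : g.ContractedDivWeylVanishes u)
    (hgeo : g.IsGeodesicField u) :
    g.IsTorseFormingOn u {p | g.scalarCurvature p ≠ ((m + 1 : ℕ) : ℝ) * ξ p} ∧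
    (∀ p, g.scalarCurvature p ≠ ((m + 1 : ℕ) : ℝ) * ξ p → g.IsGRWNear p) ∧
    (∀ p, g.scalarCurvature p = ((m + 1 : ℕ) : ℝ) * ξ p → g.IsEinsteinAt p) := by
  obtain ⟨A, B, hAB⟩ := hpf
  have hF := fun e he => isFluidOn_comp hu hunit hAB (e := e) he
  have hA : ContMDiff (𝓡 (m + 1)) 𝓘(ℝ, ℝ) ∞ A :=
    contMDiff_of_charts fun e he => ((hF e he).contDiffOn_coeff (by omega)).1
  have hB : ContMDiff (𝓡 (m + 1)) 𝓘(ℝ, ℝ) ∞ B :=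
    contMDiff_of_charts fun e he => ((hF e he).contDiffOn_coeff (by omega)).2
  have hscal := scalarCurvature_eq hu hunit hAB
  have hn0 : ((m + 1 : ℕ) : ℝ) ≠ 0 := by positivity
  -- From `R = nA - B` and `ξ = A - B` one gets `R - nξ = (n - 1) B`.
  have hiff : ∀ p, g.scalarCurvature p = ((m + 1 : ℕ) : ℝ) * ξ p ↔ B p = 0 := by
    intro p
    rw [hscal, ricciEigenvalue_eq hu hunit hAB hξ]
    have hm0 : (3 : ℝ) < ((m + 1 : ℕ) : ℝ) := by exact_mod_cast hm
    constructor
    · intro h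
      have : (((m + 1 : ℕ) : ℝ) - 1) * B p = 0 := by linarith
      exact (mul_eq_zero.1 this).resolve_left (by linarith)
    · intro h
      rw [h]; ring
  simp only [hiff, ne_eq]
  set φ : M → ℝ := fun p => -(velDeriv u A p - 1 / (2 * (((m + 1 : ℕ) : ℝ) - 1)) *
    (((m + 1 : ℕ) : ℝ) * velDeriv u A p - velDeriv u B p)) / B p with hφ
  have hcov : ∀ e ∈ IsManifold.maximalAtlas (𝓡 (m + 1)) ∞ M, ∀ x ∈ e.target,
      B (e.symm x) ≠ 0 → ∀ j k, Coord.covLower (g.comp e) (vecComp u e) j k x =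
        φ (e.symm x) * (g.comp e x j k + g.lowComp u e j x * g.lowComp u e k x) := by
    intro e he x hx hBx j k
    have h1 := (hF e he).neg_mul_covLower hm (hW e he) (hgeo e he) hx j k
    simp only [dirDeriv_comp_symm hA he hx, dirDeriv_comp_symm hB he hx] at h1
    rw [hφ]
    simp only [lowComp]
    generalize 1 / (2 * (((m + 1 : ℕ) : ℝ) - 1)) = c at h1 ⊢
    field_simp
    linear_combination -h1
  refine ⟨⟨φ, ?_, fun e he x hx hxU => hcov e he x hx hxU⟩, fun p hp => ?_,
    fun p hp e he hpe k l => ?_⟩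
  · have h1 := contMDiff_velDeriv hA hu
    have h2 := contMDiff_velDeriv hB hu
    have h3 : ContMDiff (𝓡 (m + 1)) 𝓘(ℝ, ℝ) ∞ fun p => -(velDeriv u A p -
        1 / (2 * (((m + 1 : ℕ) : ℝ) - 1)) *
        (((m + 1 : ℕ) : ℝ) * velDeriv u A p - velDeriv u B p)) :=
      (h1.sub (contMDiff_const.mul ((contMDiff_const.mul h1).sub h2))).neg
    exact h3.contMDiffOn.div₀ hB.contMDiffOn fun p hp => hp
  · have he0 := IsManifold.chart_mem_maximalAtlas (I := 𝓡 (m + 1)) (n := ∞) p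
    set e0 := chartAt (EuclideanSpace ℝ (Fin (m + 1))) p
    have hp0 : p ∈ e0.source := mem_chart_source _ p
    -- The comoving chart is built inside the open set `B ≠ 0`, the only place where `∇u` is known
    -- to be symmetric.
    have hO : IsOpen (e0.target ∩ e0.symm ⁻¹' {q | B q ≠ 0}) :=
      e0.symm.isOpen_inter_preimage (isOpen_ne.preimage hB.continuous)
    obtain ⟨e, he, ε, hε, hpe, htgt, hsub, h0, hperp⟩ := exists_comoving_chart hu hunit he0 hO
      Set.inter_subset_left (fun x hx k l => by
        rw [hcov e0 he0 x hx.1 hx.2, hcov e0 he0 x hx.1 hx.2, comp_apply_comm,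
          mul_comm (g.lowComp u e0 k x)]) hp0
      ⟨e0.map_source hp0, by simpa [e0.left_inv hp0] using hp⟩
    refine isGRWNear_of_comoving_chart hm hunit hW hgeo he (hF e he) (fun x hx => ?_) hε htgt h0
      hperp hpe
    obtain ⟨y, hy, hxy⟩ := hsub x hx
    exact hxy ▸ hy.2
  · rw [hAB e he _ (e.map_source hpe), e.left_inv hpe, hscal, hp]
    field_simp
    ring

end
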